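/- **Setting.** Let $n\ge 1$ and $l\ge 0$ be integers. Points of the half-plane are written $x=(r,z)$. For an open set $U\subset\{r>0\}$ let $L^2_r(U)=\{u:\int_U u^2\,r\,dr\,dz<\infty\}$, and, with derivatives in the sense of distributions on $U$, $$\mathbf{grad}^n u=\begin{pmatrix}\partial_r u\\-\frac nr u\\ \partial_z u\end{pmatrix},\qquad \mathbf{curl}^n\begin{pmatrix}v_r\\v_\theta\\v_z\end{pmatrix}=\begin{pmatrix}-(\frac nr v_z+\partial_z v_\theta)\\ \partial_z v_r-\partial_r v_z\\ \frac{n v_r+v_\theta}{r}+\partial_r v_\theta\end{pmatrix},\qquad \mathrm{div}^n\begin{pmatrix}w_r\\w_\theta\\w_z\end{pmatrix}=\partial_r w_r+\frac{w_r-n w_\theta}{r}+\partial_z w_z .$$ Let $H_r(\mathbf{grad}^n,U)$, $\boldsymbol H_r(\mathbf{curl}^n,U)$, $\boldsymbol H_r(\mathrm{div}^n,U)$ be the spaces of $L^2_r$-fields on $U$ whose image under the respective operator is in $L^2_r$; denote these spaces by $V^0(U),V^1(U),V^2(U)$, put $V^3(U)=L^2_r(U)$, and write $d^0=\mathbf{grad}^n$,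 $d^1=\mathbf{curl}^n$, $d^2=\mathrm{div}^n$. Let $\Omega\subset\{r>0\}$ be open with a conforming triangulation $\mathscr T$ (finitely many nondegenerate closed triangles with union $\overline\Omega$, any two meeting in a common face or not at all), let $h$ be the largest diameter of a triangle, let $\delta>0$ and $\rho=h\delta$. For a mesh vertex $a$ let $D_a=\{y: r(y)\ge 0,\ |y-a|\le\rho\}$, let $P_l$ be the space of polynomials in $(r,z)$ of degree at most $l$, let $\eta_a\in P_l$ be the polynomial with $\int_{D_a} r^3\eta_a\,p\,dr\,dz=p(a)$ for all $p\in P_l$, and let $\kappa_a(y)=r(y)^3\eta_a(y)$. Let $\widetilde\Omega$ be open with $\Omega\subset\widetilde\Omega\subset\{r>0\}$, containing the interior of the convex hull of $D_{a_1}\cup D_{a_2}\cup D_{a_3}$ for every triangle $[a_1,a_2,a_3]$ of $\mathscr T$. Let $E^k:V^k(\Omega)\to V^k(\widetilde\Omega)$, $k=0,\dots,3$, be extension operators: $E^ku=u$ a.e. on $\Omega$, $d^kE^k=E^{k+1}d^k$ for $k=0,1,2$, and $\|E^ku\|_{L^2_r(\widetilde\Omega)}\le C\|u\|_{L^2_r(\Omega)}$.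 Whenever a field in $V^k(\Omega)$ is evaluated below at a point of $\widetilde\Omega$, its extension by $E^k$ is meant. **Smoothers.** For $x=(r,z)$ in a triangle $K=[a_1,a_2,a_3]$ of $\mathscr T$, with barycentric coordinates $\lambda_i(x)$, and $y_i\in D_{a_i}$, put $\tilde x=\tilde x_y(x)=\sum_{i}\lambda_i(x)y_i$ and $J=d\tilde x_y/dx$, and write $$\langle f\rangle=\int_{D_{a_1}}\int_{D_{a_2}}\int_{D_{a_3}}\kappa_{a_1}(y_1)\kappa_{a_2}(y_2)\kappa_{a_3}(y_3)\,f\;dy_3\,dy_2\,dy_1 .$$ Define $S^g,S^c,S^d,S^o$ on $V^0(\Omega),V^1(\Omega),V^2(\Omega),V^3(\Omega)$ by $$S^gu(x)=\tfrac rn\Big\langle\big(\tfrac{nu}{r}\big)(\tilde x)\Big\rangle,\qquad S^ou(x)=\big\langle\det J\;u(\tilde x)\big\rangle,$$ $$S^cv(x)=\begin{pmatrix}\tfrac rn P_r-\tfrac1n\langle v_\theta(\tilde x)\rangle\\ \langle v_\theta(\tilde x)\rangle\\ \tfrac rn P_z\end{pmatrix},\qquad \begin{pmatrix}P_r\\P_z\end{pmatrix}=\left\langle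 J^{T}\begin{pmatrix}\frac{nv_r+v_\theta}{r}(\tilde x)\\ \frac{nv_z}{r}(\tilde x)\end{pmatrix}\right\rangle,$$ $$S^dw(x)=\begin{pmatrix}Q_r\\ \tfrac1n Q_r+\tfrac rn\big\langle\det J\,\big(\tfrac{nw_\theta-w_r}{r}\big)(\tilde x)\big\rangle\\ Q_z\end{pmatrix},\qquad \begin{pmatrix}Q_r\\Q_z\end{pmatrix}=\left\langle\det J\;J^{-1}\begin{pmatrix}w_r(\tilde x)\\w_z(\tilde x)\end{pmatrix}\right\rangle .$$ **Proposition.** The smoothers satisfy a commuting diagram property: $S^g,S^c,S^d$ map $V^0(\Omega),V^1(\Omega),V^2(\Omega)$ into themselves, and, as identities of fields on $\Omega$, $$\mathbf{grad}^n(S^gu)=S^c(\mathbf{grad}^nu)\quad\text{for all }u\in H_r(\mathbf{grad}^n,\Omega),$$ $$\mathbf{curl}^n(S^c v)=S^d(\mathbf{curl}^n v)\quad\text{for all } v\in\boldsymbol H_r(\mathbf{curl}^n,\Omega),$$ $$\mathrm{div}^n(S^d w)=S^o(\mathrm{div}^n w)\quad\text{for all } w\in\boldsymbol H_r(\mathrm{div}^n,\Omega),$$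 both sides being fields in $L^2_r(\Omega)$ in each case. -/

import Mathlib

open MeasureTheory Set
open scoped ContDiff Matrix

noncomputable section

/-- Points `x = (r, z)` of the meridian plane: `x 0` is the radial coordinate `r`,
`x 1` is the axial coordinate `z`. -/
abbrev Pt : Type := EuclideanSpace ℝ (Fin 2)

/-- Vectors of length three; the entries `0, 1, 2` are the `r`-, `θ`- and `z`-components. -/
abbrev Vec : Type := Fin 3 → ℝ

/-! ### Weighted spaces and the Fourier-mode operators in the sense of distributions

Functions on an open set `U ⊆ {r > 0}` are represented by functions on the whole plane
of which only the values on `U`, up to null sets, matter. -/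

/-- The measure `r dr dz` on `U`. -/
def rMeasure (U : Set Pt) : Measure Pt :=
  (volume.restrict U).withDensity fun x => ENNReal.ofReal (x 0)

/-- `u ∈ L²_r(U)`, for scalar fields. -/
def MemL2r (U : Set Pt) (u : Pt → ℝ) : Prop := MemLp u 2 (rMeasure U)

/-- `v ∈ L²_r(U) × L²_r(U) × L²_r(U)`, for vector fields. -/
def MemL2rVec (U : Set Pt) (v : Pt → Vec) : Prop := ∀ i, MemL2r U fun x => v x i

/-- `φ ∈ C_c^∞(U)`. -/
def IsTest (U : Set Pt) (φ : Pt → ℝ) : Prop :=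
  ContDiff ℝ ∞ φ ∧ HasCompactSupport φ ∧ tsupport φ ⊆ U

/-- Classical partial derivative: `pd 0 = ∂_r`, `pd 1 = ∂_z`. -/
def pd (i : Fin 2) (φ : Pt → ℝ) (x : Pt) : ℝ := fderiv ℝ φ x (EuclideanSpace.single i 1)

/-- `u ∈ H_r(grad^n, U)` and `grad^n_{rz} u = (∂_r u, -(n/r) u, ∂_z u) = g`. -/
structure HasGrad (n : ℕ) (U : Set Pt) (u : Pt → ℝ) (g : Pt → Vec) : Prop where
  mem : MemL2r U u
  mem_grad : MemL2rVec U g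
  eq_r : ∀ φ, IsTest U φ → ∫ x in U, g x 0 * φ x = -∫ x in U, u x * pd 0 φ x
  eq_θ : ∀ᵐ x ∂(volume.restrict U), g x 1 = -(n / x 0) * u x
  eq_z : ∀ φ, IsTest U φ → ∫ x in U, g x 2 * φ x = -∫ x in U, u x * pd 1 φ x

/-- `v ∈ H_r(curl^n, U)` and
`curl^n_{rz} v = (-((n/r) v_z + ∂_z v_θ), ∂_z v_r - ∂_r v_z, (n v_r + v_θ)/r + ∂_r v_θ) = w`. -/
structure HasCurl (n : ℕ) (U : Set Pt) (v w : Pt → Vec) : Prop where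
  mem : MemL2rVec U v
  mem_curl : MemL2rVec U w
  eq_r : ∀ φ, IsTest U φ →
    ∫ x in U, w x 0 * φ x = ∫ x in U, (-(n / x 0 * v x 2) * φ x + v x 1 * pd 1 φ x)
  eq_θ : ∀ φ, IsTest U φ →
    ∫ x in U, w x 1 * φ x = ∫ x in U, (-(v x 0 * pd 1 φ x) + v x 2 * pd 0 φ x)
  eq_z : ∀ φ, IsTest U φ →
    ∫ x in U, w x 2 * φ x
      = ∫ x in U, ((n * v x 0 + v x 1) / x 0 * φ x - v x 1 * pd 0 φ x)

/-- `w ∈ H_r(div^n, U)` and `div^n_{rz} w = ∂_r w_r + (w_r - n w_θ)/r + ∂_z w_z = f`. -/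
structure HasDiv (n : ℕ) (U : Set Pt) (w : Pt → Vec) (f : Pt → ℝ) : Prop where
  mem : MemL2rVec U w
  mem_div : MemL2r U f
  eq : ∀ φ, IsTest U φ →
    ∫ x in U, f x * φ x
      = ∫ x in U, (-(w x 0 * pd 0 φ x) + (w x 0 - n * w x 1) / x 0 * φ x
          - w x 2 * pd 1 φ x)

/-- Extension operators `E^k : V^k(Ω) → V^k(Ω')`, where `V⁰ = H_r(grad^n)`, `V¹ = H_r(curl^n)`,
`V² = H_r(div^n)`, `V³ = L²_r`, which extend, commute with `grad^n`, `curl^n`, `div^n`, and are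
bounded in the `L²_r`-norms. (Only the values of `E^k` on `V^k(Ω)` matter.) -/
structure ExtensionOperators (n : ℕ) (Ω Ω' : Set Pt) where
  E0 : (Pt → ℝ) → (Pt → ℝ)
  E1 : (Pt → Vec) → (Pt → Vec)
  E2 : (Pt → Vec) → (Pt → Vec)
  E3 : (Pt → ℝ) → (Pt → ℝ)
  mem_E3 : ∀ u, MemL2r Ω u → MemL2r Ω' (E3 u)
  ext0 : ∀ u g, HasGrad n Ω u g → E0 u =ᵐ[volume.restrict Ω] u
  ext1 : ∀ v w, HasCurl n Ω v w → E1 v =ᵐ[volume.restrict Ω] v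
  ext2 : ∀ w f, HasDiv n Ω w f → E2 w =ᵐ[volume.restrict Ω] w
  ext3 : ∀ u, MemL2r Ω u → E3 u =ᵐ[volume.restrict Ω] u
  comm_grad : ∀ u g, HasGrad n Ω u g → HasGrad n Ω' (E0 u) (E1 g)
  comm_curl : ∀ v w, HasCurl n Ω v w → HasCurl n Ω' (E1 v) (E2 w)
  comm_div : ∀ w f, HasDiv n Ω w f → HasDiv n Ω' (E2 w) (E3 f)
  C : NNReal
  bound0 : ∀ u g, HasGrad n Ω u g →
    eLpNorm (E0 u) 2 (rMeasure Ω') ≤ C * eLpNorm u 2 (rMeasure Ω)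
  bound1 : ∀ v w, HasCurl n Ω v w →
    eLpNorm (E1 v) 2 (rMeasure Ω') ≤ C * eLpNorm v 2 (rMeasure Ω)
  bound2 : ∀ w f, HasDiv n Ω w f →
    eLpNorm (E2 w) 2 (rMeasure Ω') ≤ C * eLpNorm w 2 (rMeasure Ω)
  bound3 : ∀ u, MemL2r Ω u →
    eLpNorm (E3 u) 2 (rMeasure Ω') ≤ C * eLpNorm u 2 (rMeasure Ω)

/-! ### Triangulations -/

/-- The closed triangle with vertices `K 0, K 1, K 2`. -/
def tri (K : Fin 3 → Pt) : Set Pt := convexHull ℝ (range K)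

/-- `T` is a conforming finite element triangulation of `Ω`: finitely many nondegenerate
triangles covering `closure Ω`, any two of which meet in a common face (a common vertex, a
common edge, or not at all), each listed with one ordering of its vertices. -/
structure IsTriangulation (Ω : Set Pt) (T : Finset (Fin 3 → Pt)) : Prop where
  nondegenerate : ∀ K ∈ T, AffineIndependent ℝ K
  cover : ⋃ K ∈ T, tri K = closure Ω
  conforming : ∀ K ∈ T, ∀ K' ∈ T, tri K ∩ tri K' = convexHull ℝ (range K ∩ range K')
  listed_once : ∀ K ∈ T, ∀ K' ∈ T, range K = range K' → K = K'

/-- The mesh size `h`, the largest diameter of a triangle. -/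
def meshSize (T : Finset (Fin 3 → Pt)) : ℝ := ⨆ K : {K // K ∈ T}, Metric.diam (tri K.1)

/-- Twice the signed area of the triangle with vertices `a, b, c`. -/
def area2 (a b c : Pt) : ℝ := (b 0 - a 0) * (c 1 - a 1) - (c 0 - a 0) * (b 1 - a 1)

/-- The barycentric coordinate `λ_i(x)` of `x` in the triangle `K`, as a quotient of areas
(see `sum_bary` and `sum_bary_smul`). -/
def bary (K : Fin 3 → Pt) (i : Fin 3) (x : Pt) : ℝ :=
  area2 x (K (i + 1)) (K (i + 2)) / area2 (K i) (K (i + 1)) (K (i + 2))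

theorem area2_ne_zero {K : Fin 3 → Pt} (h : AffineIndependent ℝ K) :
    area2 (K 0) (K 1) (K 2) ≠ 0 := by
  intro h0
  have key := affineIndependent_iff.1 h Finset.univ
  simp only [area2] at h0
  -- the coefficients of an affine dependence, tested on each coordinate
  have dep : ∀ c d : ℝ, c * (K 1 0 - K 0 0) + d * (K 2 0 - K 0 0) = 0 →
      c * (K 1 1 - K 0 1) + d * (K 2 1 - K 0 1) = 0 → c = 0 ∧ d = 0 := by
    intro c d h1 h2
    have := key ![-(c + d), c, d] (by simp [Fin.sum_univ_three]) (by
      ext i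
      fin_cases i
      · simp [Fin.sum_univ_three]; linarith
      · simp [Fin.sum_univ_three]; linarith)
    exact ⟨by simpa using this 1 (Finset.mem_univ _), by simpa using this 2 (Finset.mem_univ _)⟩
  have h1 := dep (K 2 0 - K 0 0) (-(K 1 0 - K 0 0)) (by ring) (by linarith)
  have h2 := dep (K 2 1 - K 0 1) (-(K 1 1 - K 0 1)) (by linarith) (by ring)
  have h3 := dep 1 0 (by linarith [h1.2]) (by linarith [h2.2])
  exact one_ne_zero h3.1

theorem bary_denom (K : Fin 3 → Pt) :
    area2 (K 1) (K 2) (K 0) = area2 (K 0) (K 1) (K 2) ∧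
      area2 (K 2) (K 0) (K 1) = area2 (K 0) (K 1) (K 2) := by
  constructor <;> simp only [area2] <;> ring

theorem sum_bary {K : Fin 3 → Pt} (h : AffineIndependent ℝ K) (x : Pt) :
    ∑ i, bary K i x = 1 := by
  have hne := area2_ne_zero h
  have e1 : ((1 : Fin 3) + 1) = 2 := rfl
  have e2 : ((1 : Fin 3) + 2) = 0 := rfl
  have e3 : ((2 : Fin 3) + 1) = 0 := rfl
  have e4 : ((2 : Fin 3) + 2) = 1 := rfl
  simp only [Fin.sum_univ_three, bary, e1, e2, e3, e4, zero_add, (bary_denom K).1,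
    (bary_denom K).2]
  rw [← add_div, ← add_div, div_eq_one_iff_eq hne]
  simp only [area2]; ring

theorem sum_bary_smul {K : Fin 3 → Pt} (h : AffineIndependent ℝ K) (x : Pt) :
    ∑ i, bary K i x • K i = x := by
  have hne := area2_ne_zero h
  have e1 : ((1 : Fin 3) + 1) = 2 := rfl
  have e2 : ((1 : Fin 3) + 2) = 0 := rfl
  have e3 : ((2 : Fin 3) + 1) = 0 := rfl
  have e4 : ((2 : Fin 3) + 2) = 1 := rfl
  have main : ∀ j : Fin 2, bary K 0 x * K 0 j + bary K 1 x * K 1 j + bary K 2 x * K 2 j = x j := by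
    intro j
    simp only [bary, e1, e2, e3, e4, zero_add, (bary_denom K).1, (bary_denom K).2]
    rw [div_mul_eq_mul_div, div_mul_eq_mul_div, div_mul_eq_mul_div, ← add_div, ← add_div,
      div_eq_iff hne]
    fin_cases j <;> simp only [area2] <;> simp <;> ring
  ext j
  simpa [Fin.sum_univ_three] using main j

/-! ### Smoothing disks and weights -/

/-- The closed disk of radius `ρ` around `a`, intersected with the half-plane `r ≥ 0`: a half
disk if `a` is on the axis, a full disk if `a` is at distance at least `ρ` from it. -/
def disk (ρ : ℝ) (a : Pt) : Set Pt := {y | 0 ≤ y 0} ∩ Metric.closedBall a ρ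

/-- The value of a polynomial in `(r, z)` at a point. -/
def pval (p : MvPolynomial (Fin 2) ℝ) (x : Pt) : ℝ := MvPolynomial.eval (fun i => x i) p

/-- `η ∈ P_l` and `(r η, r p)_{L²_r(D_a)} = p(a)` for all `p ∈ P_l`. -/
def IsEta (l : ℕ) (ρ : ℝ) (a : Pt) (η : MvPolynomial (Fin 2) ℝ) : Prop :=
  η.totalDegree ≤ l ∧ ∀ p : MvPolynomial (Fin 2) ℝ, p.totalDegree ≤ l →
    ∫ y in disk ρ a, (y 0 * pval η y) * (y 0 * pval p y) * y 0 = pval p a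

theorem continuous_pval (p : MvPolynomial (Fin 2) ℝ) : Continuous (pval p) := by
  have h : Continuous fun x : Pt => fun i : Fin 2 => x i := by fun_prop
  exact (MvPolynomial.continuous_eval p).comp h

theorem isCompact_disk (ρ : ℝ) (a : Pt) : IsCompact (disk ρ a) :=
  (isCompact_closedBall a ρ).inter_left
    (isClosed_le continuous_const (by fun_prop : Continuous fun y : Pt => y 0))

theorem integrableOn_disk {f : Pt → ℝ} (hf : Continuous f) (ρ : ℝ) (a : Pt) :
    IntegrableOn f (disk ρ a) :=
  hf.continuousOn.integrableOn_compact (isCompact_disk ρ a)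

/-- Polynomials are determined by the weighted inner product on the disk. -/
theorem eq_zero_of_integral_disk {ρ : ℝ} (hρ : 0 < ρ) {a : Pt} (ha : 0 ≤ a 0)
    (p : MvPolynomial (Fin 2) ℝ)
    (hp : ∫ y in disk ρ a, (y 0 * pval p y) * (y 0 * pval p y) * y 0 = 0) : p = 0 := by
  have hc := continuous_pval p
  have hcont : Continuous fun y : Pt => (y 0 * pval p y) * (y 0 * pval p y) * y 0 := by fun_prop
  have hmeas := (isCompact_disk ρ a).measurableSet
  have hae := (setIntegral_eq_zero_iff_of_nonneg_ae
    ((ae_restrict_iff' hmeas).2 (Filter.Eventually.of_forall fun y hy =>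
      mul_nonneg (mul_self_nonneg _) hy.1)) (integrableOn_disk hcont ρ a)).1 hp
  let c : Fin 2 → ℝ := ![a 0 + ρ / 2, a 1]
  let U : Set Pt := {y | ∀ i, |y i - c i| < ρ / 4}
  have hU : IsOpen U := by
    have : U = ⋂ i, {y : Pt | |y i - c i| < ρ / 4} := by ext; simp [U]
    rw [this]
    exact isOpen_iInter_of_finite fun i => isOpen_lt (by fun_prop) continuous_const
  have hUr : ∀ y ∈ U, 0 < y 0 := by
    intro y hy
    have := (abs_lt.1 (hy 0)).1
    simp [c] at this
    linarith
  have hUD : U ⊆ disk ρ a := by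
    intro y hy
    refine ⟨(hUr y hy).le, ?_⟩
    have h0 := abs_lt.1 (hy 0)
    have h1 := abs_lt.1 (hy 1)
    simp only [c, Matrix.cons_val_zero, Matrix.cons_val_one] at h0 h1
    rw [Metric.mem_closedBall, EuclideanSpace.dist_eq]
    apply Real.sqrt_le_iff.2 ⟨hρ.le, ?_⟩
    simp only [Fin.sum_univ_two, Real.dist_eq, sq_abs]
    nlinarith [h0.1, h0.2, h1.1, h1.2]
  have hae' : (fun y : Pt => (y 0 * pval p y) * (y 0 * pval p y) * y 0)
      =ᵐ[volume.restrict U] fun _ => 0 := ae_restrict_of_ae_restrict_of_subset hUD hae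
  have hEq := Measure.eqOn_open_of_ae_eq hae' hU hcont.continuousOn continuousOn_const
  refine MvPolynomial.funext_set (fun i => Ioo (c i - ρ / 4) (c i + ρ / 4))
    (fun i => Ioo_infinite (by linarith)) fun z hz => ?_
  have hzU : (WithLp.toLp 2 z : Pt) ∈ U := by
    intro i
    have := hz i (mem_univ i)
    rw [mem_Ioo] at this
    exact abs_lt.2 ⟨by simp only; linarith [this.1], by simp only; linarith [this.2]⟩
  have h1 := hEq hzU
  have h2 := (hUr _ hzU).ne'
  simp only [mul_eq_zero, h2, false_or, or_false, or_self] at h1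
  simpa [pval] using h1

theorem exists_eta (l : ℕ) {ρ : ℝ} (hρ : 0 < ρ) {a : Pt} (ha : 0 ≤ a 0) :
    ∃ η, IsEta l ρ a η := by
  let V := MvPolynomial.restrictTotalDegree (Fin 2) ℝ l
  have hint : ∀ p q : MvPolynomial (Fin 2) ℝ,
      IntegrableOn (fun y : Pt => (y 0 * pval p y) * (y 0 * pval q y) * y 0) (disk ρ a) := by
    intro p q
    have h1 := continuous_pval p
    have h2 := continuous_pval q
    exact integrableOn_disk (by fun_prop) ρ a
  let B : V →ₗ[ℝ] V →ₗ[ℝ] ℝ := LinearMap.mk₂ ℝ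
    (fun p q => ∫ y in disk ρ a, (y 0 * pval p.1 y) * (y 0 * pval q.1 y) * y 0)
    (fun p p' q => by
      rw [← integral_add (hint _ _) (hint _ _)]
      congr 1; ext y; simp [pval]; ring)
    (fun t p q => by
      rw [smul_eq_mul, ← integral_const_mul]
      congr 1; ext y; simp [pval]; ring)
    (fun p q q' => by
      rw [← integral_add (hint _ _) (hint _ _)]
      congr 1; ext y; simp [pval]; ring)
    (fun t p q => by
      rw [smul_eq_mul, ← integral_const_mul]
      congr 1; ext y; simp [pval]; ring)
  have hinj : Function.Injective B := by
    rw [← LinearMap.ker_eq_bot, LinearMap.ker_eq_bot']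
    intro p hp
    have : B p p = 0 := by rw [hp]; rfl
    exact Subtype.ext (eq_zero_of_integral_disk hρ ha p.1 this)
  have hsurj : Function.Surjective B :=
    (LinearMap.injective_iff_surjective_of_finrank_eq_finrank
      (Subspace.dual_finrank_eq (K := ℝ) (V := V)).symm).1 hinj
  let ev : V →ₗ[ℝ] ℝ :=
    { toFun := fun p => pval p.1 a
      map_add' := fun p q => by simp [pval]
      map_smul' := fun t p => by simp [pval] }
  obtain ⟨η, hη⟩ := hsurj ev
  refine ⟨η.1, (MvPolynomial.mem_restrictTotalDegree _ _ _).1 η.2, fun p hp => ?_⟩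
  exact LinearMap.congr_fun hη ⟨p, (MvPolynomial.mem_restrictTotalDegree _ _ _).2 hp⟩

open Classical in
/-- The polynomial `η_a`. -/
def eta (l : ℕ) (ρ : ℝ) (a : Pt) : MvPolynomial (Fin 2) ℝ :=
  if h : ∃ η, IsEta l ρ a η then h.choose else 0

theorem eta_spec (l : ℕ) {ρ : ℝ} (hρ : 0 < ρ) {a : Pt} (ha : 0 ≤ a 0) :
    IsEta l ρ a (eta l ρ a) := by
  have h := exists_eta l hρ ha
  rw [eta, dif_pos h]
  exact h.choose_spec

/-- The weight `κ(y) = r(y)³ η_a(y)`. -/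
def kappa (l : ℕ) (ρ : ℝ) (a y : Pt) : ℝ := y 0 ^ 3 * pval (eta l ρ a) y

/-- `∫_{D_{a₁}} ∫_{D_{a₂}} ∫_{D_{a₃}} κ₁(y₁) κ₂(y₂) κ₃(y₃) f(y₁, y₂, y₃) dy₃ dy₂ dy₁`
for the vertices `a₁, a₂, a₃` of `K`. -/
def avg (l : ℕ) (ρ : ℝ) (K : Fin 3 → Pt) (f : (Fin 3 → Pt) → ℝ) : ℝ :=
  ∫ y₁ in disk ρ (K 0), ∫ y₂ in disk ρ (K 1), ∫ y₃ in disk ρ (K 2),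
    kappa l ρ (K 0) y₁ * kappa l ρ (K 1) y₂ * kappa l ρ (K 2) y₃ * f ![y₁, y₂, y₃]

/-- `x̃_y(x, y₁, y₂, y₃) = ∑ λ_i(x) y_i`. -/
def xt (K y : Fin 3 → Pt) (x : Pt) : Pt := ∑ i, bary K i x • y i

/-- The Jacobian matrix `d x̃_y / d x`. -/
def jac (K y : Fin 3 → Pt) (x : Pt) : Matrix (Fin 2) (Fin 2) ℝ :=
  Matrix.of fun i j => fderiv ℝ (xt K y) x (EuclideanSpace.single j 1) i

/-! ### The smoothers on a triangle `K` -/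

/-- `S^g u` on `K`. -/
def locSg (n l : ℕ) (ρ : ℝ) (u : Pt → ℝ) (K : Fin 3 → Pt) (x : Pt) : ℝ :=
  x 0 / n * avg l ρ K fun y => n * u (xt K y x) / xt K y x 0

/-- The covariant transform `(d x̃_y / d x)ᵀ ((n v_r + v_θ)/r, n v_z/r)(x̃_y)`. -/
def covariant (n : ℕ) (v : Pt → Vec) (K y : Fin 3 → Pt) (x : Pt) : Fin 2 → ℝ :=
  let p := xt K y x
  (jac K y x)ᵀ *ᵥ ![(n * v p 0 + v p 1) / p 0, n * v p 2 / p 0]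

/-- `S^c v` on `K`. -/
def locSc (n l : ℕ) (ρ : ℝ) (v : Pt → Vec) (K : Fin 3 → Pt) (x : Pt) : Vec :=
  ![x 0 / n * avg l ρ K (fun y => covariant n v K y x 0)
      - 1 / n * avg l ρ K (fun y => v (xt K y x) 1),
    avg l ρ K (fun y => v (xt K y x) 1),
    x 0 / n * avg l ρ K (fun y => covariant n v K y x 1)]

/-- The Piola transform `det(d x̃_y / d x) (d x̃_y / d x)⁻¹ (w_r, w_z)(x̃_y)`. -/
def piola (w : Pt → Vec) (K y : Fin 3 → Pt) (x : Pt) : Fin 2 → ℝ :=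
  let p := xt K y x
  ((jac K y x).det • (jac K y x)⁻¹) *ᵥ ![w p 0, w p 2]

/-- `S^d w` on `K`. -/
def locSd (n l : ℕ) (ρ : ℝ) (w : Pt → Vec) (K : Fin 3 → Pt) (x : Pt) : Vec :=
  ![avg l ρ K (fun y => piola w K y x 0),
    1 / n * avg l ρ K (fun y => piola w K y x 0)
      + x 0 / n * avg l ρ K (fun y => (jac K y x).det *
          ((n * w (xt K y x) 1 - w (xt K y x) 0) / xt K y x 0)),
    avg l ρ K (fun y => piola w K y x 1)]

/-- `S^o u` on `K`. -/
def locSo (l : ℕ) (ρ : ℝ) (u : Pt → ℝ) (K : Fin 3 → Pt) (x : Pt) : ℝ :=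
  avg l ρ K fun y => (jac K y x).det * u (xt K y x)

/-! ### The smoothers on the mesh -/

open Classical in
/-- The function given on each triangle `K` of the mesh by `f K`. (On the null set of points
lying in several triangles, one of them is used.) -/
def glue {α : Type} [Zero α] (T : Finset (Fin 3 → Pt)) (f : (Fin 3 → Pt) → Pt → α) (x : Pt) : α :=
  if h : ∃ K ∈ T, x ∈ tri K then f h.choose x else 0

/-- `S^g`, with smoothing radius `ρ = h δ`. -/
def Sg (n l : ℕ) (T : Finset (Fin 3 → Pt)) (δ : ℝ) (u : Pt → ℝ) : Pt → ℝ :=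
  glue T (locSg n l (meshSize T * δ) u)

/-- `S^c`, with smoothing radius `ρ = h δ`. -/
def Sc (n l : ℕ) (T : Finset (Fin 3 → Pt)) (δ : ℝ) (v : Pt → Vec) : Pt → Vec :=
  glue T (locSc n l (meshSize T * δ) v)

/-- `S^d`, with smoothing radius `ρ = h δ`. -/
def Sd (n l : ℕ) (T : Finset (Fin 3 → Pt)) (δ : ℝ) (w : Pt → Vec) : Pt → Vec :=
  glue T (locSd n l (meshSize T * δ) w)

/-- `S^o`, with smoothing radius `ρ = h δ`. -/
def So (l : ℕ) (T : Finset (Fin 3 → Pt)) (δ : ℝ) (u : Pt → ℝ) : Pt → ℝ :=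
  glue T (locSo l (meshSize T * δ) u)

end

/-! ### Integration by parts and null Lagrangians for Lipschitz functions in the plane -/

noncomputable section LipschitzCalculus

open Filter Topology
open scoped NNReal ENNReal

/-! Substitution turns the Fourier-mode complex into planar exterior calculus. Put `f = n u / r`, `a
= ((n v_r + v_θ)/r, n v_z / r)` (`covField`), `q = (w_z, -w_r)` (`rotField`) and `b = (n w_θ -
w_r)/r` (`angField`). If `g = grad^n u`, then the planar gradient of `f` is the field `a` built from
`g`. If `w = curl^n v`, then `∂_z a_0 - ∂_r a_1 = b` and `∇ v_θ = q - a`. If `F = div^n w`, then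
`∂_z q_0 - ∂_r q_1 = F + b`. In these variables the smoothers are averaged pullbacks under `x ↦
x̃_y`: composition for `f` and `v_θ`, the transposed Jacobian for `a` and `q`, the determinant for
`b` and `F`. The Piola transform of `(w_r, w_z)` is the covariant transform of `q`, rotated back. So
the proposition follows once averaged pullback commutes with the weak gradient
(`MeshSetup.wavg_grad`) and with the weak scalar curl (`MeshSetup.wavg_curl`).

No traces on interior edges are compared. Each weight `κ_a` has integral one, so the average over
three points attached to a triangle equals the average over one point for every vertex of the mesh
(`integral_weight_comp`, `avg_eq_wavg`). For a fixed choice `y` of all these points, the maps `x̃_y`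
on the triangles are the restrictions of one continuous piecewise affine map `meshMap`, because the
mesh is conforming. After a cut-off near the support of the test function it is Lipschitz, and
Lipschitz maps pull back smooth gradients and curls correctly in the weak sense. For the curl this
rests on the fact that a Jacobian determinant is a null Lagrangian (`integral_wedge_eq_zero`).

Fields that are merely locally integrable are reached by mollification in the target
(`PullbackData.grad`, `PullbackData.curl`). This requires composition with the map to be continuous
on `L¹`, which holds when all image triangles are nondegenerate, hence for almost every `y`.
Fubini's theorem then carries the identity from fixed `y` to the average.

The averages converge although the fields contain `1/r` and the axis may touch the domain. At any
`x` some barycentric coordinate is at least `1/3`, so the factor `r(y)³` of that vertex's weight is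
at most a constant times `r(x̃)³`, and the law of `x̃` has a density bounded uniformly in `x`
(`lintegral_weight_mul_le`). An average is therefore bounded by `∫ r³ |F|` over a bounded part of
the enlarged domain, which is finite for `F = N` or `F = N / r` with `N ∈ L²_r`. All averages are
bounded functions on the bounded set `Ω`, which gives membership in `L²_r`. Bounded density also
makes the averages independent of the representatives. -/

/-- The standard basis vectors of the meridian plane. -/
abbrev ePt (i : Fin 2) : Pt := EuclideanSpace.single i 1

theorem norm_ePt (i : Fin 2) : ‖ePt i‖ = 1 := by simp [ePt]

/-- Along a segment the increment of `f` has right slopes at most `L` times the speed, so the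
comparison principle for such slopes integrates the infinitesimal bound. The neighbourhood may
shrink with the point; no uniform radius is needed. -/
theorem lipschitzWith_of_eventually {f : Pt → ℝ} {L : ℝ≥0}
    (h : ∀ p, ∀ᶠ q in 𝓝 p, |f q - f p| ≤ L * ‖q - p‖) : LipschitzWith L f := by
  have hcont : Continuous f := by
    rw [continuous_iff_continuousAt]
    intro p
    rw [ContinuousAt, tendsto_iff_norm_sub_tendsto_zero]
    refine squeeze_zero' (.of_forall fun _ => norm_nonneg _) (h p) ?_
    have : Continuous fun q : Pt => (L : ℝ) * ‖q - p‖ := by fun_prop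
    simpa using this.tendsto p
  refine LipschitzWith.of_dist_le_mul fun y x => ?_
  rw [dist_eq_norm, dist_eq_norm]
  set v := y - x with hv
  let g : ℝ → ℝ := fun t => f (x + t • v) - f x
  have hg : Continuous g := by fun_prop
  have key := image_le_of_liminf_slope_right_le_deriv_boundary (f := fun t => ‖g t‖) (a := 0)
    (b := 1) (B := fun t => t * (L * ‖v‖)) (B' := fun _ => L * ‖v‖) hg.norm.continuousOn
    (by simp [g]) (by fun_prop)
    (fun t _ => by simpa using ((hasDerivAt_id t).mul_const (L * ‖v‖)).hasDerivWithinAt) ?_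
    (right_mem_Icc.2 zero_le_one)
  · simpa [g, hv] using key
  · intro t _ r hr
    have hc : Continuous fun s : ℝ => x + s • v := by fun_prop
    have h1 : ∀ᶠ s in 𝓝[>] t, |f (x + s • v) - f (x + t • v)| ≤ L * ‖(s - t) • v‖ := by
      have := (hc.tendsto t).eventually (h (x + t • v))
      refine (this.filter_mono nhdsWithin_le_nhds).mono fun s hs => ?_
      simpa [sub_smul] using hs
    refine (h1.and self_mem_nhdsWithin).frequently.mono ?_
    rintro s ⟨hs, hst : t < s⟩
    refine lt_of_le_of_lt ?_ hr
    have hst' : 0 < s - t := sub_pos.2 hst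
    rw [slope_def_field, div_le_iff₀ hst']
    calc ‖g s‖ - ‖g t‖ ≤ ‖g s - g t‖ := norm_sub_norm_le _ _
      _ = |f (x + s • v) - f (x + t • v)| := by simp [g, Real.norm_eq_abs]
      _ ≤ L * ‖(s - t) • v‖ := hs
      _ = L * ‖v‖ * (s - t) := by
        rw [norm_smul, Real.norm_eq_abs, abs_of_pos hst']; ring

theorem measurable_pd (i : Fin 2) (f : Pt → ℝ) : Measurable (pd i f) :=
  measurable_fderiv_apply_const ℝ f _

theorem abs_pd_le {f : Pt → ℝ} {C : ℝ≥0} (hf : LipschitzWith C f) (i : Fin 2) (x : Pt) :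
    |pd i f x| ≤ C := by
  have h1 := (fderiv ℝ f x).le_opNorm (ePt i)
  rw [norm_ePt, mul_one] at h1
  exact h1.trans (norm_fderiv_le_of_lipschitz ℝ hf)

theorem pd_ae_eq_lineDeriv {f : Pt → ℝ} {C : ℝ≥0} (hf : LipschitzWith C f) (i : Fin 2) :
    ∀ᵐ x, pd i f x = lineDeriv ℝ f x (ePt i) := by
  filter_upwards [hf.ae_differentiableAt (μ := volume)] with x hx
  exact hx.lineDeriv_eq_fderiv.symm

theorem pd_eq_zero_of_notMem_tsupport {f : Pt → ℝ} {x : Pt} (hx : x ∉ tsupport f) (i : Fin 2) :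
    pd i f x = 0 := by
  have : f =ᶠ[𝓝 x] 0 := notMem_tsupport_iff_eventuallyEq.1 hx
  rw [pd, this.fderiv_eq]
  simp

/-- Rademacher's theorem identifies `pd` with the line derivative almost everywhere, and for line
derivatives integration by parts needs compact support of one factor only. -/
theorem integral_pd_mul {h g : Pt → ℝ} {C D : ℝ≥0} (hh : LipschitzWith C h)
    (hg : LipschitzWith D g) (hc : HasCompactSupport h) (i : Fin 2) :
    ∫ x, pd i h x * g x = -∫ x, h x * pd i g x := by
  have h1 := LipschitzWith.integral_lineDeriv_mul_eq (μ := volume) hg hh hc (ePt i)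
  have e1 : ∫ x, lineDeriv ℝ g x (ePt i) * h x = ∫ x, h x * pd i g x := by
    refine integral_congr_ae ?_
    filter_upwards [pd_ae_eq_lineDeriv hg i] with x hx
    rw [hx, mul_comm]
  have e2 : ∫ x, lineDeriv ℝ h x (-ePt i) * g x = -∫ x, pd i h x * g x := by
    rw [← integral_neg]
    refine integral_congr_ae ?_
    filter_upwards [pd_ae_eq_lineDeriv hh i] with x hx
    rw [hx, lineDeriv_neg, neg_mul]
  rw [← e1, h1, e2, neg_neg]

theorem integrable_pd {f : Pt → ℝ} {C : ℝ≥0} (hf : LipschitzWith C f)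
    (hc : HasCompactSupport f) (i : Fin 2) : Integrable (pd i f) := by
  have h1 : IntegrableOn (pd i f) (tsupport f) :=
    Measure.integrableOn_of_bounded (M := C) hc.measure_lt_top.ne
      (measurable_pd i f).aestronglyMeasurable (.of_forall fun x => abs_pd_le hf i x)
  refine (integrableOn_iff_integrable_of_support_subset fun x hx => ?_).1 h1
  by_contra hx'
  exact hx (pd_eq_zero_of_notMem_tsupport hx' i)

/-- The Jacobian determinant of two Lipschitz functions is a null Lagrangian. -/
theorem integral_wedge_eq_zero {h g : Pt → ℝ} {C D : ℝ≥0} (hh : LipschitzWith C h)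
    (hg : LipschitzWith D g) (hhc : HasCompactSupport h) (hgc : HasCompactSupport g) :
    ∫ x, pd 0 h x * pd 1 g x = ∫ x, pd 0 g x * pd 1 h x := by
  -- Second derivatives do not exist, so `∂_0` is replaced by difference quotients on both sides.
  -- For each step `t` the two integrals agree, by translation invariance and integration by parts
  -- in `∂_1` alone; the quotient moves from `h` to `g` with its direction reversed.
  have A := hh.integral_inv_smul_sub_mul_tendsto_integral_lineDeriv_mul (μ := volume)
    (integrable_pd hg hgc 1) (ePt 0)
  have B := hg.integral_inv_smul_sub_mul_tendsto_integral_lineDeriv_mul (μ := volume)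
    (integrable_pd hh hhc 1) (-ePt 0)
  have e1 : ∫ x, lineDeriv ℝ h x (ePt 0) * pd 1 g x = ∫ x, pd 0 h x * pd 1 g x := by
    refine integral_congr_ae ?_
    filter_upwards [pd_ae_eq_lineDeriv hh 0] with x hx
    rw [hx]
  have e2 : ∫ x, lineDeriv ℝ g x (-ePt 0) * pd 1 h x = -∫ x, pd 0 g x * pd 1 h x := by
    rw [← integral_neg]
    refine integral_congr_ae ?_
    filter_upwards [pd_ae_eq_lineDeriv hg 0] with x hx
    rw [hx, lineDeriv_neg, neg_mul]
  rw [e1] at A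
  rw [e2] at B
  have B' := B.neg
  rw [neg_neg] at B'
  refine tendsto_nhds_unique A (B'.congr fun t => ?_)
  let τ : Pt → Pt := fun x => x + t • ePt 0
  have hτ : LipschitzWith 1 τ := (isometry_add_right (t • ePt 0)).lipschitz
  have hht : LipschitzWith (C * 1) (h ∘ τ) := hh.comp hτ
  have hhtc : HasCompactSupport (h ∘ τ) := hhc.comp_homeomorph (Homeomorph.addRight (t • ePt 0))
  have pdτ : ∀ x, pd 1 (h ∘ τ) x = pd 1 h (x + t • ePt 0) := by
    intro x
    simp only [pd, τ, Function.comp_def, fderiv_comp_add_right]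
  have s1 : ∫ x, h (x + t • ePt 0) * pd 1 g x = - ∫ x, pd 1 h x * g (x + t • -ePt 0) := by
    have := integral_pd_mul hht hg hhtc 1
    simp only [pdτ] at this
    have h2 : ∫ x, pd 1 h (x + t • ePt 0) * g x = ∫ x, pd 1 h x * g (x + t • -ePt 0) := by
      rw [← integral_add_right_eq_self (fun x => pd 1 h x * g (x + t • -ePt 0)) (t • ePt 0)]
      simp
    rw [← h2, this, neg_neg]
    rfl
  have s2 : ∫ x, h x * pd 1 g x = - ∫ x, pd 1 h x * g x := by
    rw [integral_pd_mul hh hg hhc 1, neg_neg]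
  have ih : Integrable h := hh.continuous.integrable_of_hasCompactSupport hhc
  have bdd : ∀ {k : Pt → ℝ}, Integrable k → Integrable fun x => k x * pd 1 g x := fun hk =>
    hk.mul_bdd (c := D) (measurable_pd 1 g).aestronglyMeasurable (.of_forall fun x => abs_pd_le hg 1 x)
  have bdd' : ∀ {k : Pt → ℝ}, Integrable k → Integrable fun x => k x * pd 1 h x := fun hk =>
    hk.mul_bdd (c := C) (measurable_pd 1 h).aestronglyMeasurable (.of_forall fun x => abs_pd_le hh 1 x)
  have ig : Integrable g := hg.continuous.integrable_of_hasCompactSupport hgc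
  simp only [smul_eq_mul, mul_assoc, integral_const_mul]
  rw [← mul_neg]
  congr 1
  simp only [sub_mul]
  rw [integral_sub (bdd (ih.comp_add_right _)) (bdd ih), s1, s2,
    integral_sub (bdd' (ig.comp_add_right _)) (bdd' ig)]
  simp only [mul_comm (pd 1 h _)]
  ring

theorem LipschitzWith.mul_of_bounded {f g : Pt → ℝ} {C D A B : ℝ≥0} (hf : LipschitzWith C f)
    (hg : LipschitzWith D g) (hA : ∀ x, |f x| ≤ A) (hB : ∀ x, |g x| ≤ B) :
    LipschitzWith (A * D + B * C) fun x => f x * g x := by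
  refine LipschitzWith.of_dist_le_mul fun x y => ?_
  have h1 := hf.dist_le_mul x y
  have h2 := hg.dist_le_mul x y
  rw [Real.dist_eq] at h1 h2 ⊢
  calc |f x * g x - f y * g y| = |f x * (g x - g y) + g y * (f x - f y)| := by ring_nf
    _ ≤ |f x| * |g x - g y| + |g y| * |f x - f y| := by
      rw [← abs_mul, ← abs_mul]; exact abs_add_le _ _
    _ ≤ A * (D * dist x y) + B * (C * dist x y) := by
      gcongr
      · exact hA x
      · exact hB y
    _ = _ := by push_cast; ring

theorem exists_abs_le_of_lipschitz_compact {f : Pt → ℝ} (hf : Continuous f)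
    (hc : HasCompactSupport f) : ∃ A : ℝ≥0, ∀ x, |f x| ≤ A := by
  obtain ⟨A, hA⟩ := hc.exists_bound_of_continuous hf
  exact ⟨A.toNNReal, fun x => (hA x).trans (Real.le_coe_toNNReal A)⟩

theorem pd_mul_apply {f g : Pt → ℝ} {x : Pt} (hf : DifferentiableAt ℝ f x)
    (hg : DifferentiableAt ℝ g x) (i : Fin 2) :
    pd i (fun y => f y * g y) x = pd i f x * g x + f x * pd i g x := by
  rw [pd, fderiv_fun_mul hf hg]
  simp [pd]
  ring

theorem pd_comp_apply {ψ : Pt → ℝ} {Φ : Pt → Pt} {x : Pt} (hψ : DifferentiableAt ℝ ψ (Φ x))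
    (hΦ : DifferentiableAt ℝ Φ x) (j : Fin 2) :
    pd j (fun y => ψ (Φ y)) x
      = pd 0 ψ (Φ x) * pd j (fun y => Φ y 0) x + pd 1 ψ (Φ x) * pd j (fun y => Φ y 1) x := by
  have hcomp : ∀ i, pd j (fun y => Φ y i) x = fderiv ℝ Φ x (ePt j) i := by
    intro i
    have := ((EuclideanSpace.proj i : Pt →L[ℝ] ℝ).hasFDerivAt
      (x := Φ x)).comp x hΦ.hasFDerivAt
    rw [pd, show (fun y => Φ y i) = (EuclideanSpace.proj i : Pt →L[ℝ] ℝ) ∘ Φ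
      from rfl, this.fderiv]
    rfl
  have h2 := (hψ.hasFDerivAt.comp x hΦ.hasFDerivAt).fderiv
  rw [pd, show (fun y => ψ (Φ y)) = ψ ∘ Φ from rfl, h2, hcomp, hcomp]
  have hv : fderiv ℝ Φ x (ePt j)
      = fderiv ℝ Φ x (ePt j) 0 • ePt 0 + fderiv ℝ Φ x (ePt j) 1 • ePt 1 := by
    ext k
    fin_cases k <;> simp [ePt]
  rw [ContinuousLinearMap.comp_apply]
  change fderiv ℝ ψ (Φ x) (fderiv ℝ Φ x (ePt j)) = _
  conv_lhs => rw [hv]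
  simp [pd, ePt]
  ring

theorem lipschitzWith_coord {Φ : Pt → Pt} {C : ℝ≥0} (hΦ : LipschitzWith C Φ) (i : Fin 2) :
    LipschitzWith C fun x => Φ x i := by
  refine LipschitzWith.of_dist_le_mul fun x y => le_trans ?_ (hΦ.dist_le_mul x y)
  rw [dist_eq_norm, dist_eq_norm]
  exact PiLp.norm_apply_le (Φ x - Φ y) i

theorem hasCompactSupport_coord {Φ : Pt → Pt} (hΦ : HasCompactSupport Φ) (i : Fin 2) :
    HasCompactSupport fun x => Φ x i :=
  hΦ.comp_left (g := fun v : Pt => v i) rfl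

/-- The form `d(φ u) ∧ dg` has integral zero; expand it by the product rule. The function `u` needs
a bound, to make `φ u` Lipschitz, but no compact support. -/
theorem integral_wedge_mul {φ u g : Pt → ℝ} {B C D A : ℝ≥0} (hφ : LipschitzWith C φ)
    (hu : LipschitzWith D u) (hg : LipschitzWith A g) (hφc : HasCompactSupport φ)
    (hgc : HasCompactSupport g) (hB : ∀ x, |u x| ≤ B) :
    ∫ x, u x * (pd 0 φ x * pd 1 g x - pd 1 φ x * pd 0 g x)
      = ∫ x, φ x * (pd 1 u x * pd 0 g x - pd 0 u x * pd 1 g x) := by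
  obtain ⟨M, hM⟩ := exists_abs_le_of_lipschitz_compact hφ.continuous hφc
  have hh := hφ.mul_of_bounded hu hM hB
  have hhc : HasCompactSupport fun x => φ x * u x := hφc.mul_right
  have key := integral_wedge_eq_zero hh hg hhc hgc
  have aem : ∀ (i : Fin 2) (f : Pt → ℝ), AEStronglyMeasurable (pd i f) volume := fun i f =>
    (measurable_pd i f).aestronglyMeasurable
  have i1 : ∀ i j : Fin 2, Integrable fun x => u x * (pd i φ x * pd j g x) := fun i j =>
    ((integrable_pd hφ hφc i).mul_bdd (aem j g) (.of_forall (abs_pd_le hg j))).bdd_mul (c := B)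
      hu.continuous.aestronglyMeasurable (.of_forall hB)
  have iφ : Integrable φ := hφ.continuous.integrable_of_hasCompactSupport hφc
  have i2 : ∀ i j : Fin 2, Integrable fun x => φ x * (pd i u x * pd j g x) := fun i j => by
    have := (iφ.mul_bdd (aem i u) (.of_forall (abs_pd_le hu i))).mul_bdd (aem j g)
      (.of_forall (abs_pd_le hg j))
    simpa only [mul_assoc] using this
  have hd : ∀ᵐ x, ∀ i, pd i (fun x => φ x * u x) x = pd i φ x * u x + φ x * pd i u x := by
    filter_upwards [hφ.ae_differentiableAt (μ := volume), hu.ae_differentiableAt (μ := volume)]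
      with x h1 h2 i using pd_mul_apply h1 h2 i
  have e1 : ∫ x, pd 0 (fun x => φ x * u x) x * pd 1 g x
      = (∫ x, u x * (pd 0 φ x * pd 1 g x)) + ∫ x, φ x * (pd 0 u x * pd 1 g x) := by
    rw [← integral_add (i1 0 1) (i2 0 1)]
    refine integral_congr_ae ?_
    filter_upwards [hd] with x hx
    rw [hx 0]; ring
  have e2 : ∫ x, pd 0 g x * pd 1 (fun x => φ x * u x) x
      = (∫ x, u x * (pd 1 φ x * pd 0 g x)) + ∫ x, φ x * (pd 1 u x * pd 0 g x) := by
    rw [← integral_add (i1 1 0) (i2 1 0)]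
    refine integral_congr_ae ?_
    filter_upwards [hd] with x hx
    rw [hx 1]; ring
  simp only [mul_sub]
  rw [integral_sub (i1 0 1) (i1 1 0), integral_sub (i2 1 0) (i2 0 1)]
  linarith

/-- Pullback of the gradient of a smooth function by a Lipschitz map. -/
theorem integral_comp_mul_pd {Φ : Pt → Pt} {φ ψ : Pt → ℝ} {A C D : ℝ≥0} (hΦ : LipschitzWith A Φ)
    (hφ : LipschitzWith C φ) (hφc : HasCompactSupport φ) (hψ : Differentiable ℝ ψ)
    (hψl : LipschitzWith D ψ) (j : Fin 2) :
    ∫ x, ψ (Φ x) * pd j φ x = -∫ x, φ x * (pd 0 ψ (Φ x) * pd j (fun y => Φ y 0) x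
      + pd 1 ψ (Φ x) * pd j (fun y => Φ y 1) x) := by
  have := integral_pd_mul hφ (hψl.comp hΦ) hφc j
  simp only [Function.comp_def] at this
  simp only [mul_comm (ψ _)]
  rw [this]
  congr 1
  refine integral_congr_ae ?_
  filter_upwards [hΦ.ae_differentiableAt (μ := volume)] with x hx
  rw [pd_comp_apply (hψ _) hx]

/-- Pullback of the scalar curl of a smooth field by a Lipschitz map. -/
theorem integral_curl_pullback {Φ : Pt → Pt} {φ ψ₀ ψ₁ : Pt → ℝ} {A C D₀ D₁ B₀ B₁ : ℝ≥0}
    (hΦ : LipschitzWith A Φ) (hΦc : HasCompactSupport Φ)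
    (hφ : LipschitzWith C φ) (hφc : HasCompactSupport φ) (hψ₀ : Differentiable ℝ ψ₀)
    (hψ₀l : LipschitzWith D₀ ψ₀) (hB₀ : ∀ x, |ψ₀ x| ≤ B₀) (hψ₁ : Differentiable ℝ ψ₁)
    (hψ₁l : LipschitzWith D₁ ψ₁) (hB₁ : ∀ x, |ψ₁ x| ≤ B₁) :
    ∫ x, φ x * ((pd 0 (fun y => Φ y 0) x * pd 1 (fun y => Φ y 1) x
        - pd 1 (fun y => Φ y 0) x * pd 0 (fun y => Φ y 1) x)
          * (pd 1 ψ₀ (Φ x) - pd 0 ψ₁ (Φ x)))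
      = (∫ x, ψ₀ (Φ x) * (pd 0 φ x * pd 1 (fun y => Φ y 0) x - pd 1 φ x * pd 0 (fun y => Φ y 0) x))
        + ∫ x, ψ₁ (Φ x)
          * (pd 0 φ x * pd 1 (fun y => Φ y 1) x - pd 1 φ x * pd 0 (fun y => Φ y 1) x) := by
  have c := fun i => lipschitzWith_coord hΦ i
  have cc := fun i => hasCompactSupport_coord hΦc i
  have l0 : LipschitzWith (D₀ * A) fun x => ψ₀ (Φ x) := hψ₀l.comp hΦ
  have l1 : LipschitzWith (D₁ * A) fun x => ψ₁ (Φ x) := hψ₁l.comp hΦ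
  -- In terms of forms, `∫ ψ_i(Φ) dφ ∧ dΦ_i = -∫ φ d(ψ_i ∘ Φ) ∧ dΦ_i`. After the chain rule the sum
  -- over `i` is the determinant times the scalar curl, and only first derivatives of `Φ` occur.
  have k0 := integral_wedge_mul hφ l0 (c 0) hφc (cc 0) (fun x => hB₀ (Φ x))
  have k1 := integral_wedge_mul hφ l1 (c 1) hφc (cc 1) (fun x => hB₁ (Φ x))
  rw [k0, k1]
  have iφ : Integrable φ := hφ.continuous.integrable_of_hasCompactSupport hφc
  have aem : ∀ (i : Fin 2) (f : Pt → ℝ), AEStronglyMeasurable (pd i f) volume := fun i f =>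
    (measurable_pd i f).aestronglyMeasurable
  have int : ∀ {u g : Pt → ℝ} {E F : ℝ≥0}, LipschitzWith E u → LipschitzWith F g →
      Integrable fun x => φ x * (pd 1 u x * pd 0 g x - pd 0 u x * pd 1 g x) := by
    intro u g E F hu hg
    have h : ∀ i j, Integrable fun x => φ x * (pd i u x * pd j g x) := fun i j => by
      have := (iφ.mul_bdd (aem i u) (.of_forall (abs_pd_le hu i))).mul_bdd (aem j g)
        (.of_forall (abs_pd_le hg j))
      simpa only [mul_assoc] using this
    exact ((h 1 0).sub (h 0 1)).congr (.of_forall fun x => (mul_sub _ _ _).symm)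
  rw [← integral_add (int l0 (c 0)) (int l1 (c 1))]
  refine integral_congr_ae ?_
  filter_upwards [hΦ.ae_differentiableAt (μ := volume)] with x hx
  rw [pd_comp_apply (hψ₀ _) hx, pd_comp_apply (hψ₀ _) hx, pd_comp_apply (hψ₁ _) hx,
    pd_comp_apply (hψ₁ _) hx]
  ring

end LipschitzCalculus

/-! ### Mollification and composition with maps of bounded compression -/

noncomputable section Mollification

open Filter Topology
open scoped NNReal ENNReal Convolution

/-- A smooth bump function around the origin supported in the disk of radius `1 / (k + 1)`. -/
def bump (k : ℕ) : ContDiffBump (0 : Pt) where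
  rIn := 1 / (2 * (k + 1))
  rOut := 1 / (k + 1)
  rIn_pos := by positivity
  rIn_lt_rOut := by
    apply one_div_lt_one_div_of_lt <;> linarith [(k.cast_nonneg : (0 : ℝ) ≤ k)]

/-- Mollification at scale `1 / (k + 1)`. -/
def moll (k : ℕ) (f : Pt → ℝ) : Pt → ℝ :=
  (bump k).normed volume ⋆[ContinuousLinearMap.lsmul ℝ ℝ, volume] f

theorem tendsto_bump_rOut : Tendsto (fun k => (bump k).rOut) atTop (𝓝 0) :=
  tendsto_one_div_add_atTop_nhds_zero_nat

theorem ae_tendsto_moll {f : Pt → ℝ} (hf : Integrable f) :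
    ∀ᵐ x, Tendsto (fun k => moll k f x) atTop (𝓝 (f x)) :=
  -- The ratio of outer to inner radius of `bump k` is 2 for every `k`; a uniform bound on this
  -- ratio is what pointwise a.e. convergence requires.
  ContDiffBump.ae_convolution_tendsto_right_of_locallyIntegrable (K := 2) tendsto_bump_rOut
    (.of_forall fun k => by
      simp only [bump]
      exact le_of_eq (by field_simp))
    hf.locallyIntegrable

theorem contDiff_normed_bump (k : ℕ) : ContDiff ℝ ∞ ((bump k).normed (volume : Measure Pt)) :=
  (bump k).contDiff_normed

theorem hasCompactSupport_normed_bump (k : ℕ) :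
    HasCompactSupport ((bump k).normed (volume : Measure Pt)) :=
  (bump k).hasCompactSupport_normed

theorem integrable_normed_bump (k : ℕ) : Integrable ((bump k).normed (volume : Measure Pt)) :=
  (bump k).integrable_normed

theorem integrable_moll {f : Pt → ℝ} (hf : Integrable f) (k : ℕ) : Integrable (moll k f) :=
  (integrable_normed_bump k).integrable_convolution _ hf

theorem integral_moll {f : Pt → ℝ} (hf : Integrable f) (k : ℕ) :
    ∫ x, moll k f x = ∫ x, f x := by
  have := integral_convolution (ContinuousLinearMap.lsmul ℝ ℝ) (μ := (volume : Measure Pt))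
    (integrable_normed_bump k) hf
  rw [moll, this, (bump k).integral_normed]
  simp

theorem moll_sub {f g : Pt → ℝ} (hf : Integrable f) (hg : Integrable g) (k : ℕ) (x : Pt) :
    moll k (fun y => f y - g y) x = moll k f x - moll k g x := by
  have ex : ∀ {f : Pt → ℝ}, Integrable f → ConvolutionExistsAt ((bump k).normed volume) f x
      (ContinuousLinearMap.lsmul ℝ ℝ) volume := fun hf =>
    (hasCompactSupport_normed_bump k).convolutionExists_left _ (contDiff_normed_bump k).continuous
      hf.locallyIntegrable x
  simp only [moll, convolution_def, ContinuousLinearMap.lsmul_apply, smul_eq_mul, mul_sub]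
  exact integral_sub (ex hf) (ex hg)

/-- Scheffé's argument. The positive part of `f - moll k f` is dominated by `f` and tends to zero
a.e.; since `f` and `moll k f` have equal integrals, the `L¹` distance is twice the integral of that
positive part. -/
theorem tendsto_integral_abs_moll_sub_of_nonneg {f : Pt → ℝ} (hf : Integrable f)
    (h0 : ∀ x, 0 ≤ f x) : Tendsto (fun k => ∫ x, |moll k f x - f x|) atTop (𝓝 0) := by
  have hm0 : ∀ k x, 0 ≤ moll k f x := fun k x =>
    integral_nonneg fun y => mul_nonneg ((bump k).nonneg_normed y) (h0 _)
  have h1 : Tendsto (fun k => ∫ x, max (f x - moll k f x) 0) atTop (𝓝 (∫ _ : Pt, (0 : ℝ))) := by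
    refine tendsto_integral_of_dominated_convergence f (fun k => ?_) hf (fun k => ?_) ?_
    · exact ((hf.sub (integrable_moll hf k)).pos_part).aestronglyMeasurable
    · refine .of_forall fun x => ?_
      rw [Real.norm_eq_abs, abs_of_nonneg (le_max_right _ _)]
      exact max_le (sub_le_self _ (hm0 k x)) (h0 x)
    · filter_upwards [ae_tendsto_moll hf] with x hx
      have : Tendsto (fun k => max (f x - moll k f x) 0) atTop (𝓝 (max (f x - f x) 0)) :=
        (tendsto_const_nhds.sub hx).max tendsto_const_nhds
      simpa using this
  rw [integral_zero] at h1
  have h2 := h1.const_mul 2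
  rw [mul_zero] at h2
  refine h2.congr fun k => ?_
  have id : Integrable fun x => f x - moll k f x := hf.sub (integrable_moll hf k)
  have e : ∫ x, (2 * max (f x - moll k f x) 0 - (f x - moll k f x))
      = 2 * ∫ x, max (f x - moll k f x) 0 := by
    rw [integral_sub (id.pos_part.const_mul 2) id, integral_sub hf (integrable_moll hf k), integral_moll hf,
      sub_self, sub_zero, integral_const_mul]
  rw [← e]
  congr 1
  ext x
  rcases le_total (f x - moll k f x) 0 with h | h
  · rw [max_eq_right h, abs_of_nonneg (by linarith)]; ring
  · rw [max_eq_left h, abs_of_nonpos (by linarith)]; ring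

/-- Mollifications converge in `L¹`. -/
theorem tendsto_integral_abs_moll_sub {f : Pt → ℝ} (hf : Integrable f) :
    Tendsto (fun k => ∫ x, |moll k f x - f x|) atTop (𝓝 0) := by
  have hp := hf.pos_part
  have hn := hf.neg_part
  have h1 := tendsto_integral_abs_moll_sub_of_nonneg hp fun x => le_max_right _ _
  have h2 := tendsto_integral_abs_moll_sub_of_nonneg hn fun x => le_max_right _ _
  have h3 := h1.add h2
  rw [add_zero] at h3
  refine squeeze_zero (fun k => integral_nonneg fun x => abs_nonneg _) (fun k => ?_) h3
  have i1 : Integrable fun x => |moll k (fun y => max (f y) 0) x - max (f x) 0| :=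
    ((integrable_moll hp k).sub hp).abs
  have i2 : Integrable fun x => |moll k (fun y => max (-f y) 0) x - max (-f x) 0| :=
    ((integrable_moll hn k).sub hn).abs
  rw [← integral_add i1 i2]
  refine integral_mono ((integrable_moll hf k).sub hf).abs (i1.add i2) fun x => ?_
  have e : f = fun y => max (f y) 0 - max (-f y) 0 := by
    ext y
    rcases le_total (f y) 0 with h | h
    · rw [max_eq_right h, max_eq_left (by linarith)]; ring
    · rw [max_eq_left h, max_eq_right (by linarith)]; ring
  have e1 : moll k f x = moll k (fun y => max (f y) 0) x - moll k (fun y => max (-f y) 0) x := by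
    conv_lhs => rw [e]
    exact moll_sub hp hn k x
  have e2 := congrFun e x
  simp only at e2 ⊢
  rw [e1]
  refine le_trans (le_of_eq ?_) (abs_sub _ _)
  congr 1
  linarith

theorem contDiff_moll {f : Pt → ℝ} (hf : Integrable f) (k : ℕ) : ContDiff ℝ ∞ (moll k f) :=
  (hasCompactSupport_normed_bump k).contDiff_convolution_left _ (contDiff_normed_bump k)
    hf.locallyIntegrable

theorem hasCompactSupport_moll {f : Pt → ℝ} (hf : HasCompactSupport f) (k : ℕ) :
    HasCompactSupport (moll k f) :=
  (hasCompactSupport_normed_bump k).convolution _ hf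

/-- The test function `q ↦ η_k(p - q)`. -/
def bumpAt (k : ℕ) (p q : Pt) : ℝ := (bump k).normed volume (p - q)

theorem contDiff_bumpAt (k : ℕ) (p : Pt) : ContDiff ℝ ∞ (bumpAt k p) :=
  (contDiff_normed_bump k).comp (contDiff_const.sub contDiff_id)

theorem support_bumpAt (k : ℕ) (p : Pt) :
    Function.support (bumpAt k p) ⊆ Metric.closedBall p (bump k).rOut := by
  intro q hq
  have : p - q ∈ Function.support ((bump k).normed (volume : Measure Pt)) := hq
  rw [ContDiffBump.support_normed_eq, Metric.mem_ball, dist_zero_right] at this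
  rw [Metric.mem_closedBall, dist_eq_norm, norm_sub_rev]
  exact this.le

theorem tsupport_bumpAt (k : ℕ) (p : Pt) :
    tsupport (bumpAt k p) ⊆ Metric.closedBall p (bump k).rOut :=
  closure_minimal (support_bumpAt k p) Metric.isClosed_closedBall

theorem isTest_bumpAt {U : Set Pt} {k : ℕ} {p : Pt} (h : Metric.closedBall p (bump k).rOut ⊆ U) :
    IsTest U (bumpAt k p) :=
  ⟨contDiff_bumpAt k p, HasCompactSupport.of_support_subset_isCompact
    (isCompact_closedBall p (bump k).rOut) (support_bumpAt k p),
    (tsupport_bumpAt k p).trans h⟩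

theorem pd_bumpAt (k : ℕ) (p q : Pt) (i : Fin 2) :
    pd i (bumpAt k p) q = -pd i ((bump k).normed volume) (p - q) := by
  have h : HasFDerivAt ((bump k).normed (volume : Measure Pt)) _ (p - q) :=
    ((contDiff_normed_bump k).differentiable (by simp) _).hasFDerivAt
  have := h.comp q ((hasFDerivAt_id q).const_sub p)
  rw [pd, show bumpAt k p = (bump k).normed volume ∘ HSub.hSub p from rfl, this.fderiv]
  simp [pd]

/-- If the kernel around `p` lives inside `C`, the truncation to `C` is invisible at `p`, and
mollifying is pairing with the test function `bumpAt k p`. Weak identities on `U` thereby become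
pointwise identities between mollifications. -/
theorem moll_indicator {U C : Set Pt} (hU : MeasurableSet U) (hCU : C ⊆ U)
    {f : Pt → ℝ} {k : ℕ} {p : Pt} (hp : Metric.closedBall p (bump k).rOut ⊆ C) :
    moll k (C.indicator f) p = ∫ q in U, f q * bumpAt k p q := by
  rw [moll, convolution_eq_swap, ← integral_indicator hU]
  congr 1
  ext q
  change (bump k).normed volume (p - q) * C.indicator f q = _
  by_cases hq : q ∈ C
  · rw [indicator_of_mem hq, indicator_of_mem (hCU hq), mul_comm]; rfl
  · have h0 : bumpAt k p q = 0 := by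
      by_contra h
      exact hq (hp (support_bumpAt k p h))
    rw [indicator_of_notMem hq, mul_zero]
    by_cases hq' : q ∈ U
    · rw [indicator_of_mem hq', h0, mul_zero]
    · rw [indicator_of_notMem hq']

theorem pd_moll {f : Pt → ℝ} (hf : Integrable f) (k : ℕ) (p : Pt) (i : Fin 2) :
    pd i (moll k f) p = ∫ q, f q * pd i ((bump k).normed volume) (p - q) := by
  have h := (hasCompactSupport_normed_bump k).hasFDerivAt_convolution_left
    (ContinuousLinearMap.lsmul ℝ ℝ) ((contDiff_normed_bump k).of_le (by simp))
    hf.locallyIntegrable p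
  have hex := ((hasCompactSupport_normed_bump k).fderiv (𝕜 := ℝ)).convolutionExists_left
    ((ContinuousLinearMap.lsmul ℝ ℝ).precompL Pt)
    ((contDiff_normed_bump k).continuous_fderiv (by simp)) hf.locallyIntegrable p
  rw [pd, moll, h.fderiv, convolution_eq_swap,
    ContinuousLinearMap.integral_apply]
  · congr 1
    ext q
    simp [pd, ContinuousLinearMap.precompL_apply, mul_comm]
  · exact hex.integrable_swap

/-- The derivative falls on the kernel; it changes sign because `bumpAt k p` depends on `p - q` and
is differentiated in `q`. -/
theorem pd_moll_indicator {U C : Set Pt} (hU : MeasurableSet U)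
    (hCU : C ⊆ U) {f : Pt → ℝ} (hf : Integrable (C.indicator f)) {k : ℕ} {p : Pt}
    (hp : Metric.closedBall p (bump k).rOut ⊆ C) (i : Fin 2) :
    pd i (moll k (C.indicator f)) p = -∫ q in U, f q * pd i (bumpAt k p) q := by
  rw [pd_moll hf, ← integral_indicator hU, ← integral_neg]
  congr 1
  ext q
  by_cases hq : q ∈ C
  · rw [indicator_of_mem hq, indicator_of_mem (hCU hq), pd_bumpAt]; ring
  · have h0 : pd i (bumpAt k p) q = 0 :=
      pd_eq_zero_of_notMem_tsupport (fun h => hq (hp (tsupport_bumpAt k p h))) i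
    rw [indicator_of_notMem hq, zero_mul]
    by_cases hq' : q ∈ U
    · rw [indicator_of_mem hq', h0, mul_zero, neg_zero]
    · rw [indicator_of_notMem hq', neg_zero]

/-- A pushforward dominated by a multiple of Lebesgue measure makes composition with `Φ` well
defined and continuous on `L¹`. -/
theorem integral_abs_comp_le {Φ : Pt → Pt} {S : Set Pt} {c : ℝ≥0} (hΦ : Measurable Φ)
    (hmap : (volume.restrict S).map Φ ≤ c • volume) {f : Pt → ℝ} (hf : Integrable f) :
    IntegrableOn (fun x => f (Φ x)) S ∧ ∫ x in S, |f (Φ x)| ≤ c * ∫ x, |f x| := by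
  have h1 : Integrable f (c • volume) := hf.smul_measure ENNReal.coe_ne_top
  have h2 : Integrable f ((volume.restrict S).map Φ) := h1.mono_measure hmap
  refine ⟨(integrable_map_measure h2.aestronglyMeasurable hΦ.aemeasurable).1 h2, ?_⟩
  have e : ∫ x in S, |f (Φ x)| = ∫ x, |f x| ∂((volume.restrict S).map Φ) :=
    (integral_map hΦ.aemeasurable h2.abs.aestronglyMeasurable).symm
  rw [e]
  refine (integral_mono_measure hmap (.of_forall fun x => abs_nonneg _) h1.abs).trans
    (le_of_eq ?_)
  rw [integral_smul_nnreal_measure]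
  rfl

theorem tendsto_integral_moll_comp {Φ : Pt → Pt} {S : Set Pt} {c : ℝ≥0} (hΦ : Measurable Φ)
    (hmap : (volume.restrict S).map Φ ≤ c • volume) {f : Pt → ℝ} (hf : Integrable f)
    {A : Pt → ℝ} (hA : Measurable A) {M : ℝ} (hM : ∀ x, |A x| ≤ M) :
    Tendsto (fun k => ∫ x in S, moll k f (Φ x) * A x) atTop (𝓝 (∫ x in S, f (Φ x) * A x)) := by
  rw [tendsto_iff_norm_sub_tendsto_zero]
  have h0 := ((tendsto_integral_abs_moll_sub hf).const_mul (c : ℝ)).const_mul M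
  rw [mul_zero, mul_zero] at h0
  have hM0 : 0 ≤ M := (abs_nonneg _).trans (hM 0)
  refine squeeze_zero (fun _ => norm_nonneg _) (fun k => ?_) h0
  have ik := integrable_moll hf k
  have im : ∀ {g : Pt → ℝ}, Integrable g → IntegrableOn (fun x => g (Φ x) * A x) S := fun hg =>
    (integral_abs_comp_le hΦ hmap hg).1.mul_bdd (c := M) hA.aestronglyMeasurable
      (.of_forall hM)
  rw [← integral_sub (im ik) (im hf)]
  have h1 := integral_abs_comp_le hΦ hmap (ik.sub hf)
  calc ‖∫ x in S, (moll k f (Φ x) * A x - f (Φ x) * A x)‖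
      ≤ ∫ x in S, ‖moll k f (Φ x) * A x - f (Φ x) * A x‖ := norm_integral_le_integral_norm _
    _ ≤ ∫ x in S, M * |(moll k f - f) (Φ x)| := by
      refine integral_mono ((im ik).sub (im hf)).norm (h1.1.abs.const_mul M) fun x => ?_
      simp only [Pi.sub_apply]
      rw [← sub_mul, norm_mul, mul_comm]
      exact mul_le_mul_of_nonneg_right (hM x) (norm_nonneg _)
    _ = M * ∫ x in S, |(moll k f - f) (Φ x)| := integral_const_mul _ _
    _ ≤ M * (c * ∫ x, |moll k f x - f x|) := mul_le_mul_of_nonneg_left h1.2 hM0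

/-- A Lipschitz map, a test function on its domain, and a compact neighbourhood in the target of
the image of the support: the data for pulling back weak differential identities. -/
structure PullbackData (U : Set Pt) (Φ : Pt → Pt) (φ : Pt → ℝ) : Prop where
  isOpen : IsOpen U
  lipschitz : ∃ A, LipschitzWith A Φ
  compact : HasCompactSupport Φ
  smooth : ContDiff ℝ ∞ φ
  compact_test : HasCompactSupport φ
  mapsTo : MapsTo Φ (tsupport φ) U
  map_le : ∃ c : ℝ≥0, (volume.restrict (tsupport φ)).map Φ ≤ c • volume

namespace PullbackData

variable {U : Set Pt} {Φ : Pt → Pt} {φ : Pt → ℝ}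

/-- A closed thickening of the compact image of the support. It allows a field that is only locally
integrable on `U` to be truncated to an integrable one without affecting its mollifications at the
image points for large `k`. -/
theorem exists_compact_nhd (h : PullbackData U Φ φ) :
    ∃ C : Set Pt, IsCompact C ∧ C ⊆ U ∧ MapsTo Φ (tsupport φ) C ∧
      ∀ᶠ k in atTop, ∀ x ∈ tsupport φ, Metric.closedBall (Φ x) (bump k).rOut ⊆ C := by
  obtain ⟨A, hA⟩ := h.lipschitz
  have hc : IsCompact (Φ '' tsupport φ) := h.compact_test.isCompact.image hA.continuous
  obtain ⟨ε, hε, hsub⟩ := hc.exists_cthickening_subset_open h.isOpen h.mapsTo.image_subset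
  refine ⟨_, hc.cthickening (r := ε), hsub, fun x hx =>
    Metric.self_subset_cthickening _ (mem_image_of_mem _ hx), ?_⟩
  filter_upwards [tendsto_bump_rOut.eventually (gt_mem_nhds hε)] with k hk x hx
  exact (Metric.closedBall_subset_closedBall hk.le).trans
    (Metric.closedBall_subset_cthickening (mem_image_of_mem _ hx) _)

theorem exists_lipschitz_test (h : PullbackData U Φ φ) : ∃ C, LipschitzWith C φ :=
  ContDiff.lipschitzWith_of_hasCompactSupport h.compact_test h.smooth (by simp)

theorem setIntegral_mul_test (g : Pt → ℝ) :
    ∫ x in tsupport φ, g x * φ x = ∫ x, g x * φ x := by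
  refine setIntegral_eq_integral_of_forall_compl_eq_zero fun x hx => ?_
  rw [image_eq_zero_of_notMem_tsupport hx, mul_zero]

theorem setIntegral_mul_pd (g : Pt → ℝ) (j : Fin 2) :
    ∫ x in tsupport φ, g x * pd j φ x = ∫ x, g x * pd j φ x := by
  refine setIntegral_eq_integral_of_forall_compl_eq_zero fun x hx => ?_
  rw [pd_eq_zero_of_notMem_tsupport hx, mul_zero]

end PullbackData

end Mollification

/-! ### Pullback of weak gradients and weak curls by Lipschitz maps -/

noncomputable section Pullback

open Filter Topology
open scoped NNReal ENNReal

/-- `u` is integrable on the compact subsets of `U`. -/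
def LocInt (U : Set Pt) (u : Pt → ℝ) : Prop := ∀ C, IsCompact C → C ⊆ U → IntegrableOn u C

namespace PullbackData

variable {U : Set Pt} {Φ : Pt → Pt} {φ : Pt → ℝ}

theorem tendsto_moll (h : PullbackData U Φ φ) {f : Pt → ℝ} (hf : Integrable f)
    {A : Pt → ℝ} (hA : Measurable A) {M : ℝ} (hM : ∀ x, |A x| ≤ M) :
    Tendsto (fun k => ∫ x in tsupport φ, moll k f (Φ x) * A x) atTop
      (𝓝 (∫ x in tsupport φ, f (Φ x) * A x)) := by
  obtain ⟨L, hL⟩ := h.lipschitz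
  obtain ⟨c, hc⟩ := h.map_le
  exact tendsto_integral_moll_comp hL.continuous.measurable hc hf hA hM

theorem integrableOn_moll_mul (h : PullbackData U Φ φ) {f : Pt → ℝ} (hf : Integrable f)
    {A : Pt → ℝ} (hA : Measurable A) {M : ℝ} (hM : ∀ x, |A x| ≤ M) :
    IntegrableOn (fun x => f (Φ x) * A x) (tsupport φ) := by
  obtain ⟨L, hL⟩ := h.lipschitz
  obtain ⟨c, hc⟩ := h.map_le
  exact (integral_abs_comp_le hL.continuous.measurable hc hf).1.mul_bdd (c := M)
    hA.aestronglyMeasurable (.of_forall hM)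

/-- The weak gradient is natural under pullback. -/
theorem grad (h : PullbackData U Φ φ) {f : Pt → ℝ} {G : Fin 2 → Pt → ℝ}
    (hf : LocInt U f) (hG : ∀ i, LocInt U (G i))
    (hw : ∀ i ψ, IsTest U ψ → ∫ x in U, G i x * ψ x = -∫ x in U, f x * pd i ψ x) (j : Fin 2) :
    ∫ x, f (Φ x) * pd j φ x
      = -∫ x, (pd j (fun y => Φ y 0) x * G 0 (Φ x) + pd j (fun y => Φ y 1) x * G 1 (Φ x))
          * φ x := by
  obtain ⟨C, hC, hCU, hmaps, hev⟩ := h.exists_compact_nhd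
  obtain ⟨A, hA⟩ := h.lipschitz
  obtain ⟨L, hL⟩ := h.exists_lipschitz_test
  obtain ⟨B, hB⟩ := exists_abs_le_of_lipschitz_compact hL.continuous h.compact_test
  have intC : ∀ {g}, LocInt U g → Integrable (C.indicator g) := fun hg =>
    (integrable_indicator_iff hC.measurableSet).2 (hg C hC hCU)
  have hcC : ∀ g : Pt → ℝ, HasCompactSupport (C.indicator g) := fun g =>
    HasCompactSupport.of_support_subset_isCompact hC (support_indicator_subset)
  have mA : ∀ i, Measurable fun x => φ x * pd j (fun y => Φ y i) x := fun i =>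
    hL.continuous.measurable.mul (measurable_pd j _)
  have bA : ∀ i x, |φ x * pd j (fun y => Φ y i) x| ≤ B * A := fun i x => by
    rw [abs_mul]
    exact mul_le_mul (hB x) (abs_pd_le (lipschitzWith_coord hA i) j x) (abs_nonneg _) B.2
  have t0 := h.tendsto_moll (intC hf) (measurable_pd j φ) (abs_pd_le hL j)
  have t1 := fun i => h.tendsto_moll (intC (hG i)) (mA i) (bA i)
  have t2 := ((t1 0).add (t1 1)).neg
  -- For large `k` the mollified function is smooth and its partial derivatives at `Φ x` are the
  -- mollified `G i`, so this is the smooth pullback formula. The limit `k → ∞` then uses only that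
  -- the remaining factors are bounded and measurable.
  have key : ∀ᶠ k in atTop, ∫ x in tsupport φ, moll k (C.indicator f) (Φ x) * pd j φ x
      = -((∫ x in tsupport φ, moll k (C.indicator (G 0)) (Φ x)
            * (φ x * pd j (fun y => Φ y 0) x))
          + ∫ x in tsupport φ, moll k (C.indicator (G 1)) (Φ x)
            * (φ x * pd j (fun y => Φ y 1) x)) := by
    filter_upwards [hev] with k hk
    have hs := contDiff_moll (intC hf) k
    obtain ⟨D, hD⟩ := ContDiff.lipschitzWith_of_hasCompactSupport
      (hasCompactSupport_moll (hcC f) k) hs (by simp)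
    have e := integral_comp_mul_pd hA hL h.compact_test (hs.differentiable (by simp)) hD j
    rw [setIntegral_mul_pd, e, ← integral_add
      (h.integrableOn_moll_mul (integrable_moll (intC (hG 0)) k) (mA 0) (bA 0))
      (h.integrableOn_moll_mul (integrable_moll (intC (hG 1)) k) (mA 1) (bA 1))]
    simp only [mul_comm (φ _)]
    rw [← setIntegral_mul_test]
    congr 1
    refine setIntegral_congr_fun (isClosed_tsupport φ).measurableSet fun x hx => ?_
    have hp : ∀ i, pd i (moll k (C.indicator f)) (Φ x) = moll k (C.indicator (G i)) (Φ x) := by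
      intro i
      rw [pd_moll_indicator h.isOpen.measurableSet hCU (intC hf) (hk x hx),
        moll_indicator h.isOpen.measurableSet hCU (hk x hx),
        hw i _ (isTest_bumpAt ((hk x hx).trans hCU))]
    simp only [hp]
    ring
  have lim := tendsto_nhds_unique (t0.congr' key) t2
  rw [← setIntegral_mul_pd, ← setIntegral_mul_test]
  have ind : ∀ (g : Pt → ℝ), ∀ x ∈ tsupport φ, C.indicator g (Φ x) = g (Φ x) := fun g x hx =>
    indicator_of_mem (hmaps hx) g
  have ms := (isClosed_tsupport φ).measurableSet
  rw [setIntegral_congr_fun ms fun x hx => by rw [ind f x hx]] at lim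
  rw [lim, ← integral_add (h.integrableOn_moll_mul (intC (hG 0)) (mA 0) (bA 0))
      (h.integrableOn_moll_mul (intC (hG 1)) (mA 1) (bA 1))]
  congr 1
  refine setIntegral_congr_fun ms fun x hx => ?_
  simp only [ind _ x hx]
  ring

/-- The weak scalar curl is natural under pullback. -/
theorem curl (h : PullbackData U Φ φ) {c : Pt → ℝ} {v : Fin 2 → Pt → ℝ}
    (hc : LocInt U c) (hv : ∀ i, LocInt U (v i))
    (hw : ∀ ψ, IsTest U ψ →
      ∫ x in U, c x * ψ x = -(∫ x in U, v 0 x * pd 1 ψ x) + ∫ x in U, v 1 x * pd 0 ψ x) :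
    ∫ x, ((pd 0 (fun y => Φ y 0) x * pd 1 (fun y => Φ y 1) x
        - pd 1 (fun y => Φ y 0) x * pd 0 (fun y => Φ y 1) x) * c (Φ x)) * φ x
      = (-∫ x, (pd 0 (fun y => Φ y 0) x * v 0 (Φ x) + pd 0 (fun y => Φ y 1) x * v 1 (Φ x))
          * pd 1 φ x)
        + ∫ x, (pd 1 (fun y => Φ y 0) x * v 0 (Φ x) + pd 1 (fun y => Φ y 1) x * v 1 (Φ x))
          * pd 0 φ x := by
  obtain ⟨C, hC, hCU, hmaps, hev⟩ := h.exists_compact_nhd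
  obtain ⟨A, hA⟩ := h.lipschitz
  obtain ⟨L, hL⟩ := h.exists_lipschitz_test
  obtain ⟨B, hB⟩ := exists_abs_le_of_lipschitz_compact hL.continuous h.compact_test
  have intC : ∀ {g}, LocInt U g → Integrable (C.indicator g) := fun hg =>
    (integrable_indicator_iff hC.measurableSet).2 (hg C hC hCU)
  have hcC : ∀ g : Pt → ℝ, HasCompactSupport (C.indicator g) := fun g =>
    HasCompactSupport.of_support_subset_isCompact hC (support_indicator_subset)
  let J : Fin 2 → Fin 2 → Pt → ℝ := fun i j => pd j (fun y => Φ y i)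
  have mJ : ∀ i j, Measurable (J i j) := fun i j => measurable_pd j _
  have bJ : ∀ i j x, |J i j x| ≤ A := fun i j x => abs_pd_le (lipschitzWith_coord hA i) j x
  have mul_le : ∀ {a b a' b' : ℝ}, |a| ≤ a' → |b| ≤ b' → |a * b| ≤ a' * b' := by
    intro a b a' b' h1 h2
    rw [abs_mul]
    exact mul_le_mul h1 h2 (abs_nonneg _) ((abs_nonneg _).trans h1)
  have sub_le : ∀ {a b a' b' : ℝ}, |a| ≤ a' → |b| ≤ b' → |a - b| ≤ a' + b' := fun h1 h2 =>
    (abs_sub _ _).trans (add_le_add h1 h2)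
  -- `Ac` is `φ det DΦ` and `Av i` is `dφ ∧ dΦ_i`: the coefficients multiplying the mollified fields
  -- once the identity is written so that no derivative of a field remains.
  let Ac : Pt → ℝ := fun x => φ x * (J 0 0 x * J 1 1 x - J 0 1 x * J 1 0 x)
  let Av : Fin 2 → Pt → ℝ := fun i x => pd 0 φ x * J i 1 x - pd 1 φ x * J i 0 x
  have mAc : Measurable Ac :=
    hL.continuous.measurable.mul (((mJ 0 0).mul (mJ 1 1)).sub ((mJ 0 1).mul (mJ 1 0)))
  have mAv : ∀ i, Measurable (Av i) := fun i =>
    ((measurable_pd 0 φ).mul (mJ i 1)).sub ((measurable_pd 1 φ).mul (mJ i 0))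
  have bAc : ∀ x, |Ac x| ≤ B * (A * A + A * A) := fun x =>
    mul_le (hB x) (sub_le (mul_le (bJ _ _ x) (bJ _ _ x)) (mul_le (bJ _ _ x) (bJ _ _ x)))
  have bAv : ∀ i x, |Av i x| ≤ L * A + L * A := fun i x =>
    sub_le (mul_le (abs_pd_le hL 0 x) (bJ _ _ x)) (mul_le (abs_pd_le hL 1 x) (bJ _ _ x))
  have t0 := h.tendsto_moll (intC hc) mAc bAc
  have t1 := fun i => h.tendsto_moll (intC (hv i)) (mAv i) (bAv i)
  have t2 := (t1 0).add (t1 1)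
  have ms := (isClosed_tsupport φ).measurableSet
  have suppAv : ∀ (i : Fin 2) (g : Pt → ℝ),
      ∫ x in tsupport φ, g x * Av i x = ∫ x, g x * Av i x := by
    intro i g
    refine setIntegral_eq_integral_of_forall_compl_eq_zero fun x hx => ?_
    simp only [Av, pd_eq_zero_of_notMem_tsupport hx]
    ring
  have key : ∀ᶠ k in atTop, ∫ x in tsupport φ, moll k (C.indicator c) (Φ x) * Ac x
      = (∫ x in tsupport φ, moll k (C.indicator (v 0)) (Φ x) * Av 0 x)
          + ∫ x in tsupport φ, moll k (C.indicator (v 1)) (Φ x) * Av 1 x := by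
    filter_upwards [hev] with k hk
    have hs := fun i => contDiff_moll (intC (hv i)) k
    have hl := fun i => ContDiff.lipschitzWith_of_hasCompactSupport
      (hasCompactSupport_moll (hcC (v i)) k) (hs i) (by simp)
    obtain ⟨D₀, hD₀⟩ := hl 0
    obtain ⟨D₁, hD₁⟩ := hl 1
    obtain ⟨B₀, hB₀⟩ := exists_abs_le_of_lipschitz_compact hD₀.continuous
      (hasCompactSupport_moll (hcC (v 0)) k)
    obtain ⟨B₁, hB₁⟩ := exists_abs_le_of_lipschitz_compact hD₁.continuous
      (hasCompactSupport_moll (hcC (v 1)) k)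
    have e := integral_curl_pullback hA h.compact hL h.compact_test
      ((hs 0).differentiable (by simp)) hD₀ hB₀ ((hs 1).differentiable (by simp)) hD₁ hB₁
    rw [suppAv, suppAv]
    simp only [Av, J]
    rw [← e]
    simp only [mul_comm (φ _)]
    rw [← setIntegral_mul_test]
    refine setIntegral_congr_fun ms fun x hx => ?_
    have hp : pd 1 (moll k (C.indicator (v 0))) (Φ x) - pd 0 (moll k (C.indicator (v 1))) (Φ x)
        = moll k (C.indicator c) (Φ x) := by
      rw [pd_moll_indicator h.isOpen.measurableSet hCU (intC (hv 0)) (hk x hx),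
        pd_moll_indicator h.isOpen.measurableSet hCU (intC (hv 1)) (hk x hx),
        moll_indicator h.isOpen.measurableSet hCU (hk x hx),
        hw _ (isTest_bumpAt ((hk x hx).trans hCU))]
      ring
    simp only [hp, Ac, J]
    ring
  have lim := tendsto_nhds_unique (t0.congr' key) t2
  have ind : ∀ (g : Pt → ℝ), ∀ x ∈ tsupport φ, C.indicator g (Φ x) = g (Φ x) := fun g x hx =>
    indicator_of_mem (hmaps hx) g
  rw [setIntegral_congr_fun ms fun x hx => by rw [ind c x hx]] at lim
  rw [← setIntegral_mul_test, ← setIntegral_mul_pd, ← setIntegral_mul_pd]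
  have ip : ∀ i j l, IntegrableOn (fun x => C.indicator (v i) (Φ x) * (J i j x * pd l φ x))
      (tsupport φ) := fun i j l =>
    h.integrableOn_moll_mul (intC (hv i)) ((mJ i j).mul (measurable_pd l φ))
      (fun x => mul_le (bJ i j x) (abs_pd_le hL l x))
  have e1 : ∀ j l, ∫ x in tsupport φ, (J 0 j x * v 0 (Φ x) + J 1 j x * v 1 (Φ x)) * pd l φ x
      = (∫ x in tsupport φ, C.indicator (v 0) (Φ x) * (J 0 j x * pd l φ x))
        + ∫ x in tsupport φ, C.indicator (v 1) (Φ x) * (J 1 j x * pd l φ x) := by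
    intro j l
    rw [← integral_add (ip 0 j l) (ip 1 j l)]
    refine setIntegral_congr_fun ms fun x hx => ?_
    simp only [ind _ x hx]
    ring
  have e2 : ∀ i, ∫ x in tsupport φ, C.indicator (v i) (Φ x) * Av i x
      = (∫ x in tsupport φ, C.indicator (v i) (Φ x) * (J i 1 x * pd 0 φ x))
        - ∫ x in tsupport φ, C.indicator (v i) (Φ x) * (J i 0 x * pd 1 φ x) := by
    intro i
    rw [← integral_sub (ip i 1 0) (ip i 0 1)]
    congr 1
    ext x
    simp only [Av]
    ring
  rw [e2, e2] at lim
  have e0 : ∫ x in tsupport φ, ((J 0 0 x * J 1 1 x - J 0 1 x * J 1 0 x) * c (Φ x)) * φ x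
      = ∫ x in tsupport φ, c (Φ x) * Ac x := by
    congr 1
    ext x
    simp only [Ac]
    ring
  simp only [J] at e0 e1 lim
  rw [e0, lim, e1, e1]
  ring

end PullbackData

end Pullback

/-! ### Product weights and the law of the averaged point -/

noncomputable section ProductWeights

open Filter Topology
open scoped NNReal ENNReal

variable {ι : Type} [Fintype ι]

/-- The product of Lebesgue measures on the disks around the points `A a`. -/
def diskMeasure (ρ : ℝ) (A : ι → Pt) : Measure (ι → Pt) :=
  Measure.pi fun a => volume.restrict (disk ρ (A a))

/-- The product of the weights `κ`. -/
def weight (l : ℕ) (ρ : ℝ) (A y : ι → Pt) : ℝ := ∏ a, kappa l ρ (A a) (y a)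

instance isFiniteMeasure_restrict_disk (ρ : ℝ) (a : Pt) :
    IsFiniteMeasure (volume.restrict (disk ρ a)) :=
  ⟨by rw [Measure.restrict_apply_univ]; exact (isCompact_disk ρ a).measure_lt_top⟩

instance isFiniteMeasure_diskMeasure (ρ : ℝ) (A : ι → Pt) : IsFiniteMeasure (diskMeasure ρ A) := by
  unfold diskMeasure; infer_instance

theorem continuous_kappa (l : ℕ) (ρ : ℝ) (a : Pt) : Continuous (kappa l ρ a) := by
  have := continuous_pval (eta l ρ a)
  unfold kappa
  fun_prop

theorem continuous_weight (l : ℕ) (ρ : ℝ) (A : ι → Pt) : Continuous (weight l ρ A) :=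
  continuous_finsetProd _ fun a _ => (continuous_kappa l ρ (A a)).comp (continuous_apply a)

theorem convex_disk (ρ : ℝ) (a : Pt) : Convex ℝ (disk ρ a) := by
  refine Convex.inter ?_ (convex_closedBall a ρ)
  intro x hx y hy s t hs ht _
  simp only [mem_ofPred_eq, PiLp.add_apply, PiLp.smul_apply, smul_eq_mul] at *
  positivity

theorem ae_mem_interior_disk (ρ : ℝ) (a : Pt) :
    ∀ᵐ y ∂(volume.restrict (disk ρ a)), y ∈ interior (disk ρ a) := by
  have h0 := (convex_disk ρ a).addHaar_frontier (μ := volume)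
  rw [ae_restrict_iff' (isCompact_disk ρ a).measurableSet]
  filter_upwards [measure_eq_zero_iff_ae_notMem.1 h0] with y hy hyD
  by_contra h
  exact hy ⟨subset_closure hyD, h⟩

theorem ae_diskMeasure_mem_interior (ρ : ℝ) (A : ι → Pt) :
    ∀ᵐ y ∂(diskMeasure ρ A), ∀ a, y a ∈ interior (disk ρ (A a)) :=
  eventually_all.2 fun a => Measure.tendsto_eval_ae_ae.eventually (ae_mem_interior_disk ρ (A a))

/-- Tonelli, integrating first in the `i`-th point. The constant is the total mass of the other
disks and depends on neither `f` nor `b`. -/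
theorem lintegral_diskMeasure_le [DecidableEq ι] (ρ : ℝ) (A : ι → Pt) (i : ι) :
    ∃ c : ℝ≥0, ∀ f : (ι → Pt) → ℝ≥0∞, Measurable f → ∀ b : ℝ≥0∞,
      (∀ y, ∫⁻ z in disk ρ (A i), f (Function.update y i z) ≤ b) →
      ∫⁻ y, f y ∂(diskMeasure ρ A) ≤ c * b := by
  let μ : ι → Measure Pt := fun a => volume.restrict (disk ρ (A a))
  let ν := Measure.pi fun j : ((Finset.univ.erase i : Finset ι) : Type) => μ j
  refine ⟨(ν univ).toNNReal, fun f hf b hb => ?_⟩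
  rw [ENNReal.coe_toNNReal (measure_ne_top ν _)]
  have h1 := lintegral_eq_lmarginal_univ (μ := μ) (f := f) (A : ι → Pt)
  have h2 := lmarginal_insert' (μ := μ) f hf (Finset.notMem_erase i Finset.univ)
  rw [Finset.insert_erase (Finset.mem_univ i)] at h2
  rw [diskMeasure, h1, h2]
  refine (lmarginal_mono (g := fun _ => b) hb _).trans (le_of_eq ?_)
  simp only [lmarginal, lintegral_const]
  rw [mul_comm]

/-- The law of a convex combination with one coefficient at least `1/3` has bounded density. -/
theorem map_sum_smul_le (ρ : ℝ) (A : ι → Pt) :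
    ∃ c : ℝ≥0, ∀ (lam : ι → ℝ) (i : ι), 1 / 3 ≤ lam i →
      (diskMeasure ρ A).map (fun y => ∑ b, lam b • y b) ≤ c • volume := by
  classical
  choose c hc using lintegral_diskMeasure_le ρ A
  -- With the other points frozen, `y i ↦ ∑ b, lam b • y b` is a translation composed with scaling
  -- by `lam i ≥ 1/3`. In the plane its preimages have volume at most `(1/3)⁻² = 9` times as large.
  -- The sum over `i` removes the dependence on the index.
  refine ⟨(∑ i, c i) * 9, fun lam i hi => Measure.le_iff.2 fun s hs => ?_⟩
  have hm : Measurable fun y : ι → Pt => ∑ b, lam b • y b := by fun_prop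
  rw [Measure.map_apply hm hs, ← lintegral_indicator_one (hm hs)]
  have hpos : 0 < lam i := by linarith
  refine (hc i _ (measurable_one.indicator (hm hs)) (9 * volume s) fun y => ?_).trans ?_
  · refine (setLIntegral_le_lintegral _ _).trans ?_
    set c₀ := ∑ b ∈ Finset.univ.erase i, lam b • y b
    have e : ∀ z, ∑ b, lam b • (Function.update y i z) b = c₀ + lam i • z := by
      intro z
      rw [← Finset.sum_erase_add _ _ (Finset.mem_univ i), Function.update_self]
      congr 1
      refine Finset.sum_congr rfl fun b hb => ?_
      rw [Function.update_of_ne (Finset.ne_of_mem_erase hb)]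
    have e2 : ∀ z, ((fun y : ι → Pt => ∑ b, lam b • y b) ⁻¹' s).indicator (1 : (ι → Pt) → ℝ≥0∞)
        (Function.update y i z)
        = ((fun z => lam i • z) ⁻¹' ((fun p => c₀ + p) ⁻¹' s)).indicator 1 z := by
      intro z
      simp only [indicator, mem_preimage, e]
      rfl
    simp only [e2]
    have ms : MeasurableSet ((fun z => lam i • z) ⁻¹' ((fun p => c₀ + p) ⁻¹' s)) :=
      (measurable_const_smul (lam i)) ((measurable_const_add c₀) hs)
    rw [lintegral_indicator_one ms, Measure.addHaar_preimage_smul _ hpos.ne', measure_preimage_add]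
    gcongr
    rw [finrank_euclideanSpace_fin]
    have h9 : (lam i ^ 2)⁻¹ ≤ 9 := by
      rw [inv_le_comm₀ (by positivity) (by norm_num)]
      nlinarith
    rw [abs_of_pos (by positivity)]
    exact (ENNReal.ofReal_le_ofReal h9).trans (by simp)
  · rw [← mul_assoc]
    change _ ≤ ((((∑ i, c i) * 9 : ℝ≥0) : ℝ≥0∞)) * volume s
    push_cast
    gcongr
    exact_mod_cast Finset.single_le_sum (f := c) (fun _ _ => zero_le) (Finset.mem_univ i)

/-- The plain bound serves the factors that are discarded, the bound by `r³` the single factor whose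
decay at the axis is kept. -/
theorem exists_kappa_le (l : ℕ) (ρ : ℝ) (A : ι → Pt) :
    ∃ M : ℝ≥0, ∀ a, ∀ y ∈ disk ρ (A a), |kappa l ρ (A a) y| ≤ M ∧
      |kappa l ρ (A a) y| ≤ M * y 0 ^ 3 := by
  have h1 : ∀ a, ∃ M : ℝ, ∀ y ∈ disk ρ (A a), |kappa l ρ (A a) y| ≤ M := fun a =>
    (isCompact_disk ρ (A a)).exists_bound_of_continuousOn (continuous_kappa l ρ (A a)).continuousOn
  have h2 : ∀ a, ∃ M : ℝ, ∀ y ∈ disk ρ (A a), |pval (eta l ρ (A a)) y| ≤ M := fun a =>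
    (isCompact_disk ρ (A a)).exists_bound_of_continuousOn (continuous_pval _).continuousOn
  choose M₁ hM₁ using h1
  choose M₂ hM₂ using h2
  refine ⟨∑ a, ((M₁ a).toNNReal + (M₂ a).toNNReal), fun a y hy => ?_⟩
  have hle : (M₁ a).toNNReal + (M₂ a).toNNReal ≤ ∑ a, ((M₁ a).toNNReal + (M₂ a).toNNReal) :=
    Finset.single_le_sum (f := fun a => (M₁ a).toNNReal + (M₂ a).toNNReal)
      (fun _ _ => zero_le) (Finset.mem_univ a)
  have hle1 : M₁ a ≤ (∑ a, ((M₁ a).toNNReal + (M₂ a).toNNReal) : ℝ≥0) :=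
    (Real.le_coe_toNNReal _).trans (NNReal.coe_le_coe.2 (le_self_add.trans hle))
  have hle2 : M₂ a ≤ (∑ a, ((M₁ a).toNNReal + (M₂ a).toNNReal) : ℝ≥0) :=
    (Real.le_coe_toNNReal _).trans (NNReal.coe_le_coe.2 (le_add_self.trans hle))
  refine ⟨(hM₁ a y hy).trans hle1, ?_⟩
  have h0 : 0 ≤ y 0 := hy.1
  rw [kappa, abs_mul, abs_of_nonneg (by positivity), mul_comm]
  exact mul_le_mul_of_nonneg_right ((hM₂ a y hy).trans hle2) (by positivity)

/-- The weight is dominated by the third power of the radius at the averaged point. -/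
theorem exists_abs_weight_le (l : ℕ) (ρ : ℝ) (A : ι → Pt) :
    ∃ C : ℝ≥0, ∀ (lam : ι → ℝ) (i : ι), (∀ b, 0 ≤ lam b) → 1 / 3 ≤ lam i →
      ∀ y, (∀ a, y a ∈ disk ρ (A a)) →
        |weight l ρ A y| ≤ C * (∑ b, lam b • y b : Pt) 0 ^ 3 := by
  classical
  obtain ⟨M, hM⟩ := exists_kappa_le l ρ A
  -- The number `27 = 3³` comes from `r(y i) ≤ 3 r(x̃)`, where all radii are nonnegative and `lam i
  -- ≥ 1/3`. Using `M + 1` makes every factor at least one, so the product over the other indices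
  -- may be enlarged to the full product.
  refine ⟨27 * ((∏ b : ι, (M + 1)) * M), fun lam i h0 hi y hy => ?_⟩
  have hr : lam i * y i 0 ≤ (∑ b, lam b • y b : Pt) 0 := by
    have : (∑ b, lam b • y b : Pt) 0 = ∑ b, lam b * y b 0 := by
      simp
    rw [this]
    exact Finset.single_le_sum (f := fun b => lam b * y b 0)
      (fun b _ => mul_nonneg (h0 b) (hy b).1) (Finset.mem_univ i)
  have hyi : 0 ≤ y i 0 := (hy i).1
  have hr3 : y i 0 ≤ 3 * (∑ b, lam b • y b : Pt) 0 := by nlinarith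
  have h3 : y i 0 ^ 3 ≤ 27 * (∑ b, lam b • y b : Pt) 0 ^ 3 := by
    calc y i 0 ^ 3 ≤ (3 * (∑ b, lam b • y b : Pt) 0) ^ 3 := by gcongr
      _ = _ := by ring
  rw [weight, Finset.abs_prod, ← Finset.prod_erase_mul _ _ (Finset.mem_univ i)]
  have hp : ∏ a ∈ Finset.univ.erase i, |kappa l ρ (A a) (y a)| ≤ ∏ b : ι, ((M : ℝ) + 1) := by
    refine (Finset.prod_le_prod (fun _ _ => abs_nonneg _)
      (fun a _ => ((hM a _ (hy a)).1.trans (by linarith : (M : ℝ) ≤ M + 1)))).trans ?_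
    refine Finset.prod_le_prod_of_subset_of_one_le (Finset.erase_subset _ _)
      (fun _ _ => by positivity) fun _ _ _ => by linarith [M.2]
  calc (∏ a ∈ Finset.univ.erase i, |kappa l ρ (A a) (y a)|) * |kappa l ρ (A i) (y i)|
      ≤ (∏ b : ι, ((M : ℝ) + 1)) * (M * (27 * (∑ b, lam b • y b : Pt) 0 ^ 3)) := by
        refine mul_le_mul hp ((hM i _ (hy i)).2.trans ?_) (abs_nonneg _) (by positivity)
        gcongr
    _ = _ := by push_cast; ring

/-- The central estimate: the weight costs at most `r³` at the averaged point, and the law of that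
point has bounded density. The constant does not depend on the coefficients `lam`, which later are
the hat function values at a variable `x`. -/
theorem lintegral_weight_mul_le (l : ℕ) (ρ : ℝ) (A : ι → Pt) :
    ∃ C : ℝ≥0, ∀ (lam : ι → ℝ) (i : ι), (∀ b, 0 ≤ lam b) → 1 / 3 ≤ lam i →
      ∀ H : Set Pt, MeasurableSet H → (∀ᵐ y ∂(diskMeasure ρ A), ∑ b, lam b • y b ∈ H) →
      ∀ G : Pt → ℝ≥0∞, Measurable G →
        ∫⁻ y, ‖weight l ρ A y‖ₑ * G (∑ b, lam b • y b) ∂(diskMeasure ρ A)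
          ≤ C * ∫⁻ x in H, ‖x 0 ^ 3‖ₑ * G x := by
  obtain ⟨c, hc⟩ := map_sum_smul_le ρ A
  obtain ⟨C, hC⟩ := exists_abs_weight_le l ρ A
  refine ⟨C * c, fun lam i h0 hi H hH hmem G hG => ?_⟩
  have hm : Measurable fun y : ι → Pt => ∑ b, lam b • y b := by fun_prop
  have hmG : Measurable (H.indicator fun x : Pt => ‖x 0 ^ 3‖ₑ * G x) :=
    Measurable.indicator (by fun_prop) hH
  calc ∫⁻ y, ‖weight l ρ A y‖ₑ * G (∑ b, lam b • y b) ∂(diskMeasure ρ A)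
      ≤ ∫⁻ y, C * (H.indicator fun x : Pt => ‖x 0 ^ 3‖ₑ * G x) (∑ b, lam b • y b)
          ∂(diskMeasure ρ A) := by
        refine lintegral_mono_ae ?_
        filter_upwards [hmem, ae_diskMeasure_mem_interior ρ A] with y hy hy'
        rw [indicator_of_mem hy, ← mul_assoc]
        gcongr
        have h1 := hC lam i h0 hi y fun a => interior_subset (hy' a)
        rw [enorm_eq_nnnorm, enorm_eq_nnnorm, ← ENNReal.coe_mul, ENNReal.coe_le_coe,
          ← NNReal.coe_le_coe]
        push_cast
        exact h1.trans (mul_le_mul_of_nonneg_left (le_abs_self _) C.2)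
    _ = C * ∫⁻ x, (H.indicator fun x : Pt => ‖x 0 ^ 3‖ₑ * G x) x
          ∂((diskMeasure ρ A).map fun y => ∑ b, lam b • y b) := by
        rw [lintegral_map hmG hm]; exact lintegral_const_mul _ (hmG.comp hm)
    _ ≤ C * ∫⁻ x, (H.indicator fun x : Pt => ‖x 0 ^ 3‖ₑ * G x) x ∂(c • volume) := by
        gcongr
        exact hc lam i hi
    _ = _ := by
        rw [← lintegral_indicator hH, lintegral_smul_measure, ENNReal.coe_mul, mul_assoc]
        rfl

/-- The averaged point has an absolutely continuous law, so averages do not see changes of a field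
on null sets. -/
theorem ae_sum_smul_notMem {ρ : ℝ} {A : ι → Pt} {lam : ι → ℝ} {i : ι} (hi : 1 / 3 ≤ lam i)
    {N : Set Pt} (hN : volume N = 0) :
    ∀ᵐ y ∂(diskMeasure ρ A), ∑ b, lam b • y b ∉ N := by
  obtain ⟨c, hc⟩ := map_sum_smul_le ρ A
  have hm : Measurable fun y : ι → Pt => ∑ b, lam b • y b := by fun_prop
  have h1 : ((diskMeasure ρ A).map fun y => ∑ b, lam b • y b) N = 0 := by
    refine le_antisymm ((hc lam i hi N).trans ?_) (zero_le)
    rw [Measure.smul_apply, hN, smul_zero]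
  exact ae_of_ae_map hm.aemeasurable (measure_eq_zero_iff_ae_notMem.1 h1)

/-- The moment condition on `η_a` for the polynomial 1. It is the only moment that the commuting
property needs. -/
theorem integral_kappa {l : ℕ} {ρ : ℝ} (hρ : 0 < ρ) {a : Pt} (ha : 0 ≤ a 0) :
    ∫ y in disk ρ a, kappa l ρ a y = 1 := by
  have h := (eta_spec l hρ ha).2 1 (by simp)
  simp only [pval, map_one, mul_one] at h
  rw [← h]
  congr 1
  ext y
  simp only [kappa, pval]
  ring

/-- The weights around points that are not involved integrate to one. -/
theorem integral_weight_comp {ι' : Type} [Fintype ι'] {l : ℕ} {ρ : ℝ} (hρ : 0 < ρ) {A : ι → Pt}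
    (hA : ∀ a, 0 ≤ A a 0) {e : ι' → ι} (he : Function.Injective e) (f : (ι' → Pt) → ℝ) :
    ∫ y, weight l ρ A y * f (y ∘ e) ∂(diskMeasure ρ A)
      = ∫ y, weight l ρ (A ∘ e) y * f y ∂(diskMeasure ρ (A ∘ e)) := by
  classical
  -- Splitting the indices into the image of `e` and its complement splits the product measure, so
  -- the integral factors and the complementary factor is a product of integrals equal to one.
  let g : ι' ⊕ ((range e)ᶜ : Set ι) ≃ ι :=
    (Equiv.sumCongr (Equiv.ofInjective e he) (Equiv.refl _)).trans (Equiv.Set.sumCompl (range e))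
  have hg1 : ∀ i, g (Sum.inl i) = e i := fun i => rfl
  have hg2 : ∀ r, g (Sum.inr r) = r := fun r => rfl
  let μ : ι → Measure Pt := fun a => volume.restrict (disk ρ (A a))
  have m1 := measurePreserving_piCongrLeft μ g
  have m2 := measurePreserving_sumPiEquivProdPi_symm (fun s => μ (g s))
  have m := m1.comp m2
  have hval : ∀ (p : (ι' → Pt) × (((range e)ᶜ : Set ι) → Pt)) (s),
      (MeasurableEquiv.piCongrLeft (fun _ : ι => Pt) g)
        ((MeasurableEquiv.sumPiEquivProdPi fun _ => Pt).symm p) (g s)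
        = Sum.elim p.1 p.2 s := by
    intro p s
    rw [MeasurableEquiv.coe_piCongrLeft, Equiv.piCongrLeft_apply_apply]
    cases s <;> rfl
  have h1 := m.integral_comp
    (MeasurableEquiv.measurableEmbedding ((MeasurableEquiv.sumPiEquivProdPi fun _ => Pt).symm.trans
      (MeasurableEquiv.piCongrLeft (fun _ : ι => Pt) g)))
    (fun y => weight l ρ A y * f (y ∘ e))
  rw [diskMeasure, ← h1]
  have h2 : ∀ p : (ι' → Pt) × (((range e)ᶜ : Set ι) → Pt),
      weight l ρ A ((MeasurableEquiv.piCongrLeft (fun _ : ι => Pt) g)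
        ((MeasurableEquiv.sumPiEquivProdPi fun _ => Pt).symm p))
      * f ((MeasurableEquiv.piCongrLeft (fun _ : ι => Pt) g)
        ((MeasurableEquiv.sumPiEquivProdPi fun _ => Pt).symm p) ∘ e)
      = (weight l ρ (A ∘ e) p.1 * f p.1)
        * ∏ r : ((range e)ᶜ : Set ι), kappa l ρ (A r) (p.2 r) := by
    intro p
    have e1 : (MeasurableEquiv.piCongrLeft (fun _ : ι => Pt) g)
        ((MeasurableEquiv.sumPiEquivProdPi fun _ => Pt).symm p) ∘ e = p.1 := by
      ext1 i
      exact hval p (Sum.inl i)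
    rw [e1, weight, ← Equiv.prod_comp g, Fintype.prod_sum_type]
    simp only [hval, Sum.elim_inl, Sum.elim_inr]
    simp only [hg1, hg2, weight, Function.comp_apply]
    ring
  simp only [Function.comp_apply] at h2 ⊢
  rw [integral_congr_ae (.of_forall h2), integral_prod_mul
    (fun y : ι' → Pt => weight l ρ (A ∘ e) y * f y)
    (fun z : ((range e)ᶜ : Set ι) → Pt => ∏ r : ((range e)ᶜ : Set ι), kappa l ρ (A r) (z r))]
  have h3 : ∫ z : ((range e)ᶜ : Set ι) → Pt, ∏ r : ((range e)ᶜ : Set ι), kappa l ρ (A r) (z r)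
      ∂(Measure.pi fun r => μ (g (Sum.inr r))) = 1 := by
    rw [integral_fintype_prod_eq_prod]
    exact Finset.prod_eq_one fun r _ => integral_kappa hρ (hA r)
  rw [h3, mul_one]
  rfl

/-- The iterated integral defining `avg` as an integral over the product of the disks. -/
theorem avg_eq_integral {l : ℕ} {ρ : ℝ} {K : Fin 3 → Pt} {f : (Fin 3 → Pt) → ℝ}
    (hf : Integrable (fun y => weight l ρ K y * f y) (diskMeasure ρ K)) :
    avg l ρ K f = ∫ y, weight l ρ K y * f y ∂(diskMeasure ρ K) := by
  let μ : Fin 3 → Measure Pt := fun a => volume.restrict (disk ρ (K a))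
  have m1 := (measurePreserving_piFinSuccAbove μ 0).symm
  have m2 := (measurePreserving_piFinTwo fun j => μ ((0 : Fin 3).succAbove j)).symm
  have hval : ∀ y₁ y₂ y₃ : Pt, (MeasurableEquiv.piFinSuccAbove (fun _ => Pt) (0 : Fin 3)).symm
      (y₁, (MeasurableEquiv.piFinTwo fun _ => Pt).symm (y₂, y₃)) = ![y₁, y₂, y₃] := by
    intro y₁ y₂ y₃
    ext1 i
    fin_cases i <;> rfl
  have i1 := (m1.integrable_comp_emb (MeasurableEquiv.measurableEmbedding _)).2 hf
  have e1 := m1.integral_comp (MeasurableEquiv.measurableEmbedding _)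
    (fun y => weight l ρ K y * f y)
  simp only [Function.comp_def] at i1
  rw [diskMeasure, ← e1, integral_prod _ i1, avg]
  refine integral_congr_ae ?_
  filter_upwards [i1.prod_right_ae] with y₁ hy₁
  have i2 := (m2.integrable_comp_emb (MeasurableEquiv.measurableEmbedding _)).2 hy₁
  have e2 := m2.integral_comp (MeasurableEquiv.measurableEmbedding _)
    (fun z => weight l ρ K ((MeasurableEquiv.piFinSuccAbove (fun _ => Pt) (0 : Fin 3)).symm (y₁, z))
      * f ((MeasurableEquiv.piFinSuccAbove (fun _ => Pt) (0 : Fin 3)).symm (y₁, z)))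
  simp only [Function.comp_def] at i2
  rw [← e2, integral_prod _ i2]
  refine integral_congr_ae (.of_forall fun y₂ => integral_congr_ae (.of_forall fun y₃ => ?_))
  simp only [hval, weight, Fin.prod_univ_three]
  rfl

end ProductWeights

/-! ### Barycentric coordinates, hat functions and the piecewise affine mesh map -/

noncomputable section MeshGeometry

open Filter Topology
open scoped NNReal ENNReal

/-- The gradient of the barycentric coordinate `λ_i`. -/
def gradBary (K : Fin 3 → Pt) (i : Fin 3) (j : Fin 2) : ℝ :=
  ![K (i + 1) 1 - K (i + 2) 1, K (i + 2) 0 - K (i + 1) 0] j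
    / area2 (K i) (K (i + 1)) (K (i + 2))

theorem bary_eq (K : Fin 3 → Pt) (i : Fin 3) (x : Pt) :
    bary K i x = bary K i 0 + (gradBary K i 0 * x 0 + gradBary K i 1 * x 1) := by
  simp only [bary, gradBary, area2, Matrix.cons_val_zero, Matrix.cons_val_one, PiLp.zero_apply]
  ring

theorem area2_rotate (K : Fin 3 → Pt) (i : Fin 3) :
    area2 (K i) (K (i + 1)) (K (i + 2)) = area2 (K 0) (K 1) (K 2) := by
  fin_cases i
  · rfl
  · exact (bary_denom K).1
  · exact (bary_denom K).2

theorem bary_vertex {K : Fin 3 → Pt} (h : area2 (K 0) (K 1) (K 2) ≠ 0) (i j : Fin 3) :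
    bary K i (K j) = if i = j then 1 else 0 := by
  simp only [bary, area2_rotate]
  split_ifs with hij
  · rw [← hij, area2_rotate, div_self h]
  · rw [div_eq_zero_iff]
    left
    have : j = i + 1 ∨ j = i + 2 := by
      revert hij; revert i j; decide
    rcases this with rfl | rfl <;> simp only [area2] <;> ring

theorem bary_sum_smul {κ : Type} [Fintype κ] (K : Fin 3 → Pt) (i : Fin 3) (w : κ → ℝ)
    (hw : ∑ j, w j = 1) (p : κ → Pt) :
    bary K i (∑ j, w j • p j) = ∑ j, w j * bary K i (p j) := by
  have e : ∀ k : Fin 2, (∑ j, w j • p j : Pt) k = ∑ j, w j * p j k := fun k => by simp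
  rw [bary_eq, e, e]
  simp only [bary_eq K i (p _)]
  simp only [mul_add, Finset.sum_add_distrib, ← Finset.sum_mul, hw, Finset.mul_sum, one_mul]
  congr 2 <;> exact Finset.sum_congr rfl fun j _ => by ring

theorem bary_combo (K : Fin 3 → Pt) (i : Fin 3) {s t : ℝ} (h : s + t = 1) (x y : Pt) :
    bary K i (s • x + t • y) = s * bary K i x + t * bary K i y := by
  have := bary_sum_smul K i ![s, t] (by simpa using h) ![x, y]
  simpa using this

/-- The map `xt K y` preserves barycentric coordinates, from those of `K` to those of `y`;
exchanging the two triangles therefore inverts it as soon as `y` is nondegenerate. -/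
theorem xt_xt {K y : Fin 3 → Pt} (hK : AffineIndependent ℝ K)
    (hy : area2 (y 0) (y 1) (y 2) ≠ 0) (x : Pt) : xt y K (xt K y x) = x := by
  have h : ∀ i, bary y i (xt K y x) = bary K i x := by
    intro i
    rw [xt, bary_sum_smul _ _ _ (sum_bary hK x)]
    simp [bary_vertex hy]
  conv_rhs => rw [← sum_bary_smul hK x]
  rw [xt]
  simp only [h]

/-- The linear part of `x ↦ x̃_y`. -/
def xtLinear (K y : Fin 3 → Pt) : Pt →ₗ[ℝ] Pt where
  toFun x := ∑ i, (gradBary K i 0 * x 0 + gradBary K i 1 * x 1) • y i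
  map_add' x x' := by
    rw [← Finset.sum_add_distrib]
    refine Finset.sum_congr rfl fun i _ => ?_
    rw [← add_smul]
    congr 1
    simp only [PiLp.add_apply]
    ring
  map_smul' c x := by
    rw [Finset.smul_sum]
    refine Finset.sum_congr rfl fun i _ => ?_
    rw [smul_smul]
    congr 1
    simp only [PiLp.smul_apply, smul_eq_mul, RingHom.id_apply]
    ring

theorem xt_eq (K y : Fin 3 → Pt) (x : Pt) : xt K y x = xt K y 0 + xtLinear K y x := by
  simp only [xt, xtLinear, LinearMap.coe_mk, AddHom.coe_mk]
  rw [← Finset.sum_add_distrib]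
  refine Finset.sum_congr rfl fun i _ => ?_
  rw [← add_smul, bary_eq K i x]

/-- A preimage is contained in the image under the inverse affine map `xt y K`, so the absolute
determinant of the linear part of that map serves as constant. -/
theorem exists_volume_preimage_xt_le {K y : Fin 3 → Pt} (hK : AffineIndependent ℝ K)
    (hy : area2 (y 0) (y 1) (y 2) ≠ 0) :
    ∃ c : ℝ≥0, ∀ s : Set Pt, volume (xt K y ⁻¹' s) ≤ c * volume s := by
  refine ⟨Real.toNNReal |LinearMap.det (xtLinear y K)|, fun s => ?_⟩
  have hsub : xt K y ⁻¹' s ⊆ (fun p => xt y K 0 + p) '' (xtLinear y K '' s) := by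
    intro x hx
    exact ⟨_, ⟨_, hx, rfl⟩, by simp only; rw [← xt_eq, xt_xt hK hy]⟩
  refine (measure_mono hsub).trans ?_
  rw [image_add_left, measure_preimage_add, Measure.addHaar_image_linearMap]
  rfl

theorem hasFDerivAt_bary (K : Fin 3 → Pt) (i : Fin 3) (x : Pt) :
    HasFDerivAt (bary K i) (gradBary K i 0 • (EuclideanSpace.proj 0 : Pt →L[ℝ] ℝ)
      + gradBary K i 1 • (EuclideanSpace.proj 1 : Pt →L[ℝ] ℝ)) x := by
  have h0 := ((EuclideanSpace.proj 0 : Pt →L[ℝ] ℝ).hasFDerivAt (x := x)).const_smul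
    (gradBary K i 0)
  have h1 := ((EuclideanSpace.proj 1 : Pt →L[ℝ] ℝ).hasFDerivAt (x := x)).const_smul
    (gradBary K i 1)
  refine ((h0.add h1).const_add (bary K i 0)).congr_of_eventuallyEq (.of_forall fun z => ?_)
  exact bary_eq K i z

theorem jac_apply (K y : Fin 3 → Pt) (x : Pt) (i j : Fin 2) :
    jac K y x i j = ∑ k, gradBary K k j * y k i := by
  have h : HasFDerivAt (xt K y) _ x := HasFDerivAt.fun_sum (u := Finset.univ) fun k _ =>
    (hasFDerivAt_bary K k x).smul_const (y k)
  rw [jac, Matrix.of_apply, h.fderiv]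
  fin_cases j <;> simp [Fin.sum_univ_three]

theorem continuous_bary (K : Fin 3 → Pt) (i : Fin 3) : Continuous (bary K i) :=
  continuous_iff_continuousAt.2 fun x => (hasFDerivAt_bary K i x).continuousAt

theorem det_jac {K : Fin 3 → Pt} (hK : AffineIndependent ℝ K) (y : Fin 3 → Pt) (x : Pt) :
    (jac K y x).det = area2 (y 0) (y 1) (y 2) / area2 (K 0) (K 1) (K 2) := by
  have h := area2_ne_zero hK
  rw [Matrix.det_fin_two]
  simp only [jac_apply, Fin.sum_univ_three, gradBary, area2_rotate]
  simp only [Matrix.cons_val_zero, Matrix.cons_val_one, zero_add,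
    show (1 : Fin 3) + 1 = 2 from rfl, show (1 : Fin 3) + 2 = 0 from rfl,
    show (2 : Fin 3) + 1 = 0 from rfl, show (2 : Fin 3) + 2 = 1 from rfl]
  field_simp
  simp only [area2]
  ring

theorem bary_nonneg {K : Fin 3 → Pt} (hK : AffineIndependent ℝ K) {x : Pt} (hx : x ∈ tri K)
    (i : Fin 3) : 0 ≤ bary K i x := by
  have hsub : tri K ⊆ {x | 0 ≤ bary K i x} := by
    refine convexHull_min ?_ ?_
    · rintro _ ⟨j, rfl⟩
      rw [mem_ofPred_eq, bary_vertex (area2_ne_zero hK)]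
      split_ifs <;> norm_num
    · intro x hx y hy s t hs ht hst
      simp only [mem_ofPred_eq] at hx hy ⊢
      rw [bary_combo K i hst]
      positivity
  exact hsub hx

/-! ### Hat functions -/

/-- The restriction to the triangle `K` of the hat function of the vertex `a`. -/
def hatOn (K : Fin 3 → Pt) (a x : Pt) : ℝ := by
  classical exact ∑ i, if K i = a then bary K i x else 0

/-- The hat function of the vertex `a`. -/
def hat (T : Finset (Fin 3 → Pt)) (a : Pt) : Pt → ℝ := glue T fun K => hatOn K a

/-- The vertices of the mesh. -/
def vertices (T : Finset (Fin 3 → Pt)) : Finset Pt := by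
  classical exact T.biUnion fun K => Finset.univ.image K

theorem mem_vertices {T : Finset (Fin 3 → Pt)} {K : Fin 3 → Pt} (hK : K ∈ T) (i : Fin 3) :
    K i ∈ vertices T := by
  classical
  rw [vertices, Finset.mem_biUnion]
  exact ⟨K, hK, Finset.mem_image_of_mem K (Finset.mem_univ i)⟩

theorem exists_of_mem_vertices {T : Finset (Fin 3 → Pt)} {a : Pt} (ha : a ∈ vertices T) :
    ∃ K ∈ T, ∃ i, K i = a := by
  classical
  rw [vertices, Finset.mem_biUnion] at ha
  obtain ⟨K, hK, h⟩ := ha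
  obtain ⟨i, _, hi⟩ := Finset.mem_image.1 h
  exact ⟨K, hK, i, hi⟩

/-- The vertices of a triangle of the mesh as vertices of the mesh. -/
def vertexEmb {T : Finset (Fin 3 → Pt)} {K : Fin 3 → Pt} (hK : K ∈ T) (i : Fin 3) : vertices T :=
  ⟨K i, mem_vertices hK i⟩

theorem hatOn_combo (K : Fin 3 → Pt) (a : Pt) {s t : ℝ} (h : s + t = 1) (x y : Pt) :
    hatOn K a (s • x + t • y) = s * hatOn K a x + t * hatOn K a y := by
  classical
  simp only [hatOn, Finset.mul_sum, ← Finset.sum_add_distrib, mul_ite, mul_zero]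
  refine Finset.sum_congr rfl fun i _ => ?_
  split_ifs
  · exact bary_combo K i h x y
  · rw [add_zero]

open Classical in
theorem hatOn_vertex {K : Fin 3 → Pt} (hK : AffineIndependent ℝ K) (a : Pt) (j : Fin 3) :
    hatOn K a (K j) = if K j = a then 1 else 0 := by
  simp only [hatOn, bary_vertex (area2_ne_zero hK)]
  rw [Finset.sum_eq_single j]
  · simp
  · intro b _ hb
    simp [hb]
  · simp

theorem hatOn_nonneg {K : Fin 3 → Pt} (hK : AffineIndependent ℝ K) {x : Pt} (hx : x ∈ tri K)
    (a : Pt) : 0 ≤ hatOn K a x := by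
  classical
  rw [hatOn]
  refine Finset.sum_nonneg fun i _ => ?_
  split_ifs
  · exact bary_nonneg hK hx i
  · exact le_rfl

/-- Both functions are affine and agree at the common vertices, and conformity says that the
triangles meet exactly in the convex hull of those. This is what makes the hat functions, and hence
`meshMap`, continuous across edges. -/
theorem hatOn_eq_on_inter {Ω : Set Pt} {T : Finset (Fin 3 → Pt)} (hT : IsTriangulation Ω T)
    {K K' : Fin 3 → Pt} (hK : K ∈ T) (hK' : K' ∈ T) {x : Pt} (hx : x ∈ tri K) (hx' : x ∈ tri K')
    (a : Pt) : hatOn K a x = hatOn K' a x := by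
  have hsub : convexHull ℝ (range K ∩ range K') ⊆ {x | hatOn K a x = hatOn K' a x} := by
    refine convexHull_min ?_ ?_
    · rintro p ⟨⟨j, rfl⟩, ⟨j', hj'⟩⟩
      rw [mem_ofPred_eq]
      conv_rhs => rw [← hj']
      rw [hatOn_vertex (hT.nondegenerate K hK), hatOn_vertex (hT.nondegenerate K' hK'), hj']
    · intro x hx y hy s t _ _ hst
      simp only [mem_ofPred_eq] at hx hy ⊢
      rw [hatOn_combo K a hst, hatOn_combo K' a hst, hx, hy]
  rw [← hT.conforming K hK K' hK'] at hsub
  exact hsub ⟨hx, hx'⟩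

theorem hat_eq {Ω : Set Pt} {T : Finset (Fin 3 → Pt)} (hT : IsTriangulation Ω T)
    {K : Fin 3 → Pt} (hK : K ∈ T) {x : Pt} (hx : x ∈ tri K) (a : Pt) :
    hat T a x = hatOn K a x := by
  have h : ∃ K ∈ T, x ∈ tri K := ⟨K, hK, hx⟩
  rw [hat, glue, dif_pos h]
  exact hatOn_eq_on_inter hT h.choose_spec.1 hK h.choose_spec.2 hx a

theorem sum_vertices_ite {T : Finset (Fin 3 → Pt)} {K : Fin 3 → Pt} (hK : K ∈ T)
    {E : Type} [AddCommMonoid E] [Module ℝ E] (c : Fin 3 → ℝ) (y : vertices T → E) :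
    ∑ a : vertices T, (by classical exact ∑ i, if K i = a then c i else 0 : ℝ) • y a
      = ∑ i, c i • y (vertexEmb hK i) := by
  classical
  simp only [Finset.sum_smul]
  rw [Finset.sum_comm]
  refine Finset.sum_congr rfl fun i _ => ?_
  rw [Finset.sum_eq_single (vertexEmb hK i)]
  · simp [vertexEmb]
  · intro b _ hb
    rw [if_neg, zero_smul]
    intro h
    exact hb (Subtype.ext h.symm)
  · simp

/-- The piecewise affine map which moves every vertex `a` of the mesh to `y a`. -/
def meshMap (T : Finset (Fin 3 → Pt)) (y : vertices T → Pt) (x : Pt) : Pt :=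
  ∑ a : vertices T, hat T a x • y a

theorem meshMap_eq {Ω : Set Pt} {T : Finset (Fin 3 → Pt)} (hT : IsTriangulation Ω T)
    {K : Fin 3 → Pt} (hK : K ∈ T) {x : Pt} (hx : x ∈ tri K)
    (y : vertices T → Pt) : meshMap T y x = xt K (y ∘ vertexEmb hK) x := by
  simp only [meshMap, hat_eq hT hK hx]
  exact sum_vertices_ite hK (fun i => bary K i x) y

theorem exists_mem_tri {Ω : Set Pt} {T : Finset (Fin 3 → Pt)} (hT : IsTriangulation Ω T)
    {x : Pt} (hx : x ∈ Ω) : ∃ K ∈ T, x ∈ tri K := by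
  have : x ∈ ⋃ K ∈ T, tri K := hT.cover ▸ subset_closure hx
  simpa using this

theorem hat_nonneg {Ω : Set Pt} {T : Finset (Fin 3 → Pt)} (hT : IsTriangulation Ω T)
    {x : Pt} (hx : x ∈ Ω) (a : Pt) : 0 ≤ hat T a x := by
  obtain ⟨K, hK, hxK⟩ := exists_mem_tri hT hx
  rw [hat_eq hT hK hxK]
  exact hatOn_nonneg (hT.nondegenerate K hK) hxK a

theorem sum_hat {Ω : Set Pt} {T : Finset (Fin 3 → Pt)} (hT : IsTriangulation Ω T)
    {x : Pt} (hx : x ∈ Ω) : ∑ a : vertices T, hat T a x = 1 := by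
  obtain ⟨K, hK, hxK⟩ := exists_mem_tri hT hx
  simp only [hat_eq hT hK hxK]
  have := sum_vertices_ite hK (fun i => bary K i x) (fun _ => (1 : ℝ))
  simp only [smul_eq_mul, mul_one] at this
  exact this.trans (sum_bary (hT.nondegenerate K hK) x)

theorem hat_vertex_eq {Ω : Set Pt} {T : Finset (Fin 3 → Pt)} (hT : IsTriangulation Ω T)
    {K : Fin 3 → Pt} (hK : K ∈ T) {x : Pt} (hx : x ∈ tri K) (i : Fin 3) :
    hat T (K i) x = bary K i x := by
  classical
  rw [hat_eq hT hK hx, hatOn, Finset.sum_eq_single i]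
  · simp
  · intro b _ hb
    rw [if_neg]
    exact fun h => hb ((hT.nondegenerate K hK).injective h)
  · simp

theorem exists_le_bary {K : Fin 3 → Pt} (hK : AffineIndependent ℝ K) (x : Pt) :
    ∃ i, 1 / 3 ≤ bary K i x := by
  by_contra! h
  have := sum_bary hK x
  rw [Fin.sum_univ_three] at this
  linarith [h 0, h 1, h 2]

theorem exists_le_hat {Ω : Set Pt} {T : Finset (Fin 3 → Pt)} (hT : IsTriangulation Ω T)
    {x : Pt} (hx : x ∈ Ω) : ∃ a : vertices T, 1 / 3 ≤ hat T a x := by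
  obtain ⟨K, hK, hxK⟩ := exists_mem_tri hT hx
  obtain ⟨i, hi⟩ := exists_le_bary (hT.nondegenerate K hK) x
  exact ⟨vertexEmb hK i, by rw [vertexEmb, hat_vertex_eq hT hK hxK]; exact hi⟩

theorem exists_hatOn_lipschitz (T : Finset (Fin 3 → Pt)) :
    ∃ L : ℝ≥0, ∀ K ∈ T, (∀ a x z, |hatOn K a z - hatOn K a x| ≤ L * ‖z - x‖) := by
  classical
  let c : (Fin 3 → Pt) → ℝ≥0 := fun K =>
    ∑ i, (Real.nnabs (gradBary K i 0) + Real.nnabs (gradBary K i 1))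
  refine ⟨∑ K ∈ T, c K, fun K hK a x z => ?_⟩
  have hc : (c K : ℝ) ≤ (∑ K ∈ T, c K : ℝ≥0) :=
    NNReal.coe_le_coe.2 (Finset.single_le_sum (f := c) (fun _ _ => zero_le) hK)
  refine le_trans ?_ (mul_le_mul_of_nonneg_right hc (norm_nonneg _))
  rw [hatOn, hatOn, ← Finset.sum_sub_distrib]
  simp only [c]
  push_cast
  rw [Finset.sum_mul]
  refine (Finset.abs_sum_le_sum_abs _ _).trans (Finset.sum_le_sum fun i _ => ?_)
  have h0 : |(z - x) 0| ≤ ‖z - x‖ := PiLp.norm_apply_le (z - x) 0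
  have h1 : |(z - x) 1| ≤ ‖z - x‖ := PiLp.norm_apply_le (z - x) 1
  split_ifs
  · have e : bary K i z - bary K i x
        = gradBary K i 0 * (z - x) 0 + gradBary K i 1 * (z - x) 1 := by
      rw [bary_eq K i z, bary_eq K i x]
      simp only [PiLp.sub_apply]
      ring
    rw [e, add_mul]
    refine (abs_add_le _ _).trans ?_
    rw [abs_mul, abs_mul]
    gcongr
  · rw [sub_zero, abs_zero]
    positivity

theorem isCompact_tri (K : Fin 3 → Pt) : IsCompact (tri K) :=
  (finite_range K).isCompact_convexHull (𝕜 := ℝ)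

/-- The triangles are closed and finite in number, so a point `q` near `p` lies only in triangles
that also contain `p`; on such a triangle both values come from one affine function. -/
theorem exists_hat_lipschitz {Ω : Set Pt} (hΩ : IsOpen Ω) {T : Finset (Fin 3 → Pt)}
    (hT : IsTriangulation Ω T) :
    ∃ L : ℝ≥0, ∀ p ∈ Ω, ∀ a, ∀ᶠ q in 𝓝 p, |hat T a q - hat T a p| ≤ L * ‖q - p‖ := by
  obtain ⟨L, hL⟩ := exists_hatOn_lipschitz T
  refine ⟨L, fun p hp a => ?_⟩
  have h1 : ∀ᶠ q in 𝓝 p, ∀ K ∈ T, q ∈ tri K → p ∈ tri K := by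
    rw [Filter.eventually_all_finset]
    intro K _
    by_cases hpK : p ∈ tri K
    · exact .of_forall fun _ _ => hpK
    · filter_upwards [(isCompact_tri K).isClosed.isOpen_compl.mem_nhds hpK] with q hq hq'
      exact absurd hq' hq
  filter_upwards [h1, hΩ.mem_nhds hp] with q hq hqΩ
  obtain ⟨K, hK, hqK⟩ := exists_mem_tri hT hqΩ
  rw [hat_eq hT hK hqK, hat_eq hT hK (hq K hK hqK)]
  exact hL K hK a p q

theorem continuous_hatOn (K : Fin 3 → Pt) (a : Pt) : Continuous (hatOn K a) := by
  classical
  unfold hatOn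
  refine continuous_finsetSum _ fun i _ => ?_
  split_ifs
  · exact continuous_bary K i
  · exact continuous_const

theorem measurable_hat {Ω : Set Pt} {T : Finset (Fin 3 → Pt)} (hT : IsTriangulation Ω T)
    (a : Pt) : Measurable (hat T a) := by
  intro s hs
  have mt : ∀ K, MeasurableSet (tri K) := fun K => (isCompact_tri K).measurableSet
  have e : hat T a ⁻¹' s = (⋃ K ∈ T, tri K ∩ hatOn K a ⁻¹' s)
      ∪ ((⋃ K ∈ T, tri K)ᶜ ∩ (fun _ : Pt => (0 : ℝ)) ⁻¹' s) := by
    ext x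
    by_cases hx : ∃ K ∈ T, x ∈ tri K
    · have hx' : x ∉ (⋃ K ∈ T, tri K)ᶜ := by simpa using hx
      simp only [mem_union, mem_inter_iff, hx', false_and, or_false, mem_iUnion, mem_preimage,
        exists_prop]
      constructor
      · intro h
        obtain ⟨K, hK, hxK⟩ := hx
        exact ⟨K, hK, hxK, hat_eq hT hK hxK a ▸ h⟩
      · rintro ⟨K, hK, hxK, h⟩
        rwa [hat_eq hT hK hxK a]
    · have h0 : hat T a x = 0 := by rw [hat, glue, dif_neg hx]
      have hx' : x ∈ (⋃ K ∈ T, tri K)ᶜ := by simpa using hx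
      have hx'' : x ∉ (⋃ K ∈ T, tri K ∩ hatOn K a ⁻¹' s) := by
        simp only [mem_iUnion, not_exists]
        exact fun K hK h => hx ⟨K, hK, h.1⟩
      simp only [mem_union, hx'', false_or, mem_inter_iff, hx', true_and, mem_preimage, h0]
  rw [e]
  refine (Finset.measurableSet_biUnion _ fun K _ =>
    (mt K).inter ((continuous_hatOn K a).measurable hs)).union
    ((Finset.measurableSet_biUnion _ fun K _ => mt K).compl.inter (measurable_const hs))

/-- The points of `Ω` that are on no edge of the mesh. -/
def regularPts (Ω : Set Pt) (T : Finset (Fin 3 → Pt)) : Set Pt :=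
  Ω ∩ {x | ∀ K ∈ T, x ∉ frontier (tri K)}

theorem ae_mem_regularPts {Ω : Set Pt} (hΩ : IsOpen Ω) (T : Finset (Fin 3 → Pt)) :
    ∀ᵐ x ∂(volume.restrict Ω), x ∈ regularPts Ω T := by
  have h : ∀ᵐ x : Pt, ∀ K ∈ T, x ∉ frontier (tri K) := by
    rw [Filter.eventually_all_finset]
    exact fun K _ => measure_eq_zero_iff_ae_notMem.1
      ((convex_convexHull ℝ (range K)).addHaar_frontier _)
  filter_upwards [ae_restrict_of_ae h, ae_restrict_mem hΩ.measurableSet] with x h1 h2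
  exact ⟨h2, h1⟩

theorem mem_interior_of_regular {Ω : Set Pt} {T : Finset (Fin 3 → Pt)} {x : Pt}
    (hx : x ∈ regularPts Ω T) {K : Fin 3 → Pt} (hK : K ∈ T) (hxK : x ∈ tri K) :
    x ∈ interior (tri K) := by
  by_contra h
  exact hx.2 K hK ⟨subset_closure hxK, h⟩

/-- The triangle picked by `glue` depends on the point alone, so one `K` serves all scalar and
vector fields at once. -/
theorem exists_glue_eq {Ω : Set Pt} {T : Finset (Fin 3 → Pt)} (hT : IsTriangulation Ω T)
    {x : Pt} (hx : x ∈ Ω) :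
    ∃ K ∈ T, x ∈ tri K ∧ (∀ f : (Fin 3 → Pt) → Pt → ℝ, glue T f x = f K x) ∧
      ∀ f : (Fin 3 → Pt) → Pt → Vec, glue T f x = f K x := by
  have h := exists_mem_tri hT hx
  exact ⟨h.choose, h.choose_spec.1, h.choose_spec.2, fun f => by rw [glue, dif_pos h],
    fun f => by rw [glue, dif_pos h]⟩

/-- The Jacobian matrix of `meshMap T y`, entrywise. -/
def meshJac (T : Finset (Fin 3 → Pt)) (y : vertices T → Pt) (x : Pt) (i j : Fin 2) : ℝ :=
  ∑ a : vertices T, pd j (hat T a) x * y a i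

open Classical in
theorem hasFDerivAt_hat {Ω : Set Pt} {T : Finset (Fin 3 → Pt)} (hT : IsTriangulation Ω T)
    {K : Fin 3 → Pt} (hK : K ∈ T) {x : Pt} (hx : x ∈ interior (tri K)) (a : Pt) :
    HasFDerivAt (hat T a) (∑ i, if K i = a then gradBary K i 0 • (EuclideanSpace.proj 0 : Pt →L[ℝ] ℝ)
      + gradBary K i 1 • (EuclideanSpace.proj 1 : Pt →L[ℝ] ℝ) else 0) x := by
  have h1 : HasFDerivAt (hatOn K a) (∑ i, if K i = a then
      gradBary K i 0 • (EuclideanSpace.proj 0 : Pt →L[ℝ] ℝ)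
      + gradBary K i 1 • (EuclideanSpace.proj 1 : Pt →L[ℝ] ℝ) else 0) x := by
    unfold hatOn
    refine HasFDerivAt.fun_sum fun i _ => ?_
    split_ifs
    · exact hasFDerivAt_bary K i x
    · exact hasFDerivAt_const _ _
  refine h1.congr_of_eventuallyEq ?_
  filter_upwards [isOpen_interior.mem_nhds hx] with z hz
  exact hat_eq hT hK (interior_subset hz) a

theorem meshJac_eq {Ω : Set Pt} {T : Finset (Fin 3 → Pt)} (hT : IsTriangulation Ω T)
    {K : Fin 3 → Pt} (hK : K ∈ T) {x : Pt} (hx : x ∈ interior (tri K))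
    (y : vertices T → Pt) (i j : Fin 2) :
    meshJac T y x i j = jac K (y ∘ vertexEmb hK) x i j := by
  classical
  rw [jac_apply]
  have e : ∀ a : Pt, pd j (hat T a) x = ∑ k, if K k = a then gradBary K k j else 0 := by
    intro a
    rw [pd, (hasFDerivAt_hat hT hK hx a).fderiv, _root_.sum_apply]
    refine Finset.sum_congr rfl fun k _ => ?_
    split_ifs
    · fin_cases j <;> simp
    · rfl
  simp only [meshJac, e]
  exact sum_vertices_ite hK (fun k => gradBary K k j) (fun a => y a i)

theorem pd_eq_meshJac {Ω : Set Pt} {T : Finset (Fin 3 → Pt)} (hT : IsTriangulation Ω T)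
    {x : Pt} (hx : x ∈ regularPts Ω T) (y : vertices T → Pt) {Φ : Pt → Pt}
    (hΦ : Φ =ᶠ[𝓝 x] meshMap T y) (i j : Fin 2) :
    pd j (fun z => Φ z i) x = meshJac T y x i j := by
  obtain ⟨K, hK, hxK⟩ := exists_mem_tri hT hx.1
  have hd : ∀ a, DifferentiableAt ℝ (hat T a) x := fun a =>
    (hasFDerivAt_hat hT hK (mem_interior_of_regular hx hK hxK) a).differentiableAt
  have e : (fun z => Φ z i) =ᶠ[𝓝 x] fun z => ∑ a : vertices T, hat T a z * y a i := by
    filter_upwards [hΦ] with z hz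
    rw [hz, meshMap]
    simp
  rw [pd, e.fderiv_eq]
  have h : HasFDerivAt (fun z => ∑ a : vertices T, hat T a z * y a i) _ x :=
    HasFDerivAt.fun_sum (u := Finset.univ) fun a _ => (hd a).hasFDerivAt.mul_const (y a i)
  rw [h.fderiv, _root_.sum_apply]
  simp only [meshJac, pd]
  refine Finset.sum_congr rfl fun a _ => ?_
  rw [_root_.smul_apply, smul_eq_mul, mul_comm]

theorem exists_abs_pd_hat_le {Ω : Set Pt} (hΩ : IsOpen Ω) {T : Finset (Fin 3 → Pt)}
    (hT : IsTriangulation Ω T) :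
    ∃ L : ℝ≥0, ∀ x ∈ Ω, ∀ a j, |pd j (hat T a) x| ≤ L := by
  obtain ⟨L, hL⟩ := exists_hat_lipschitz hΩ hT
  refine ⟨L, fun x hx a j => ?_⟩
  have h : ‖fderiv ℝ (hat T a) x‖ ≤ L := norm_fderiv_le_of_lip' ℝ L.2 (hL x hx a)
  have h1 := (fderiv ℝ (hat T a) x).le_opNorm (ePt j)
  rw [norm_ePt, mul_one] at h1
  exact h1.trans h

end MeshGeometry

/-! ### Nondegeneracy of almost every choice of points, and the cut-off mesh map -/

noncomputable section MeshPullback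

open Filter Topology
open scoped NNReal ENNReal Manifold

/-! ### Almost every choice of points is nondegenerate -/

/-- The set is a line: a translate of the kernel of a nonzero linear functional. -/
theorem volume_area2_eq_zero {p q : Pt} (h : p ≠ q) : volume {z | area2 p q z = 0} = 0 := by
  let L : Pt →ₗ[ℝ] ℝ :=
    { toFun := fun z => (q 0 - p 0) * z 1 - z 0 * (q 1 - p 1)
      map_add' := fun z w => by simp only [PiLp.add_apply]; ring
      map_smul' := fun c z => by
        simp only [PiLp.smul_apply, smul_eq_mul, RingHom.id_apply]; ring }
  have hL : LinearMap.ker L ≠ ⊤ := by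
    intro htop
    apply h
    have h1 : L (ePt 0) = 0 := by rw [← LinearMap.mem_ker, htop]; trivial
    have h2 : L (ePt 1) = 0 := by rw [← LinearMap.mem_ker, htop]; trivial
    simp [L, ePt] at h1 h2
    ext i
    fin_cases i
    · simp only [Fin.zero_eta]; linarith
    · simp only [Fin.mk_one]; linarith
  have e : {z | area2 p q z = 0} = (fun z => z - p) ⁻¹' (LinearMap.ker L : Set Pt) := by
    ext z
    simp only [mem_ofPred_eq, mem_preimage, SetLike.mem_coe, LinearMap.mem_ker, L,
      LinearMap.coe_mk, AddHom.coe_mk, PiLp.sub_apply, area2]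
  simp only [e, sub_eq_add_neg]
  rw [measure_preimage_add_right]
  exact Measure.addHaar_submodule volume _ hL

section

variable {ι : Type} [Fintype ι] {ρ : ℝ} {A : ι → Pt}

theorem ae_diskMeasure_of_update [DecidableEq ι] (i : ι) {N : Set (ι → Pt)}
    (hN : MeasurableSet N) (h : ∀ y, volume {z | Function.update y i z ∈ N} = 0) :
    ∀ᵐ y ∂(diskMeasure ρ A), y ∉ N := by
  obtain ⟨c, hc⟩ := lintegral_diskMeasure_le ρ A i
  have h1 := hc (N.indicator 1) (measurable_one.indicator hN) 0 fun y => by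
    refine (setLIntegral_le_lintegral _ _).trans (le_of_eq ?_)
    have m : MeasurableSet {z | Function.update y i z ∈ N} :=
      (measurable_update y) hN
    have : ∀ z, N.indicator (1 : (ι → Pt) → ℝ≥0∞) (Function.update y i z)
        = {z | Function.update y i z ∈ N}.indicator 1 z := fun z => rfl
    simp only [this]
    rw [lintegral_indicator_one m, h y]
  rw [lintegral_indicator_one hN] at h1
  refine measure_eq_zero_iff_ae_notMem.1 (le_antisymm (h1.trans ?_) zero_le)
  simp

theorem continuous_area2_comp {κ : Type} (a b c : κ) :
    Continuous fun y : κ → Pt => area2 (y a) (y b) (y c) := by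
  unfold area2
  fun_prop

/-- Almost surely `y a ≠ y b`, by varying `y a`; given that, collinearity confines `y c` to a line,
which is null. -/
theorem ae_area2_ne_zero {a b c : ι} (hab : a ≠ b) (hac : a ≠ c) (hbc : b ≠ c) :
    ∀ᵐ y ∂(diskMeasure ρ A), area2 (y a) (y b) (y c) ≠ 0 := by
  classical
  have h1 : ∀ᵐ y ∂(diskMeasure ρ A), y ∉ {y : ι → Pt | y a = y b} := by
    refine ae_diskMeasure_of_update a (measurableSet_eq_fun (measurable_pi_apply a)
      (measurable_pi_apply b)) fun y => ?_
    have : {z | Function.update y a z ∈ {y : ι → Pt | y a = y b}} = {y b} := by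
      ext z
      simp [Function.update_of_ne hab.symm]
    rw [this, measure_singleton]
  have h2 : ∀ᵐ y ∂(diskMeasure ρ A), y ∉ {y : ι → Pt | area2 (y a) (y b) (y c) = 0 ∧ y a ≠ y b} := by
    refine ae_diskMeasure_of_update c ((measurableSet_eq_fun
      (continuous_area2_comp a b c).measurable measurable_const).inter
      (measurableSet_eq_fun (measurable_pi_apply a) (measurable_pi_apply b)).compl) fun y => ?_
    by_cases hy : y a = y b
    · have : {z | Function.update y c z ∈ {y : ι → Pt | area2 (y a) (y b) (y c) = 0 ∧ y a ≠ y b}}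
          = ∅ := by
        ext z
        simp [Function.update_of_ne hac, Function.update_of_ne hbc, hy]
      rw [this, measure_empty]
    · refine measure_mono_null ?_ (volume_area2_eq_zero hy)
      intro z hz
      have := hz.1
      rwa [Function.update_of_ne hac, Function.update_of_ne hbc, Function.update_self] at this
  filter_upwards [h1, h2] with y hy1 hy2 h0
  exact hy2 ⟨h0, hy1⟩

end

/-- The geometric hypotheses, with smoothing radius `ρ`. -/
structure MeshSetup (Ω Ω' : Set Pt) (T : Finset (Fin 3 → Pt)) (ρ : ℝ) : Prop where
  isOpen : IsOpen Ω
  isOpen' : IsOpen Ω'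
  subset : Ω ⊆ Ω'
  pos : ∀ x ∈ Ω', 0 < x 0
  tri : IsTriangulation Ω T
  radius_pos : 0 < ρ
  hull : ∀ K ∈ T, interior (convexHull ℝ (⋃ i, disk ρ (K i))) ⊆ Ω'

/-- The inclusion of the vertices in the plane. -/
def vertexPt (T : Finset (Fin 3 → Pt)) : vertices T → Pt := Subtype.val

/-- Choices of points in the disks around the vertices with nondegenerate image triangles. -/
def GoodPts (T : Finset (Fin 3 → Pt)) (ρ : ℝ) (y : vertices T → Pt) : Prop :=
  (∀ a, y a ∈ interior (disk ρ (vertexPt T a))) ∧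
    ∀ K, ∀ hK : K ∈ T,
      area2 (y (vertexEmb hK 0)) (y (vertexEmb hK 1)) (y (vertexEmb hK 2)) ≠ 0

namespace MeshSetup

variable {Ω Ω' : Set Pt} {T : Finset (Fin 3 → Pt)} {ρ : ℝ}

theorem vertexEmb_injective (S : MeshSetup Ω Ω' T ρ) {K : Fin 3 → Pt} (hK : K ∈ T) :
    Function.Injective (vertexEmb hK) := fun _ _ h =>
  (S.tri.nondegenerate K hK).injective (congrArg Subtype.val h)

theorem vertex_nonneg (S : MeshSetup Ω Ω' T ρ) {K : Fin 3 → Pt} (hK : K ∈ T) (i : Fin 3) :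
    0 ≤ K i 0 := by
  have h1 : K i ∈ closure Ω := by
    rw [← S.tri.cover]
    exact mem_biUnion hK (subset_convexHull ℝ _ (mem_range_self i))
  have h2 : closure Ω ⊆ {x : Pt | 0 ≤ x 0} :=
    closure_minimal (fun x hx => (S.pos x (S.subset hx)).le)
      (isClosed_le continuous_const (by fun_prop))
  exact h2 h1

theorem vertexPt_nonneg (S : MeshSetup Ω Ω' T ρ) (a : vertices T) : 0 ≤ vertexPt T a 0 := by
  obtain ⟨K, hK, i, hi⟩ := exists_of_mem_vertices a.2
  rw [vertexPt, ← hi]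
  exact S.vertex_nonneg hK i

theorem ae_goodPts (S : MeshSetup Ω Ω' T ρ) :
    ∀ᵐ y ∂(diskMeasure ρ (vertexPt T)), GoodPts T ρ y := by
  refine (ae_diskMeasure_mem_interior ρ (vertexPt T)).and ?_
  have h : ∀ K : T, ∀ᵐ y ∂(diskMeasure ρ (vertexPt T)),
      area2 (y (vertexEmb K.2 0)) (y (vertexEmb K.2 1)) (y (vertexEmb K.2 2)) ≠ 0 := fun K =>
    ae_area2_ne_zero ((S.vertexEmb_injective K.2).ne (by decide))
      ((S.vertexEmb_injective K.2).ne (by decide)) ((S.vertexEmb_injective K.2).ne (by decide))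
  filter_upwards [eventually_all.2 h] with y hy K hK
  exact hy ⟨K, hK⟩

/-- Only the interior of the hull of the disks is known to lie in `Ω'`. Points interior to their
disks are interior to the hull, and the interior of a convex set is convex. -/
theorem xt_mem (S : MeshSetup Ω Ω' T ρ) {K : Fin 3 → Pt} (hK : K ∈ T) {x : Pt}
    (hx : x ∈ _root_.tri K) {y : Fin 3 → Pt} (hy : ∀ i, y i ∈ interior (disk ρ (K i))) :
    xt K y x ∈ Ω' := by
  refine S.hull K hK ?_
  have hc : Convex ℝ (interior (convexHull ℝ (⋃ i, disk ρ (K i)))) :=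
    (convex_convexHull ℝ _).interior
  refine hc.sum_mem (fun i _ => bary_nonneg (S.tri.nondegenerate K hK) hx i)
    (sum_bary (S.tri.nondegenerate K hK) x) fun i _ => ?_
  exact interior_mono ((subset_iUnion (fun i => disk ρ (K i)) i).trans (subset_convexHull ℝ _))
    (hy i)

theorem meshMap_mem (S : MeshSetup Ω Ω' T ρ) {x : Pt} (hx : x ∈ Ω) {y : vertices T → Pt}
    (hy : ∀ a, y a ∈ interior (disk ρ (vertexPt T a))) : meshMap T y x ∈ Ω' := by
  obtain ⟨K, hK, hxK⟩ := exists_mem_tri S.tri hx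
  rw [meshMap_eq S.tri hK hxK]
  have h (i : Fin 3) : (y ∘ vertexEmb hK) i ∈ interior (disk ρ (K i)) := hy (vertexEmb hK i)
  exact S.xt_mem hK hxK h

theorem hat_le_one (S : MeshSetup Ω Ω' T ρ) {x : Pt} (hx : x ∈ Ω) (a : vertices T) :
    hat T a x ≤ 1 := by
  rw [← sum_hat S.tri hx]
  exact Finset.single_le_sum (f := fun a : vertices T => hat T a x)
    (fun b _ => hat_nonneg S.tri hx b) (Finset.mem_univ a)

/-- Hat functions are controlled only at points of `Ω`, with comparison points close by. A smooth
cut-off supported in `Ω` gives functions Lipschitz on the whole plane; `L + B` comes from the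
product rule, since the cut-off and the hat functions have values in `[0, 1]` where needed. -/
theorem exists_cutoff_hat (S : MeshSetup Ω Ω' T ρ) {C : Set Pt} (hC : IsCompact C)
    (hCΩ : C ⊆ Ω) :
    ∃ (χ : Pt → ℝ) (M : ℝ≥0), HasCompactSupport χ ∧ (∀ x ∈ C, χ =ᶠ[𝓝 x] 1) ∧
      ∀ a : vertices T, LipschitzWith M fun x => χ x * hat T a x := by
  obtain ⟨t, ht, hCt, htΩ⟩ := exists_compact_between hC S.isOpen hCΩ
  obtain ⟨χ, h1, h0, h01⟩ := exists_contMDiffMap_one_nhds_of_subset_interior (n := (⊤ : ℕ∞))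
    𝓘(ℝ, Pt) hC.isClosed hCt
  have hχ : ContDiff ℝ ∞ χ := χ.contMDiff.contDiff
  have hc : HasCompactSupport χ := HasCompactSupport.intro ht h0
  obtain ⟨B, hB⟩ := ContDiff.lipschitzWith_of_hasCompactSupport hc hχ (by simp)
  obtain ⟨L, hL⟩ := exists_hat_lipschitz S.isOpen S.tri
  refine ⟨χ, L + B, hc, fun x hx => ?_, fun a => lipschitzWith_of_eventually fun p => ?_⟩
  · exact (eventually_nhdsSet_iff_forall.1 h1) x hx
  · by_cases hp : p ∈ Ω
    · filter_upwards [hL p hp a] with q hq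
      have e : χ q * hat T a q - χ p * hat T a p
          = χ q * (hat T a q - hat T a p) + hat T a p * (χ q - χ p) := by ring
      rw [e]
      refine (abs_add_le _ _).trans ?_
      rw [abs_mul, abs_mul, abs_of_nonneg (h01 q).1, abs_of_nonneg (hat_nonneg S.tri hp a)]
      have h2 : |χ q - χ p| ≤ B * ‖q - p‖ := by
        simpa [dist_eq_norm] using hB.dist_le_mul q p
      push_cast
      rw [add_mul]
      have h3 := mul_le_mul (h01 q).2 hq (abs_nonneg _) zero_le_one
      have h4 := mul_le_mul (S.hat_le_one hp a) h2 (abs_nonneg _) zero_le_one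
      rw [one_mul] at h3 h4
      exact add_le_add h3 h4
    · have hpt : p ∉ t := fun h => hp (htΩ h)
      filter_upwards [ht.isClosed.isOpen_compl.mem_nhds hpt] with q hq
      rw [h0 q hq, h0 p hpt]
      simp only [zero_mul, sub_zero, abs_zero]
      positivity

/-- The map is `meshMap` times a cut-off equal to one near the support of `φ`. On that support a
preimage is covered by preimages under finitely many affine maps, one per triangle, invertible
because the image triangles are nondegenerate; this bounds the pushforward. -/
theorem pullbackData (S : MeshSetup Ω Ω' T ρ) {y : vertices T → Pt} (hy : GoodPts T ρ y)
    {φ : Pt → ℝ} (hφ : IsTest Ω φ) :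
    ∃ Φ, PullbackData Ω' Φ φ ∧ ∀ x ∈ tsupport φ, Φ =ᶠ[𝓝 x] meshMap T y := by
  obtain ⟨hφs, hφc, hφΩ⟩ := hφ
  obtain ⟨χ, M, hχc, hχ1, hlip⟩ := S.exists_cutoff_hat hφc hφΩ
  let Φ : Pt → Pt := fun x => ∑ a : vertices T, (χ x * hat T a x) • y a
  have hΦ : ∀ x, Φ x = χ x • meshMap T y x := by
    intro x
    simp only [Φ, meshMap, Finset.smul_sum, smul_smul]
  have heq : ∀ x ∈ tsupport φ, Φ =ᶠ[𝓝 x] meshMap T y := by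
    intro x hx
    filter_upwards [hχ1 x hx] with z hz
    rw [hΦ, hz, Pi.one_apply, one_smul]
  have heq' : ∀ x ∈ tsupport φ, Φ x = meshMap T y x := fun x hx => (heq x hx).self_of_nhds
  have hl : LipschitzWith (∑ a : vertices T, M * ‖y a‖₊) Φ := by
    refine LipschitzWith.of_dist_le_mul fun p q => ?_
    rw [dist_eq_norm]
    simp only [Φ]
    rw [← Finset.sum_sub_distrib]
    push_cast
    rw [Finset.sum_mul]
    refine (norm_sum_le _ _).trans (Finset.sum_le_sum fun a _ => ?_)
    rw [← sub_smul, norm_smul]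
    have := (hlip a).dist_le_mul p q
    rw [Real.dist_eq] at this
    calc ‖χ p * hat T a p - χ q * hat T a q‖ * ‖y a‖ ≤ (M * dist p q) * ‖y a‖ := by
          gcongr
          exact this
      _ = _ := by ring
  refine ⟨Φ, ⟨S.isOpen', ⟨_, hl⟩, ?_, hφs, hφc, ?_, ?_⟩, heq⟩
  · have : Φ = fun x => χ x • meshMap T y x := funext hΦ
    rw [this]
    exact hχc.smul_right
  · intro x hx
    rw [heq' x hx]
    exact S.meshMap_mem (hφΩ hx) hy.1
  · have hK : ∀ K : T, ∃ c : ℝ≥0, ∀ s : Set Pt,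
        volume (xt K.1 (y ∘ vertexEmb K.2) ⁻¹' s) ≤ c * volume s := fun K =>
      exists_volume_preimage_xt_le (S.tri.nondegenerate K.1 K.2) (hy.2 K.1 K.2)
    choose c hc using hK
    refine ⟨∑ K, c K, Measure.le_iff.2 fun s hs => ?_⟩
    rw [Measure.map_apply hl.continuous.measurable hs,
      Measure.restrict_apply (hl.continuous.measurable hs)]
    have hsub : Φ ⁻¹' s ∩ tsupport φ ⊆ ⋃ K : T, xt K.1 (y ∘ vertexEmb K.2) ⁻¹' s := by
      rintro x ⟨hxs, hx⟩
      obtain ⟨K, hK, hxK⟩ := exists_mem_tri S.tri (hφΩ hx)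
      refine mem_iUnion.2 ⟨⟨K, hK⟩, ?_⟩
      rw [mem_preimage, ← meshMap_eq S.tri hK hxK, ← heq' x hx]
      exact hxs
    refine (measure_mono hsub).trans ((measure_iUnion_fintype_le _ _).trans ?_)
    refine (Finset.sum_le_sum fun K _ => hc K s).trans (le_of_eq ?_)
    rw [← Finset.sum_mul]
    change _ = ((∑ K, c K : ℝ≥0) : ℝ≥0∞) * volume s
    push_cast
    rfl

end MeshSetup

end MeshPullback

/-! ### Convergence of weighted averages and their weak derivatives -/

noncomputable section Averaging

open Filter Topology
open scoped NNReal ENNReal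

/-- Measurable fields on `U` for which the weighted averages converge. -/
structure Averageable (U : Set Pt) (F : Pt → ℝ) : Prop where
  measurable : Measurable F
  lintegral_lt_top : ∀ R : ℝ, ∫⁻ x in U ∩ Metric.closedBall 0 R, ‖x 0 ^ 3‖ₑ * ‖F x‖ₑ < ⊤

/-- On a compact subset of `U` the radius has a positive minimum, so the factor `r³` can be divided
out. -/
theorem Averageable.locInt {U : Set Pt} (hpos : ∀ x ∈ U, 0 < x 0) {F : Pt → ℝ}
    (hF : Averageable U F) : LocInt U F := by
  intro C hC hCU
  rcases C.eq_empty_or_nonempty with rfl | hne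
  · exact integrableOn_empty
  obtain ⟨x₀, hx₀, hmin⟩ := hC.exists_isMinOn hne
    (f := fun x : Pt => x 0) (by fun_prop : Continuous fun x : Pt => x 0).continuousOn
  have hm := hpos x₀ (hCU hx₀)
  obtain ⟨R, hR⟩ := hC.isBounded.subset_closedBall 0
  refine ⟨hF.measurable.aestronglyMeasurable, ?_⟩
  have hsub : C ⊆ U ∩ Metric.closedBall 0 R := fun x hx => ⟨hCU hx, hR hx⟩
  have hmono : ∫⁻ x in C, ‖x 0 ^ 3‖ₑ * ‖F x‖ₑ < ⊤ :=
    (lintegral_mono_set hsub).trans_lt (hF.lintegral_lt_top R)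
  have hle : ∫⁻ x in C, ‖x₀ 0 ^ 3‖ₑ * ‖F x‖ₑ ≤ ∫⁻ x in C, ‖x 0 ^ 3‖ₑ * ‖F x‖ₑ := by
    refine setLIntegral_mono' hC.measurableSet fun x hx => ?_
    gcongr
    have h1 : x₀ 0 ≤ x 0 := hmin hx
    rw [enorm_le_iff_norm_le, Real.norm_of_nonneg (by positivity),
      Real.norm_of_nonneg (pow_nonneg (hm.le.trans h1) 3)]
    gcongr
  rw [lintegral_const_mul _ hF.measurable.enorm] at hle
  have h0 : ‖x₀ 0 ^ 3‖ₑ ≠ 0 := by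
    rw [enorm_ne_zero]; positivity
  by_contra hinf
  rw [HasFiniteIntegral, not_lt_top_iff] at hinf
  rw [hinf, ENNReal.mul_top h0, top_le_iff] at hle
  exact hmono.ne hle

variable {Ω Ω' : Set Pt} {T : Finset (Fin 3 → Pt)} {ρ : ℝ} {l : ℕ}

/-- The weighted average over the choices of one point in the disk around each vertex. -/
def wavg (l : ℕ) (ρ : ℝ) (T : Finset (Fin 3 → Pt)) (N : Pt → (vertices T → Pt) → ℝ) (x : Pt) : ℝ :=
  ∫ y, weight l ρ (vertexPt T) y * N x y ∂(diskMeasure ρ (vertexPt T))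

/-- Integrands whose weighted averages exist and are bounded on `Ω`. -/
structure AvgIntegrand (Ω : Set Pt) (l : ℕ) (ρ : ℝ) (T : Finset (Fin 3 → Pt))
    (N : Pt → (vertices T → Pt) → ℝ) : Prop where
  measurable : Measurable (Function.uncurry N)
  bound : ∃ C : ℝ≥0, ∀ x ∈ Ω,
    ∫⁻ y, ‖weight l ρ (vertexPt T) y * N x y‖ₑ ∂(diskMeasure ρ (vertexPt T)) ≤ C

namespace AvgIntegrand

variable {N N' : Pt → (vertices T → Pt) → ℝ}

theorem measurable_weight_mul (h : AvgIntegrand Ω l ρ T N) :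
    Measurable fun p : Pt × (vertices T → Pt) => weight l ρ (vertexPt T) p.2 * N p.1 p.2 :=
  ((continuous_weight l ρ (vertexPt T)).measurable.comp measurable_snd).mul h.measurable

theorem measurable_section (h : AvgIntegrand Ω l ρ T N) (x : Pt) :
    Measurable fun y => weight l ρ (vertexPt T) y * N x y := by
  have h1 : Measurable (Function.uncurry N ∘ Prod.mk x) := h.measurable.comp measurable_prodMk_left
  exact (continuous_weight l ρ (vertexPt T)).measurable.mul h1

theorem integrable (h : AvgIntegrand Ω l ρ T N) {x : Pt} (hx : x ∈ Ω) :
    Integrable (fun y => weight l ρ (vertexPt T) y * N x y) (diskMeasure ρ (vertexPt T)) := by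
  obtain ⟨C, hC⟩ := h.bound
  exact ⟨(h.measurable_section x).aestronglyMeasurable,
    (hC x hx).trans_lt ENNReal.coe_lt_top⟩

theorem add (h : AvgIntegrand Ω l ρ T N) (h' : AvgIntegrand Ω l ρ T N') :
    AvgIntegrand Ω l ρ T fun x y => N x y + N' x y := by
  refine ⟨h.measurable.add h'.measurable, ?_⟩
  obtain ⟨C, hC⟩ := h.bound
  obtain ⟨C', hC'⟩ := h'.bound
  refine ⟨C + C', fun x hx => ?_⟩
  push_cast
  refine le_trans ?_ (add_le_add (hC x hx) (hC' x hx))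
  rw [← lintegral_add_left (h.measurable_section x).enorm]
  refine lintegral_mono fun y => ?_
  rw [mul_add]
  exact enorm_add_le _ _

theorem measurable_wavg (h : AvgIntegrand Ω l ρ T N) : Measurable (wavg l ρ T N) :=
  (h.measurable_weight_mul.stronglyMeasurable.integral_prod_right).measurable

theorem exists_abs_wavg_le (h : AvgIntegrand Ω l ρ T N) :
    ∃ C : ℝ≥0, ∀ x ∈ Ω, |wavg l ρ T N x| ≤ C := by
  obtain ⟨C, hC⟩ := h.bound
  refine ⟨C, fun x hx => ?_⟩
  have h1 := (enorm_integral_le_lintegral_enorm _).trans (hC x hx)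
  rw [enorm_eq_nnnorm, ENNReal.coe_le_coe, ← NNReal.coe_le_coe, coe_nnnorm] at h1
  exact h1

theorem integrable_prod (h : AvgIntegrand Ω l ρ T N) (hΩ : MeasurableSet Ω) {g : Pt → ℝ}
    (hgm : Measurable g) (hg : IntegrableOn g Ω) :
    Integrable (Function.uncurry fun x y => weight l ρ (vertexPt T) y * N x y * g x)
      ((volume.restrict Ω).prod (diskMeasure ρ (vertexPt T))) := by
  have hm : Measurable fun p : Pt × (vertices T → Pt) =>
      weight l ρ (vertexPt T) p.2 * N p.1 p.2 * g p.1 :=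
    h.measurable_weight_mul.mul (hgm.comp measurable_fst)
  obtain ⟨C, hC⟩ := h.bound
  refine ⟨hm.aestronglyMeasurable, ?_⟩
  rw [HasFiniteIntegral]
  have e := lintegral_prod (μ := volume.restrict Ω) (ν := diskMeasure ρ (vertexPt T))
    (fun p : Pt × (vertices T → Pt) =>
      ‖weight l ρ (vertexPt T) p.2 * N p.1 p.2 * g p.1‖ₑ) hm.enorm.aemeasurable
  refine lt_of_eq_of_lt e ?_
  calc ∫⁻ x in Ω, ∫⁻ y, ‖weight l ρ (vertexPt T) y * N x y * g x‖ₑ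
        ∂(diskMeasure ρ (vertexPt T))
      ≤ ∫⁻ x in Ω, C * ‖g x‖ₑ := by
        refine setLIntegral_mono' hΩ fun x hx => ?_
        simp only [enorm_mul _ (g x)]
        rw [lintegral_mul_const _ (h.measurable_section x).enorm]
        gcongr
        exact hC x hx
    _ = C * ∫⁻ x in Ω, ‖g x‖ₑ := lintegral_const_mul _ hgm.enorm
    _ < ⊤ := ENNReal.mul_lt_top ENNReal.coe_lt_top hg.2

theorem integrable_weight_mul_integral (h : AvgIntegrand Ω l ρ T N) (hΩ : MeasurableSet Ω)
    {g : Pt → ℝ} (hgm : Measurable g) (hg : IntegrableOn g Ω) :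
    Integrable (fun y => weight l ρ (vertexPt T) y * ∫ x in Ω, N x y * g x)
      (diskMeasure ρ (vertexPt T)) := by
  have := (h.integrable_prod hΩ hgm hg).integral_prod_right
  simpa only [Function.uncurry, mul_assoc, integral_const_mul] using this

theorem integral_wavg_mul (h : AvgIntegrand Ω l ρ T N) (hΩ : MeasurableSet Ω) {g : Pt → ℝ}
    (hgm : Measurable g) (hg : IntegrableOn g Ω) :
    ∫ x in Ω, wavg l ρ T N x * g x
      = ∫ y, weight l ρ (vertexPt T) y * (∫ x in Ω, N x y * g x)
          ∂(diskMeasure ρ (vertexPt T)) := by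
  have hs := integral_integral_swap (h.integrable_prod hΩ hgm hg)
  simp only [wavg, ← integral_mul_const, ← integral_const_mul]
  rw [hs]
  simp only [mul_assoc]

end AvgIntegrand

namespace MeshSetup

theorem measurable_meshMap (S : MeshSetup Ω Ω' T ρ) :
    Measurable fun p : Pt × (vertices T → Pt) => meshMap T p.2 p.1 := by
  unfold meshMap
  refine Finset.measurable_fun_sum _ fun a _ => ?_
  exact ((measurable_hat S.tri a).comp measurable_fst).smul
    ((measurable_pi_apply a).comp measurable_snd)

theorem measurable_meshJac (i j : Fin 2) :
    Measurable fun p : Pt × (vertices T → Pt) => meshJac T p.2 p.1 i j := by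
  unfold meshJac
  refine Finset.measurable_fun_sum _ fun a _ => ?_
  have h : Measurable fun v : Pt => v i := by fun_prop
  exact ((measurable_pd j (hat T a)).comp measurable_fst).mul
    (h.comp ((measurable_pi_apply a).comp measurable_snd))

theorem exists_norm_le_of_mem_disk (T : Finset (Fin 3 → Pt)) (ρ : ℝ) :
    ∃ R : ℝ≥0, ∀ a : vertices T, ∀ y ∈ disk ρ (vertexPt T a), ‖y‖ ≤ R := by
  have h : ∀ a : vertices T, ∃ R : ℝ≥0, ∀ y ∈ disk ρ (vertexPt T a), ‖y‖ ≤ R := fun a => by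
    obtain ⟨R, hR⟩ := (isCompact_disk ρ (vertexPt T a)).isBounded.exists_norm_le
    exact ⟨R.toNNReal, fun y hy => (hR y hy).trans (Real.le_coe_toNNReal R)⟩
  choose R hR using h
  refine ⟨∑ a, R a, fun a y hy => (hR a y hy).trans ?_⟩
  exact NNReal.coe_le_coe.2 (Finset.single_le_sum (f := R) (fun _ _ => zero_le)
    (Finset.mem_univ a))

theorem exists_abs_meshJac_le (S : MeshSetup Ω Ω' T ρ) :
    ∃ B : ℝ≥0, ∀ x ∈ Ω, ∀ y : vertices T → Pt, (∀ a, y a ∈ disk ρ (vertexPt T a)) →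
      ∀ i j, |meshJac T y x i j| ≤ B := by
  obtain ⟨R, hR⟩ := exists_norm_le_of_mem_disk T ρ
  obtain ⟨L, hL⟩ := exists_abs_pd_hat_le S.isOpen S.tri
  refine ⟨∑ _a : vertices T, L * R, fun x hx y hy i j => ?_⟩
  rw [meshJac]
  push_cast
  refine (Finset.abs_sum_le_sum_abs _ _).trans (Finset.sum_le_sum fun a _ => ?_)
  rw [abs_mul]
  exact mul_le_mul (hL x hx a j) ((PiLp.norm_apply_le (y a) i).trans (hR a _ (hy a)))
    (abs_nonneg _) L.2

theorem exists_ae_meshMap_mem (S : MeshSetup Ω Ω' T ρ) :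
    ∃ R : ℝ, ∀ x ∈ Ω, ∀ᵐ y ∂(diskMeasure ρ (vertexPt T)),
      meshMap T y x ∈ Ω' ∩ Metric.closedBall 0 R := by
  obtain ⟨R, hR⟩ := exists_norm_le_of_mem_disk T ρ
  refine ⟨R, fun x hx => ?_⟩
  filter_upwards [ae_diskMeasure_mem_interior ρ (vertexPt T)] with y hy
  refine ⟨S.meshMap_mem hx hy, ?_⟩
  have hc : Convex ℝ (Metric.closedBall (0 : Pt) R) := convex_closedBall _ _
  refine hc.sum_mem (fun a _ => hat_nonneg S.tri hx a) (sum_hat S.tri hx) fun a _ => ?_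
  rw [mem_closedBall_zero_iff]
  exact hR a _ (interior_subset (hy a))

/-- The hat values at `x` are convex coefficients, one of them at least `1/3`, so
`lintegral_weight_mul_le` applies with a constant that does not depend on `x`. -/
theorem avgIntegrand (S : MeshSetup Ω Ω' T ρ) (l : ℕ) {M : Pt → (vertices T → Pt) → ℝ}
    (hM : Measurable (Function.uncurry M)) {B : ℝ≥0}
    (hB : ∀ x ∈ Ω, ∀ y : vertices T → Pt, (∀ a, y a ∈ disk ρ (vertexPt T a)) → |M x y| ≤ B)
    {F : Pt → ℝ} (hF : Averageable Ω' F) :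
    AvgIntegrand Ω l ρ T fun x y => M x y * F (meshMap T y x) := by
  refine ⟨hM.mul (hF.measurable.comp S.measurable_meshMap), ?_⟩
  obtain ⟨C, hC⟩ := lintegral_weight_mul_le l ρ (vertexPt T)
  obtain ⟨R, hR⟩ := S.exists_ae_meshMap_mem
  have hfin := hF.lintegral_lt_top R
  set I := ∫⁻ x in Ω' ∩ Metric.closedBall 0 R, ‖x 0 ^ 3‖ₑ * ‖F x‖ₑ
  refine ⟨B * (C * I.toNNReal), fun x hx => ?_⟩
  obtain ⟨a, ha⟩ := exists_le_hat S.tri hx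
  have key := hC (fun b => hat T b x) a (fun b => hat_nonneg S.tri hx b) ha
    (Ω' ∩ Metric.closedBall 0 R) (S.isOpen'.measurableSet.inter measurableSet_closedBall)
    (hR x hx) (fun z => ‖F z‖ₑ) hF.measurable.enorm
  push_cast
  rw [ENNReal.coe_toNNReal hfin.ne]
  change (∫⁻ y, ‖weight l ρ (vertexPt T) y‖ₑ * ‖F (meshMap T y x)‖ₑ
    ∂(diskMeasure ρ (vertexPt T))) ≤ _ at key
  refine le_trans ?_ (mul_le_mul_right key (B : ℝ≥0∞))
  have hm : Measurable fun y : vertices T → Pt =>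
      ‖weight l ρ (vertexPt T) y‖ₑ * ‖F (meshMap T y x)‖ₑ :=
    (continuous_weight l ρ (vertexPt T)).measurable.enorm.mul
      (hF.measurable.comp (S.measurable_meshMap.comp measurable_prodMk_left)).enorm
  rw [← lintegral_const_mul _ hm]
  refine lintegral_mono_ae ?_
  filter_upwards [ae_diskMeasure_mem_interior ρ (vertexPt T)] with y hy
  rw [enorm_mul, enorm_mul, mul_left_comm]
  gcongr
  have h1 := hB x hx y fun a => interior_subset (hy a)
  rw [enorm_eq_nnnorm, ENNReal.coe_le_coe, ← NNReal.coe_le_coe]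
  exact h1

theorem avgIntegrand_comp (S : MeshSetup Ω Ω' T ρ) (l : ℕ) {F : Pt → ℝ}
    (hF : Averageable Ω' F) : AvgIntegrand Ω l ρ T fun x y => F (meshMap T y x) := by
  have := S.avgIntegrand l (M := fun _ _ => 1) measurable_const (B := 1)
    (fun _ _ _ _ => by simp) hF
  simpa only [one_mul] using this

theorem avgIntegrand_jac (S : MeshSetup Ω Ω' T ρ) (l : ℕ) (i j : Fin 2) {F : Pt → ℝ}
    (hF : Averageable Ω' F) :
    AvgIntegrand Ω l ρ T fun x y => meshJac T y x i j * F (meshMap T y x) := by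
  obtain ⟨B, hB⟩ := S.exists_abs_meshJac_le
  exact S.avgIntegrand l (measurable_meshJac i j) (B := B) (fun x hx y hy => hB x hx y hy i j) hF

theorem avgIntegrand_det (S : MeshSetup Ω Ω' T ρ) (l : ℕ) {F : Pt → ℝ}
    (hF : Averageable Ω' F) :
    AvgIntegrand Ω l ρ T fun x y => (meshJac T y x 0 0 * meshJac T y x 1 1
      - meshJac T y x 0 1 * meshJac T y x 1 0) * F (meshMap T y x) := by
  obtain ⟨B, hB⟩ := S.exists_abs_meshJac_le
  refine S.avgIntegrand l (M := fun x y => meshJac T y x 0 0 * meshJac T y x 1 1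
      - meshJac T y x 0 1 * meshJac T y x 1 0)
    (((measurable_meshJac 0 0).mul (measurable_meshJac 1 1)).sub
      ((measurable_meshJac 0 1).mul (measurable_meshJac 1 0))) (B := B * B + B * B)
    (fun x hx y hy => ?_) hF
  refine (abs_sub _ _).trans ?_
  rw [abs_mul, abs_mul]
  push_cast
  gcongr <;> exact hB x hx y hy _ _

/-- The Jacobian of the mesh map is identified only off the edges, which form a null set, and only
where the cut-off is one, which includes the support of `φ`. -/
theorem setIntegral_mul_test_congr (S : MeshSetup Ω Ω' T ρ) {φ g₁ g₂ : Pt → ℝ}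
    (hφ : tsupport φ ⊆ Ω) (h : ∀ x ∈ regularPts Ω T, x ∈ tsupport φ → g₁ x = g₂ x) :
    ∫ x in Ω, g₁ x * φ x = ∫ x, g₂ x * φ x := by
  rw [← setIntegral_eq_integral_of_forall_compl_eq_zero (s := Ω) (f := fun x => g₂ x * φ x)]
  · refine integral_congr_ae ?_
    filter_upwards [ae_mem_regularPts S.isOpen T] with x hx
    by_cases hxφ : x ∈ tsupport φ
    · rw [h x hx hxφ]
    · simp only [image_eq_zero_of_notMem_tsupport hxφ, mul_zero]
  · intro x hx
    rw [image_eq_zero_of_notMem_tsupport fun h => hx (hφ h), mul_zero]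

theorem setIntegral_mul_pd_congr (S : MeshSetup Ω Ω' T ρ) {φ g₁ g₂ : Pt → ℝ} (j : Fin 2)
    (hφ : tsupport φ ⊆ Ω) (h : ∀ x ∈ regularPts Ω T, x ∈ tsupport φ → g₁ x = g₂ x) :
    ∫ x in Ω, g₁ x * pd j φ x = ∫ x, g₂ x * pd j φ x := by
  rw [← setIntegral_eq_integral_of_forall_compl_eq_zero (s := Ω) (f := fun x => g₂ x * pd j φ x)]
  · refine integral_congr_ae ?_
    filter_upwards [ae_mem_regularPts S.isOpen T] with x hx
    by_cases hxφ : x ∈ tsupport φ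
    · rw [h x hx hxφ]
    · simp only [pd_eq_zero_of_notMem_tsupport hxφ, mul_zero]
  · intro x hx
    rw [pd_eq_zero_of_notMem_tsupport fun h => hx (hφ h), mul_zero]

theorem integrableOn_test {φ : Pt → ℝ} (hφ : IsTest Ω φ) : IntegrableOn φ Ω :=
  (hφ.1.continuous.integrable_of_hasCompactSupport hφ.2.1).integrableOn

theorem integrableOn_pd_test {φ : Pt → ℝ} (hφ : IsTest Ω φ) (j : Fin 2) :
    IntegrableOn (pd j φ) Ω := by
  obtain ⟨L, hL⟩ := ContDiff.lipschitzWith_of_hasCompactSupport hφ.2.1 hφ.1 (by simp)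
  exact (integrable_pd hL hφ.2.1 j).integrableOn

/-- The weak gradient of an average. -/
theorem wavg_grad (S : MeshSetup Ω Ω' T ρ) {f : Pt → ℝ} {G : Fin 2 → Pt → ℝ}
    (hf : Averageable Ω' f) (hG : ∀ i, Averageable Ω' (G i))
    (hw : ∀ i ψ, IsTest Ω' ψ → ∫ x in Ω', G i x * ψ x = -∫ x in Ω', f x * pd i ψ x)
    {φ : Pt → ℝ} (hφ : IsTest Ω φ) (j : Fin 2) :
    ∫ x in Ω, wavg l ρ T (fun x y => f (meshMap T y x)) x * pd j φ x
      = -∫ x in Ω, wavg l ρ T (fun x y => meshJac T y x 0 j * G 0 (meshMap T y x)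
          + meshJac T y x 1 j * G 1 (meshMap T y x)) x * φ x := by
  have hm := S.isOpen.measurableSet
  rw [(S.avgIntegrand_comp l hf).integral_wavg_mul hm (measurable_pd j φ)
      (integrableOn_pd_test hφ j),
    ((S.avgIntegrand_jac l 0 j (hG 0)).add (S.avgIntegrand_jac l 1 j (hG 1))).integral_wavg_mul hm
      hφ.1.continuous.measurable (integrableOn_test hφ), ← integral_neg]
  refine integral_congr_ae ?_
  -- Fubini's theorem has moved the test integral inside the average, so it remains to compare the
  -- integrals over `Ω` for one nondegenerate choice `y`; there the pullback of the weak gradient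
  -- applies.
  filter_upwards [S.ae_goodPts] with y hy
  rw [← mul_neg]
  congr 1
  obtain ⟨Φ, hΦ, heq⟩ := S.pullbackData hy hφ
  have key := hΦ.grad (hf.locInt S.pos) (fun i => (hG i).locInt S.pos) hw j
  rw [S.setIntegral_mul_pd_congr (g₂ := fun x => f (Φ x)) j hφ.2.2
      (fun x _ hxφ => by rw [(heq x hxφ).self_of_nhds]), key]
  congr 1
  refine (S.setIntegral_mul_test_congr hφ.2.2 fun x hx hxφ => ?_).symm
  rw [pd_eq_meshJac S.tri hx y (heq x hxφ), pd_eq_meshJac S.tri hx y (heq x hxφ),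
    (heq x hxφ).self_of_nhds]

/-- The weak scalar curl of an average. -/
theorem wavg_curl (S : MeshSetup Ω Ω' T ρ) {c : Pt → ℝ} {v : Fin 2 → Pt → ℝ}
    (hc : Averageable Ω' c) (hv : ∀ i, Averageable Ω' (v i))
    (hw : ∀ ψ, IsTest Ω' ψ →
      ∫ x in Ω', c x * ψ x = -(∫ x in Ω', v 0 x * pd 1 ψ x) + ∫ x in Ω', v 1 x * pd 0 ψ x)
    {φ : Pt → ℝ} (hφ : IsTest Ω φ) :
    ∫ x in Ω, wavg l ρ T (fun x y => (meshJac T y x 0 0 * meshJac T y x 1 1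
        - meshJac T y x 0 1 * meshJac T y x 1 0) * c (meshMap T y x)) x * φ x
      = (-∫ x in Ω, wavg l ρ T (fun x y => meshJac T y x 0 0 * v 0 (meshMap T y x)
          + meshJac T y x 1 0 * v 1 (meshMap T y x)) x * pd 1 φ x)
        + ∫ x in Ω, wavg l ρ T (fun x y => meshJac T y x 0 1 * v 0 (meshMap T y x)
          + meshJac T y x 1 1 * v 1 (meshMap T y x)) x * pd 0 φ x := by
  have hm := S.isOpen.measurableSet
  have a1 := fun j => (S.avgIntegrand_jac l 0 j (hv 0)).add (S.avgIntegrand_jac l 1 j (hv 1))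
  rw [(S.avgIntegrand_det l hc).integral_wavg_mul hm hφ.1.continuous.measurable
      (integrableOn_test hφ),
    (a1 0).integral_wavg_mul hm (measurable_pd 1 φ) (integrableOn_pd_test hφ 1),
    (a1 1).integral_wavg_mul hm (measurable_pd 0 φ) (integrableOn_pd_test hφ 0),
    ← integral_neg, ← integral_add]
  rotate_left
  · exact ((a1 0).integrable_weight_mul_integral hm (measurable_pd 1 φ)
      (integrableOn_pd_test hφ 1)).neg
  · exact (a1 1).integrable_weight_mul_integral hm (measurable_pd 0 φ) (integrableOn_pd_test hφ 0)
  refine integral_congr_ae ?_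
  filter_upwards [S.ae_goodPts] with y hy
  obtain ⟨Φ, hΦ, heq⟩ := S.pullbackData hy hφ
  have key := hΦ.curl (hc.locInt S.pos) (fun i => (hv i).locInt S.pos) hw
  have hp : ∀ x ∈ regularPts Ω T, x ∈ tsupport φ → ∀ i j,
      pd j (fun z => Φ z i) x = meshJac T y x i j := fun x hx hxφ i j =>
    pd_eq_meshJac S.tri hx y (heq x hxφ) i j
  rw [← mul_neg, ← mul_add]
  congr 1
  rw [S.setIntegral_mul_test_congr (g₂ := fun x => (pd 0 (fun y => Φ y 0) x
        * pd 1 (fun y => Φ y 1) x - pd 1 (fun y => Φ y 0) x * pd 0 (fun y => Φ y 1) x) * c (Φ x))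
      hφ.2.2 (fun x hx hxφ => by simp only [hp x hx hxφ, (heq x hxφ).self_of_nhds]), key]
  congr 1
  · congr 1
    refine (S.setIntegral_mul_pd_congr 1 hφ.2.2 fun x hx hxφ => ?_).symm
    simp only [hp x hx hxφ, (heq x hxφ).self_of_nhds]
  · refine (S.setIntegral_mul_pd_congr 0 hφ.2.2 fun x hx hxφ => ?_).symm
    simp only [hp x hx hxφ, (heq x hxφ).self_of_nhds]

end MeshSetup

end Averaging

/-! ### Three-point averages on a triangle as averages over the whole mesh -/

noncomputable section LocalAverages

open Filter Topology
open scoped NNReal ENNReal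

variable {Ω Ω' : Set Pt} {T : Finset (Fin 3 → Pt)} {ρ : ℝ} {l : ℕ}

/-- The average of `f (x̃_y)`. -/
def avgScalar (l : ℕ) (ρ : ℝ) (T : Finset (Fin 3 → Pt)) (f : Pt → ℝ) : Pt → ℝ :=
  wavg l ρ T fun x y => f (meshMap T y x)

/-- The average of the component `j` of `Jᵀ a (x̃_y)`. -/
def avgCov (l : ℕ) (ρ : ℝ) (T : Finset (Fin 3 → Pt)) (a : Fin 2 → Pt → ℝ) (j : Fin 2) :
    Pt → ℝ :=
  wavg l ρ T fun x y => meshJac T y x 0 j * a 0 (meshMap T y x)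
    + meshJac T y x 1 j * a 1 (meshMap T y x)

/-- The average of `det J * c (x̃_y)`. -/
def avgDet (l : ℕ) (ρ : ℝ) (T : Finset (Fin 3 → Pt)) (c : Pt → ℝ) : Pt → ℝ :=
  wavg l ρ T fun x y => (meshJac T y x 0 0 * meshJac T y x 1 1
    - meshJac T y x 0 1 * meshJac T y x 1 0) * c (meshMap T y x)

theorem continuous_jac (K : Fin 3 → Pt) (x : Pt) (i j : Fin 2) :
    Continuous fun y => jac K y x i j := by
  simp only [jac_apply]
  fun_prop

/-- The vertices outside `K` enter only through their weights, which integrate to one. The integrand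
`g` built from the given field is exchanged for `G`, built from a measurable representative, since
they agree for almost every `y`. -/
theorem avg_eq_wavg (S : MeshSetup Ω Ω' T ρ) {K : Fin 3 → Pt} (hK : K ∈ T) {x : Pt}
    {g G : (Fin 3 → Pt) → ℝ} {N : Pt → (vertices T → Pt) → ℝ}
    (hN : ∀ y, N x y = G (y ∘ vertexEmb hK)) (hg : g =ᵐ[diskMeasure ρ K] G)
    (hG : Integrable (fun y => weight l ρ K y * G y) (diskMeasure ρ K)) :
    avg l ρ K g = wavg l ρ T N x := by
  have hg' : (fun y => weight l ρ K y * g y) =ᵐ[diskMeasure ρ K]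
      fun y => weight l ρ K y * G y := by
    filter_upwards [hg] with y hy
    rw [hy]
  rw [avg_eq_integral (hG.congr hg'.symm), integral_congr_ae hg', wavg]
  simp only [hN]
  exact (integral_weight_comp S.radius_pos S.vertexPt_nonneg (S.vertexEmb_injective hK) G).symm

namespace MeshSetup

theorem integrable_weight_mul_xt (S : MeshSetup Ω Ω' T ρ) (l : ℕ) {K : Fin 3 → Pt} (hK : K ∈ T)
    {x : Pt} (hx : x ∈ _root_.tri K) {m : (Fin 3 → Pt) → ℝ} (hm : Continuous m) {F : Pt → ℝ}
    (hF : Averageable Ω' F) :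
    Integrable (fun y => weight l ρ K y * (m y * F (xt K y x))) (diskMeasure ρ K) := by
  have haff := S.tri.nondegenerate K hK
  have hcpt : IsCompact (Set.pi univ fun i => disk ρ (K i)) :=
    isCompact_univ_pi fun i => isCompact_disk ρ (K i)
  obtain ⟨B, hB⟩ := hcpt.exists_bound_of_continuousOn hm.continuousOn
  have hmx : Continuous fun y : Fin 3 → Pt => xt K y x := by unfold xt; fun_prop
  have hxt : IsCompact ((fun y : Fin 3 → Pt => xt K y x) '' Set.pi univ fun i => disk ρ (K i)) :=
    hcpt.image hmx
  obtain ⟨R, hR⟩ := hxt.isBounded.subset_closedBall 0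
  obtain ⟨C, hC⟩ := lintegral_weight_mul_le l ρ K
  obtain ⟨i, hi⟩ := exists_le_bary haff x
  have hae := ae_diskMeasure_mem_interior ρ K
  have key := hC (fun b => bary K b x) i (fun b => bary_nonneg haff hx b) hi
    (Ω' ∩ Metric.closedBall 0 R) (S.isOpen'.measurableSet.inter measurableSet_closedBall)
    (by
      filter_upwards [hae] with y hy
      exact ⟨S.xt_mem hK hx hy, hR ⟨y, fun i _ => interior_subset (hy i), rfl⟩⟩)
    (fun z => ‖F z‖ₑ) hF.measurable.enorm
  change (∫⁻ y, ‖weight l ρ K y‖ₑ * ‖F (xt K y x)‖ₑ ∂(diskMeasure ρ K)) ≤ _ at key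
  have hw : Integrable (fun y => weight l ρ K y * F (xt K y x)) (diskMeasure ρ K) := by
    refine ⟨((continuous_weight l ρ K).measurable.mul
      (hF.measurable.comp hmx.measurable)).aestronglyMeasurable, ?_⟩
    simp only [HasFiniteIntegral, enorm_mul]
    exact key.trans_lt (ENNReal.mul_lt_top ENNReal.coe_lt_top (hF.lintegral_lt_top R))
  have := hw.bdd_mul (c := B) hm.measurable.aestronglyMeasurable
    (by filter_upwards [hae] with y hy using hB y fun i _ => interior_subset (hy i))
  refine this.congr (.of_forall fun y => ?_)
  simp only
  ring

theorem ae_comp_xt_eq (S : MeshSetup Ω Ω' T ρ) {K : Fin 3 → Pt} (hK : K ∈ T)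
    {x : Pt} (hx : x ∈ _root_.tri K) {F F' : Pt → ℝ} (h : F =ᵐ[volume.restrict Ω'] F') :
    ∀ᵐ y ∂(diskMeasure ρ K), F (xt K y x) = F' (xt K y x) := by
  obtain ⟨i, hi⟩ := exists_le_bary (S.tri.nondegenerate K hK) x
  have hN : volume {z | ¬ (z ∈ Ω' → F z = F' z)} = 0 :=
    ae_iff.1 ((ae_restrict_iff' S.isOpen'.measurableSet).1 h)
  filter_upwards [ae_sum_smul_notMem (ρ := ρ) (A := K) (lam := fun b => bary K b x) hi hN,
    ae_diskMeasure_mem_interior ρ K] with y hy hy'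
  exact not_not.1 hy (S.xt_mem hK hx hy')

variable {K : Fin 3 → Pt} {x : Pt}

theorem avg_scalar_eq (S : MeshSetup Ω Ω' T ρ) (l : ℕ) (hK : K ∈ T) (hx : x ∈ _root_.tri K)
    {F F' : Pt → ℝ} (h : F =ᵐ[volume.restrict Ω'] F') (hF : Averageable Ω' F') :
    avg l ρ K (fun y => F (xt K y x)) = avgScalar l ρ T F' x := by
  refine avg_eq_wavg S hK (G := fun y => F' (xt K y x)) (fun y => ?_) (S.ae_comp_xt_eq hK hx h) ?_
  · rw [meshMap_eq S.tri hK hx]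
  · simpa only [one_mul] using S.integrable_weight_mul_xt l hK hx (m := fun _ => 1)
      continuous_const hF

theorem avg_jac_eq (S : MeshSetup Ω Ω' T ρ) (l : ℕ) (hK : K ∈ T)
    (hx : x ∈ interior (_root_.tri K)) {F F' : Fin 2 → Pt → ℝ}
    (h : ∀ i, F i =ᵐ[volume.restrict Ω'] F' i) (hF : ∀ i, Averageable Ω' (F' i)) (j : Fin 2)
    {g : (Fin 3 → Pt) → ℝ}
    (hg : ∀ᵐ y ∂(diskMeasure ρ K), g y = jac K y x 0 j * F 0 (xt K y x)
      + jac K y x 1 j * F 1 (xt K y x)) :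
    avg l ρ K g = avgCov l ρ T F' j x := by
  have hx' := interior_subset hx
  refine avg_eq_wavg S hK (G := fun y => jac K y x 0 j * F' 0 (xt K y x)
      + jac K y x 1 j * F' 1 (xt K y x)) (fun y => ?_) ?_ ?_
  · rw [meshMap_eq S.tri hK hx', meshJac_eq S.tri hK hx, meshJac_eq S.tri hK hx]
  · filter_upwards [hg, S.ae_comp_xt_eq hK hx' (h 0), S.ae_comp_xt_eq hK hx' (h 1)] with y h1 h2 h3
    rw [h1, h2, h3]
  · simp only [mul_add]
    exact (S.integrable_weight_mul_xt l hK hx' (continuous_jac K x 0 j) (hF 0)).add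
      (S.integrable_weight_mul_xt l hK hx' (continuous_jac K x 1 j) (hF 1))

theorem avg_det_eq (S : MeshSetup Ω Ω' T ρ) (l : ℕ) (hK : K ∈ T)
    (hx : x ∈ interior (_root_.tri K)) {F F' : Pt → ℝ}
    (h : F =ᵐ[volume.restrict Ω'] F') (hF : Averageable Ω' F') :
    avg l ρ K (fun y => (jac K y x).det * F (xt K y x)) = avgDet l ρ T F' x := by
  have hx' := interior_subset hx
  refine avg_eq_wavg S hK (G := fun y => (jac K y x).det * F' (xt K y x)) (fun y => ?_) ?_ ?_
  · simp only [meshMap_eq S.tri hK hx', meshJac_eq S.tri hK hx, Matrix.det_fin_two]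
  · filter_upwards [S.ae_comp_xt_eq hK hx' h] with y h1
    rw [h1]
  · refine S.integrable_weight_mul_xt l hK hx' ?_ hF
    simp only [Matrix.det_fin_two]
    exact ((continuous_jac K x 0 0).mul (continuous_jac K x 1 1)).sub
      ((continuous_jac K x 0 1).mul (continuous_jac K x 1 0))

/-- For singular `J` the inverse has the default value zero, and `det J • J⁻¹` need not be the
adjugate; such `y` are negligible. -/
theorem ae_det_jac_ne_zero (S : MeshSetup Ω Ω' T ρ) (hK : K ∈ T) (x : Pt) :
    ∀ᵐ y ∂(diskMeasure ρ K), (jac K y x).det ≠ 0 := by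
  filter_upwards [ae_area2_ne_zero (ρ := ρ) (A := K) (a := 0) (b := 1) (c := 2)
    (by decide) (by decide) (by decide)] with y hy
  have h := S.tri.nondegenerate K hK
  rw [det_jac h]
  exact div_ne_zero hy (area2_ne_zero h)

theorem det_smul_inv {J : Matrix (Fin 2) (Fin 2) ℝ} (h : J.det ≠ 0) : J.det • J⁻¹ = J.adjugate := by
  rw [Matrix.inv_def, smul_smul, Ring.inverse_eq_inv', mul_inv_cancel₀ h, one_smul]

end MeshSetup

end LocalAverages

/-! ### Weighted `L²` fields, change of representatives, and test functions -/

noncomputable section WeightedSpaces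

open Filter Topology
open scoped NNReal ENNReal

variable {U : Set Pt} {n : ℕ}

theorem measurable_coord (i : Fin 2) : Measurable fun x : Pt => x i := by fun_prop

theorem rMeasure_absolutelyContinuous (U : Set Pt) : rMeasure U ≪ volume.restrict U :=
  withDensity_absolutelyContinuous _ _

theorem absolutelyContinuous_rMeasure (hU : MeasurableSet U) (hpos : ∀ x ∈ U, 0 < x 0) :
    volume.restrict U ≪ rMeasure U := by
  refine withDensity_absolutelyContinuous' (measurable_coord 0).ennreal_ofReal.aemeasurable
    ((ae_restrict_iff' hU).2 (.of_forall fun x hx => ?_))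
  exact (ENNReal.ofReal_pos.2 (hpos x hx)).ne'

theorem MemL2r.congr {u u' : Pt → ℝ} (h : MemL2r U u) (hu : u =ᵐ[volume.restrict U] u') :
    MemL2r U u' :=
  MemLp.ae_eq ((rMeasure_absolutelyContinuous U).ae_le hu) h

theorem MemL2r.exists_measurable (hU : MeasurableSet U) (hpos : ∀ x ∈ U, 0 < x 0)
    {u : Pt → ℝ} (h : MemL2r U u) :
    ∃ u', Measurable u' ∧ u =ᵐ[volume.restrict U] u' :=
  ⟨h.1.mk u, h.1.stronglyMeasurable_mk.measurable,
    (absolutelyContinuous_rMeasure hU hpos).ae_le h.1.ae_eq_mk⟩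

theorem MemL2rVec.exists_measurable (hU : MeasurableSet U) (hpos : ∀ x ∈ U, 0 < x 0)
    {v : Pt → Vec} (h : MemL2rVec U v) :
    ∃ v' : Pt → Vec, (∀ i, Measurable fun x => v' x i) ∧
      ∀ i, (fun x => v x i) =ᵐ[volume.restrict U] fun x => v' x i := by
  choose v' hv' using fun i => (h i).exists_measurable hU hpos
  exact ⟨fun x i => v' i x, fun i => (hv' i).1, fun i => (hv' i).2⟩

/-- The measure `r dr dz` is finite on balls, so `L²` is contained in `L¹` there. -/
theorem integrableOn_withDensity_ball {U : Set Pt} {N : Pt → ℝ} (hN : Measurable N)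
    (h : MemL2r U N) (R : ℝ) :
    ∫⁻ x in U ∩ Metric.closedBall 0 R, ENNReal.ofReal (x 0) * ‖N x‖ₑ < ⊤ := by
  have hmeas : MeasurableSet (Metric.closedBall (0 : Pt) R) := measurableSet_closedBall
  have hd : Measurable fun x : Pt => ENNReal.ofReal (x 0) := (measurable_coord 0).ennreal_ofReal
  have hfin : IsFiniteMeasure ((rMeasure U).restrict (Metric.closedBall 0 R)) := by
    refine ⟨?_⟩
    rw [Measure.restrict_apply_univ, rMeasure, withDensity_apply _ hmeas]
    calc ∫⁻ x in Metric.closedBall 0 R, ENNReal.ofReal (x 0) ∂(volume.restrict U)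
        ≤ ∫⁻ _x in Metric.closedBall (0 : Pt) R, ENNReal.ofReal R ∂(volume.restrict U) := by
          refine setLIntegral_mono' hmeas fun x hx => ENNReal.ofReal_le_ofReal ?_
          exact (le_abs_self _).trans ((PiLp.norm_apply_le x 0).trans
            (mem_closedBall_zero_iff.1 hx))
      _ < ⊤ := by
          rw [setLIntegral_const]
          refine ENNReal.mul_lt_top ENNReal.ofReal_lt_top ?_
          exact (Measure.restrict_apply_le _ _).trans_lt measure_closedBall_lt_top
  have h1 : MemLp N 1 ((rMeasure U).restrict (Metric.closedBall 0 R)) :=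
    (MemLp.restrict _ h).mono_exponent (by norm_num)
  have h2 := (memLp_one_iff_integrable.1 h1).2
  rw [HasFiniteIntegral, rMeasure, restrict_withDensity hmeas, Measure.restrict_restrict hmeas,
    lintegral_withDensity_eq_lintegral_mul _ hd hN.enorm, inter_comm] at h2
  exact h2

/-- On a ball of radius `R`, `r³ |F| = r² |r F| ≤ R (1 + R) · r |N|`, which is integrable. The
factor `1 + r` in the hypothesis covers both `F = N` and `F = N / r`. -/
theorem averageable_of_le (hU : MeasurableSet U) (hpos : ∀ x ∈ U, 0 < x 0) {N F : Pt → ℝ}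
    (hN : Measurable N) (h : MemL2r U N) (hF : Measurable F)
    (hle : ∀ x ∈ U, |x 0 * F x| ≤ (1 + x 0) * |N x|) : Averageable U F := by
  refine ⟨hF, fun R => ?_⟩
  have hfin := integrableOn_withDensity_ball hN h R
  refine lt_of_le_of_lt ?_ (ENNReal.mul_lt_top (a := ENNReal.ofReal (R * (1 + R)))
    ENNReal.ofReal_lt_top hfin)
  have hm : Measurable fun x : Pt => ENNReal.ofReal (x 0) * ‖N x‖ₑ :=
    (measurable_coord 0).ennreal_ofReal.mul hN.enorm
  rw [← lintegral_const_mul _ hm]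
  refine setLIntegral_mono' (hU.inter measurableSet_closedBall) fun x hx => ?_
  have hx0 := hpos x hx.1
  have hR : x 0 ≤ R := (le_abs_self _).trans ((PiLp.norm_apply_le x 0).trans
    (mem_closedBall_zero_iff.1 hx.2))
  have h1 := hle x hx.1
  have hR0 := hx0.le.trans hR
  rw [← enorm_mul, ← ofReal_norm, ← ofReal_norm, ← ENNReal.ofReal_mul hx0.le,
    ← ENNReal.ofReal_mul (by nlinarith)]
  refine ENNReal.ofReal_le_ofReal ?_
  rw [Real.norm_eq_abs, Real.norm_eq_abs]
  calc |x 0 ^ 3 * F x| = x 0 ^ 2 * |x 0 * F x| := by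
        rw [abs_mul, abs_mul, abs_of_pos (pow_pos hx0 3), abs_of_pos hx0]
        ring
    _ ≤ x 0 ^ 2 * ((1 + x 0) * |N x|) := by gcongr
    _ = x 0 * (1 + x 0) * (x 0 * |N x|) := by ring
    _ ≤ R * (1 + R) * (x 0 * |N x|) := by gcongr

theorem MemL2r.averageable (hU : MeasurableSet U) (hpos : ∀ x ∈ U, 0 < x 0) {N : Pt → ℝ}
    (h : MemL2r U N) (hN : Measurable N) : Averageable U N := by
  refine averageable_of_le hU hpos hN h hN fun x hx => ?_
  rw [abs_mul, abs_of_pos (hpos x hx)]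
  nlinarith [abs_nonneg (N x)]

theorem MemL2r.averageable_div (hU : MeasurableSet U) (hpos : ∀ x ∈ U, 0 < x 0) {N : Pt → ℝ}
    (h : MemL2r U N) (hN : Measurable N) : Averageable U fun x => N x / x 0 := by
  refine averageable_of_le hU hpos hN h (hN.div (measurable_coord 0)) fun x hx => ?_
  rw [mul_div_cancel₀ _ (hpos x hx).ne']
  nlinarith [abs_nonneg (N x), hpos x hx]

namespace Averageable

variable {F G : Pt → ℝ}

theorem const_mul (h : Averageable U F) (c : ℝ) : Averageable U fun x => c * F x := by
  refine ⟨h.measurable.const_mul c, fun R => ?_⟩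
  have hm : Measurable fun x : Pt => ‖x 0 ^ 3‖ₑ * ‖F x‖ₑ :=
    ((measurable_coord 0).pow_const 3).enorm.mul h.measurable.enorm
  simp only [enorm_mul, mul_left_comm _ ‖c‖ₑ] at hm ⊢
  rw [lintegral_const_mul _ hm]
  exact ENNReal.mul_lt_top enorm_lt_top (by simpa only [enorm_mul] using h.lintegral_lt_top R)

theorem add (h : Averageable U F) (h' : Averageable U G) : Averageable U fun x => F x + G x := by
  refine ⟨h.measurable.add h'.measurable, fun R => ?_⟩
  have hm : Measurable fun x : Pt => ‖x 0 ^ 3‖ₑ * ‖F x‖ₑ :=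
    ((measurable_coord 0).pow_const 3).enorm.mul h.measurable.enorm
  refine lt_of_le_of_lt ?_ (ENNReal.add_lt_top.2 ⟨h.lintegral_lt_top R, h'.lintegral_lt_top R⟩)
  rw [← lintegral_add_left hm]
  refine lintegral_mono fun x => ?_
  rw [← mul_add]
  gcongr
  exact enorm_add_le _ _

theorem neg (h : Averageable U F) : Averageable U fun x => -F x := by
  simpa only [neg_one_mul] using h.const_mul (-1)

theorem sub (h : Averageable U F) (h' : Averageable U G) : Averageable U fun x => F x - G x := by
  simpa only [sub_eq_add_neg] using h.add h'.neg

end Averageable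

theorem LocInt.integrableOn_mul {F ψ : Pt → ℝ} (hF : LocInt U F) (hψ : Continuous ψ)
    (hc : HasCompactSupport ψ) (hs : tsupport ψ ⊆ U) :
    IntegrableOn (fun x => F x * ψ x) U := by
  have h1 : IntegrableOn (fun x => F x * ψ x) (tsupport ψ) :=
    (hF _ hc hs).mul_continuousOn hψ.continuousOn hc
  refine (integrableOn_iff_integrable_of_support_subset fun x hx => ?_).1 h1 |>.integrableOn
  exact subset_tsupport ψ fun h => hx (by simp only [h, mul_zero])

theorem setIntegral_mul_congr {f f' : Pt → ℝ} (h : f =ᵐ[volume.restrict U] f') (ψ : Pt → ℝ) :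
    ∫ x in U, f x * ψ x = ∫ x in U, f' x * ψ x := by
  refine integral_congr_ae ?_
  filter_upwards [h] with x hx
  rw [hx]

theorem HasGrad.congr {u u' : Pt → ℝ} {g g' : Pt → Vec} (h : HasGrad n U u g)
    (hu : u =ᵐ[volume.restrict U] u')
    (hg : ∀ i, (fun x => g x i) =ᵐ[volume.restrict U] fun x => g' x i) : HasGrad n U u' g' where
  mem := h.mem.congr hu
  mem_grad i := (h.mem_grad i).congr (hg i)
  eq_r φ hφ := by
    rw [← setIntegral_mul_congr (hg 0) φ,
      ← setIntegral_mul_congr hu (pd 0 φ)]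
    exact h.eq_r φ hφ
  eq_θ := by
    filter_upwards [h.eq_θ, hu, hg 1] with x h1 h2 h3
    rw [← h2, ← h3, h1]
  eq_z φ hφ := by
    rw [← setIntegral_mul_congr (hg 2) φ,
      ← setIntegral_mul_congr hu (pd 1 φ)]
    exact h.eq_z φ hφ

theorem HasCurl.congr {v v' w w' : Pt → Vec} (h : HasCurl n U v w)
    (hv : ∀ i, (fun x => v x i) =ᵐ[volume.restrict U] fun x => v' x i)
    (hw : ∀ i, (fun x => w x i) =ᵐ[volume.restrict U] fun x => w' x i) : HasCurl n U v' w' where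
  mem i := (h.mem i).congr (hv i)
  mem_curl i := (h.mem_curl i).congr (hw i)
  eq_r φ hφ := by
    rw [← setIntegral_mul_congr (hw 0) φ]
    refine (h.eq_r φ hφ).trans (integral_congr_ae ?_)
    filter_upwards [hv 1, hv 2] with x h1 h2
    rw [h1, h2]
  eq_θ φ hφ := by
    rw [← setIntegral_mul_congr (hw 1) φ]
    refine (h.eq_θ φ hφ).trans (integral_congr_ae ?_)
    filter_upwards [hv 0, hv 2] with x h1 h2
    rw [h1, h2]
  eq_z φ hφ := by
    rw [← setIntegral_mul_congr (hw 2) φ]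
    refine (h.eq_z φ hφ).trans (integral_congr_ae ?_)
    filter_upwards [hv 0, hv 1] with x h1 h2
    rw [h1, h2]

theorem HasDiv.congr {w w' : Pt → Vec} {f f' : Pt → ℝ} (h : HasDiv n U w f)
    (hw : ∀ i, (fun x => w x i) =ᵐ[volume.restrict U] fun x => w' x i)
    (hf : f =ᵐ[volume.restrict U] f') : HasDiv n U w' f' where
  mem i := (h.mem i).congr (hw i)
  mem_div := h.mem_div.congr hf
  eq φ hφ := by
    rw [← setIntegral_mul_congr hf φ]
    refine (h.eq φ hφ).trans (integral_congr_ae ?_)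
    filter_upwards [hw 0, hw 1, hw 2] with x h0 h1 h2
    rw [h0, h1, h2]

namespace IsTest

variable {φ : Pt → ℝ}

theorem integrableOn (hφ : IsTest U φ) : IntegrableOn φ U :=
  (hφ.1.continuous.integrable_of_hasCompactSupport hφ.2.1).integrableOn

theorem continuous_pd (hφ : IsTest U φ) (j : Fin 2) : Continuous (pd j φ) :=
  (hφ.1.continuous_fderiv (by simp)).clm_apply continuous_const

theorem tsupport_pd (φ : Pt → ℝ) (j : Fin 2) : tsupport (pd j φ) ⊆ tsupport φ :=
  closure_minimal (fun x hx => by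
    by_contra h
    exact hx (pd_eq_zero_of_notMem_tsupport h j)) (isClosed_tsupport φ)

/-- The factor `c` may be singular outside `U`, since `φ` vanishes near there. This permits testing
with multiples of `φ / r` and `r φ`, which moves the weights of the reduced fields onto the test
function. -/
theorem mul_contDiff (hφ : IsTest U φ) (hU : IsOpen U) {c : Pt → ℝ} (hc : ContDiffOn ℝ ∞ c U) :
    IsTest U fun x => c x * φ x := by
  have hsupp : tsupport (fun x => c x * φ x) ⊆ tsupport φ := tsupport_mul_subset_right
  refine ⟨contDiff_iff_contDiffAt.2 fun x => ?_, hφ.2.1.mul_left, hsupp.trans hφ.2.2⟩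
  by_cases hx : x ∈ tsupport φ
  · exact (hc.contDiffAt (hU.mem_nhds (hφ.2.2 hx))).mul hφ.1.contDiffAt
  · refine contDiffAt_const (c := (0 : ℝ)) |>.congr_of_eventuallyEq ?_
    filter_upwards [notMem_tsupport_iff_eventuallyEq.1 hx] with z hz
    simp only [hz, Pi.zero_apply, mul_zero]

theorem const_div_coord (hφ : IsTest U φ) (hU : IsOpen U) (hpos : ∀ x ∈ U, 0 < x 0) (c : ℝ) :
    IsTest U fun x => c / x 0 * φ x :=
  hφ.mul_contDiff hU (contDiffOn_const.div (by fun_prop) fun x hx => (hpos x hx).ne')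

theorem const_mul_coord (hφ : IsTest U φ) (hU : IsOpen U) (c : ℝ) :
    IsTest U fun x => c * x 0 * φ x :=
  hφ.mul_contDiff hU (by fun_prop)

theorem differentiableAt (hφ : IsTest U φ) (x : Pt) : DifferentiableAt ℝ φ x :=
  (hφ.1.differentiable (by simp)).differentiableAt

theorem pd_const_mul_coord (hφ : IsTest U φ) (c : ℝ) (j : Fin 2) (x : Pt) :
    pd j (fun x => c * x 0 * φ x) x = (if j = 0 then c else 0) * φ x + c * x 0 * pd j φ x := by
  have h1 : HasFDerivAt (fun x : Pt => c * x 0) (c • (EuclideanSpace.proj 0 : Pt →L[ℝ] ℝ)) x :=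
    ((EuclideanSpace.proj 0 : Pt →L[ℝ] ℝ).hasFDerivAt (x := x)).const_mul c
  rw [pd_mul_apply h1.differentiableAt (hφ.differentiableAt x) j, pd, h1.fderiv]
  fin_cases j <;> simp

theorem pd_const_div_coord (hφ : IsTest U φ) (c : ℝ) (j : Fin 2) {x : Pt} (hx : 0 < x 0) :
    pd j (fun x => c / x 0 * φ x) x
      = -(if j = 0 then c / x 0 ^ 2 else 0) * φ x + c / x 0 * pd j φ x := by
  have h0 : HasFDerivAt (fun x : Pt => x 0) (EuclideanSpace.proj 0 : Pt →L[ℝ] ℝ) x :=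
    (EuclideanSpace.proj 0 : Pt →L[ℝ] ℝ).hasFDerivAt (x := x)
  have h1 : HasFDerivAt (fun x : Pt => c / x 0)
      (c • (-(x 0 ^ 2)⁻¹) • (EuclideanSpace.proj 0 : Pt →L[ℝ] ℝ)) x := by
    simp only [div_eq_mul_inv]
    exact ((hasDerivAt_inv hx.ne').comp_hasFDerivAt x h0).const_mul c
  rw [pd_mul_apply h1.differentiableAt (hφ.differentiableAt x) j, pd, h1.fderiv]
  fin_cases j <;> simp [div_eq_mul_inv]

theorem hasCompactSupport_pd (hφ : IsTest U φ) (j : Fin 2) : HasCompactSupport (pd j φ) :=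
  hφ.2.1.of_isClosed_subset (isClosed_tsupport _) (tsupport_pd φ j)

end IsTest

end WeightedSpaces

/-! ### The smoothers expressed through averaged pullbacks -/

noncomputable section CommutingDiagram

open Filter Topology
open scoped NNReal ENNReal

/-- Bounded measurable functions on `U`. -/
structure BddMeas (U : Set Pt) (F : Pt → ℝ) : Prop where
  measurable : Measurable F
  bound : ∃ C : ℝ, ∀ x ∈ U, |F x| ≤ C

namespace BddMeas

variable {U : Set Pt} {F G : Pt → ℝ}

theorem add (h : BddMeas U F) (h' : BddMeas U G) : BddMeas U fun x => F x + G x := by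
  obtain ⟨C, hC⟩ := h.bound
  obtain ⟨D, hD⟩ := h'.bound
  exact ⟨h.measurable.add h'.measurable, C + D, fun x hx =>
    (abs_add_le _ _).trans (add_le_add (hC x hx) (hD x hx))⟩

theorem mul (h : BddMeas U F) (h' : BddMeas U G) : BddMeas U fun x => F x * G x := by
  obtain ⟨C, hC⟩ := h.bound
  obtain ⟨D, hD⟩ := h'.bound
  refine ⟨h.measurable.mul h'.measurable, C * D, fun x hx => ?_⟩
  rw [abs_mul]
  exact mul_le_mul (hC x hx) (hD x hx) (abs_nonneg _) ((abs_nonneg _).trans (hC x hx))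

theorem const_mul (h : BddMeas U F) (c : ℝ) : BddMeas U fun x => c * F x :=
  BddMeas.mul ⟨measurable_const, |c|, fun _ _ => le_rfl⟩ h

theorem neg (h : BddMeas U F) : BddMeas U fun x => -F x := by
  simpa only [neg_one_mul] using h.const_mul (-1)

theorem sub (h : BddMeas U F) (h' : BddMeas U G) : BddMeas U fun x => F x - G x := by
  simpa only [sub_eq_add_neg] using h.add h'.neg

theorem coord_div (hb : Bornology.IsBounded U) (c : ℝ) : BddMeas U fun x => x 0 / c := by
  obtain ⟨R, hR⟩ := hb.exists_norm_le
  refine ⟨(measurable_coord 0).div_const c, R * |c⁻¹|, fun x hx => ?_⟩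
  rw [div_eq_mul_inv, abs_mul]
  gcongr
  exact (PiLp.norm_apply_le x 0).trans (hR x hx)

theorem integrableOn_mul (h : BddMeas U F) (hU : MeasurableSet U) {g : Pt → ℝ}
    (hg : IntegrableOn g U) : IntegrableOn (fun x => F x * g x) U := by
  obtain ⟨C, hC⟩ := h.bound
  exact Integrable.bdd_mul (c := C) hg h.measurable.aestronglyMeasurable
    ((ae_restrict_iff' hU).2 (.of_forall hC))

theorem memL2r (h : BddMeas U F) (hU : MeasurableSet U) (hb : Bornology.IsBounded U) :
    MemL2r U F := by
  obtain ⟨C, hC⟩ := h.bound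
  obtain ⟨R, hR⟩ := hb.exists_norm_le
  have hfin : IsFiniteMeasure (rMeasure U) := by
    refine ⟨?_⟩
    rw [rMeasure, withDensity_apply _ MeasurableSet.univ, Measure.restrict_univ]
    calc ∫⁻ x in U, ENNReal.ofReal (x 0) ≤ ∫⁻ _x in U, ENNReal.ofReal R := by
          refine setLIntegral_mono' hU fun x hx => ENNReal.ofReal_le_ofReal ?_
          exact (le_abs_self _).trans ((PiLp.norm_apply_le x 0).trans (hR x hx))
      _ < ⊤ := by
          rw [setLIntegral_const]
          exact ENNReal.mul_lt_top ENNReal.ofReal_lt_top hb.measure_lt_top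
  exact MemLp.of_bound h.measurable.aestronglyMeasurable C
    ((rMeasure_absolutelyContinuous U).ae_le ((ae_restrict_iff' hU).2 (.of_forall hC)))

end BddMeas

variable {Ω Ω' : Set Pt} {T : Finset (Fin 3 → Pt)} {ρ : ℝ} {l n : ℕ}

theorem AvgIntegrand.bddMeas {N : Pt → (vertices T → Pt) → ℝ} (h : AvgIntegrand Ω l ρ T N) :
    BddMeas Ω (wavg l ρ T N) := by
  obtain ⟨C, hC⟩ := h.exists_abs_wavg_le
  exact ⟨h.measurable_wavg, C, hC⟩

/-- The field `((n v_r + v_θ)/r, n v_z/r)` transported by the covariant transform. -/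
def covField (n : ℕ) (v : Pt → Vec) : Fin 2 → Pt → ℝ :=
  ![fun z => (n * v z 0 + v z 1) / z 0, fun z => n * v z 2 / z 0]

/-- The rotated meridian part `(w_z, -w_r)` of a field. -/
def rotField (w : Pt → Vec) : Fin 2 → Pt → ℝ := ![fun z => w z 2, fun z => -w z 0]

/-- The density `(n w_θ - w_r)/r`. -/
def angField (n : ℕ) (w : Pt → Vec) (z : Pt) : ℝ := (n * w z 1 - w z 0) / z 0

/-- `S^g u` as a single average over the mesh. -/
def meshSg (n l : ℕ) (ρ : ℝ) (T : Finset (Fin 3 → Pt)) (u : Pt → ℝ) (x : Pt) : ℝ :=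
  x 0 / n * avgScalar l ρ T (fun z => n * u z / z 0) x

/-- `S^c v` as averages over the mesh. -/
def meshSc (n l : ℕ) (ρ : ℝ) (T : Finset (Fin 3 → Pt)) (v : Pt → Vec) (x : Pt) : Vec :=
  ![x 0 / n * avgCov l ρ T (covField n v) 0 x - 1 / n * avgScalar l ρ T (fun z => v z 1) x,
    avgScalar l ρ T (fun z => v z 1) x,
    x 0 / n * avgCov l ρ T (covField n v) 1 x]

/-- `S^d w` as averages over the mesh. -/
def meshSd (n l : ℕ) (ρ : ℝ) (T : Finset (Fin 3 → Pt)) (w : Pt → Vec) (x : Pt) : Vec :=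
  ![-avgCov l ρ T (rotField w) 1 x,
    1 / n * -avgCov l ρ T (rotField w) 1 x + x 0 / n * avgDet l ρ T (angField n w) x,
    avgCov l ρ T (rotField w) 0 x]

/-- Measurable square integrable fields. -/
structure NiceField (U : Set Pt) (v : Pt → Vec) : Prop where
  measurable : ∀ i, Measurable fun x => v x i
  memL2r : MemL2rVec U v

namespace MeshSetup

theorem isBounded (S : MeshSetup Ω Ω' T ρ) : Bornology.IsBounded Ω := by
  have h : IsCompact (⋃ K ∈ T, _root_.tri K) := T.isCompact_biUnion fun K _ => isCompact_tri K
  rw [S.tri.cover] at h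
  exact h.isBounded.subset subset_closure

section Averageable

variable {v : Pt → Vec}

theorem averageable_comp (S : MeshSetup Ω Ω' T ρ) (h : NiceField Ω' v) (i : Fin 3) :
    Averageable Ω' fun z => v z i :=
  (h.memL2r i).averageable S.isOpen'.measurableSet S.pos (h.measurable i)

theorem averageable_comp_div (S : MeshSetup Ω Ω' T ρ) (h : NiceField Ω' v) (i : Fin 3) :
    Averageable Ω' fun z => v z i / z 0 :=
  (h.memL2r i).averageable_div S.isOpen'.measurableSet S.pos (h.measurable i)

theorem averageable_covField (S : MeshSetup Ω Ω' T ρ) (h : NiceField Ω' v) (i : Fin 2) :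
    Averageable Ω' (covField n v i) := by
  fin_cases i
  · have := ((S.averageable_comp_div h 0).const_mul n).add (S.averageable_comp_div h 1)
    simpa only [covField, Fin.zero_eta, Matrix.cons_val_zero, add_div, mul_div_assoc] using this
  · have := (S.averageable_comp_div h 2).const_mul n
    simpa only [covField, Fin.mk_one, Matrix.cons_val_one, Matrix.cons_val_zero,
      mul_div_assoc] using this

theorem averageable_rotField (S : MeshSetup Ω Ω' T ρ) (h : NiceField Ω' v) (i : Fin 2) :
    Averageable Ω' (rotField v i) := by
  fin_cases i
  · exact S.averageable_comp h 2
  · exact (S.averageable_comp h 0).neg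

theorem averageable_angField (S : MeshSetup Ω Ω' T ρ) (h : NiceField Ω' v) :
    Averageable Ω' (angField n v) := by
  have := ((S.averageable_comp_div h 1).const_mul n).sub (S.averageable_comp_div h 0)
  unfold angField
  simpa only [sub_div, mul_div_assoc] using this

end Averageable

section Bounded

variable {f : Pt → ℝ} {a b : Fin 2 → Pt → ℝ}

theorem bddMeas_avgScalar (S : MeshSetup Ω Ω' T ρ) (hf : Averageable Ω' f) :
    BddMeas Ω (avgScalar l ρ T f) := (S.avgIntegrand_comp l hf).bddMeas

theorem avgIntegrand_cov (S : MeshSetup Ω Ω' T ρ) (l : ℕ) (ha : ∀ i, Averageable Ω' (a i))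
    (j : Fin 2) :
    AvgIntegrand Ω l ρ T fun x y => meshJac T y x 0 j * a 0 (meshMap T y x)
      + meshJac T y x 1 j * a 1 (meshMap T y x) :=
  (S.avgIntegrand_jac l 0 j (ha 0)).add (S.avgIntegrand_jac l 1 j (ha 1))

theorem bddMeas_avgCov (S : MeshSetup Ω Ω' T ρ) (ha : ∀ i, Averageable Ω' (a i)) (j : Fin 2) :
    BddMeas Ω (avgCov l ρ T a j) := (S.avgIntegrand_cov l ha j).bddMeas

theorem bddMeas_avgDet (S : MeshSetup Ω Ω' T ρ) (hf : Averageable Ω' f) :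
    BddMeas Ω (avgDet l ρ T f) := (S.avgIntegrand_det l hf).bddMeas

theorem avgCov_sub (S : MeshSetup Ω Ω' T ρ) (ha : ∀ i, Averageable Ω' (a i))
    (hb : ∀ i, Averageable Ω' (b i)) (j : Fin 2) {x : Pt} (hx : x ∈ Ω) :
    avgCov l ρ T (fun i z => a i z - b i z) j x = avgCov l ρ T a j x - avgCov l ρ T b j x := by
  simp only [avgCov, wavg]
  rw [← integral_sub ((S.avgIntegrand_cov l ha j).integrable hx)
    ((S.avgIntegrand_cov l hb j).integrable hx)]
  congr 1
  ext y
  ring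

theorem avgDet_add (S : MeshSetup Ω Ω' T ρ) {c d : Pt → ℝ} (hc : Averageable Ω' c)
    (hd : Averageable Ω' d) {x : Pt} (hx : x ∈ Ω) :
    avgDet l ρ T (fun z => c z + d z) x = avgDet l ρ T c x + avgDet l ρ T d x := by
  simp only [avgDet, wavg]
  rw [← integral_add ((S.avgIntegrand_det l hc).integrable hx)
    ((S.avgIntegrand_det l hd).integrable hx)]
  congr 1
  ext y
  ring

theorem bddMeas_meshSg (S : MeshSetup Ω Ω' T ρ) {u : Pt → ℝ}
    (hf : Averageable Ω' fun z => n * u z / z 0) : BddMeas Ω (meshSg n l ρ T u) :=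
  (BddMeas.coord_div S.isBounded n).mul (S.bddMeas_avgScalar hf)

theorem bddMeas_meshSc (S : MeshSetup Ω Ω' T ρ) {v : Pt → Vec} (hv : NiceField Ω' v) (i : Fin 3) :
    BddMeas Ω fun x => meshSc n l ρ T v x i := by
  have h0 := BddMeas.coord_div S.isBounded (n : ℝ)
  have h1 := S.bddMeas_avgScalar (l := l) (S.averageable_comp hv 1)
  have h2 := S.bddMeas_avgCov (l := l) (S.averageable_covField (n := n) hv)
  fin_cases i
  · exact (h0.mul (h2 0)).sub (h1.const_mul (1 / n))
  · exact h1
  · exact h0.mul (h2 1)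

theorem bddMeas_meshSd (S : MeshSetup Ω Ω' T ρ) {w : Pt → Vec} (hw : NiceField Ω' w) (i : Fin 3) :
    BddMeas Ω fun x => meshSd n l ρ T w x i := by
  have h0 := BddMeas.coord_div S.isBounded (n : ℝ)
  have h1 := S.bddMeas_avgCov (l := l) (S.averageable_rotField hw)
  have h2 := S.bddMeas_avgDet (l := l) (S.averageable_angField (n := n) hw)
  fin_cases i
  · exact (h1 1).neg
  · exact ((h1 1).neg.const_mul (1 / n)).add (h0.mul h2)
  · exact h1 0

end Bounded

section Representation

variable {v v' : Pt → Vec}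

theorem ae_glue_locSg (S : MeshSetup Ω Ω' T ρ) {u u' : Pt → ℝ} (h : u =ᵐ[volume.restrict Ω'] u')
    (hu : Averageable Ω' fun z => n * u' z / z 0) :
    glue T (locSg n l ρ u) =ᵐ[volume.restrict Ω] meshSg n l ρ T u' := by
  filter_upwards [ae_mem_regularPts S.isOpen T] with x hx
  obtain ⟨K, hK, hxK, hglue, -⟩ := exists_glue_eq S.tri hx.1
  rw [hglue, locSg, meshSg]
  congr 1
  refine S.avg_scalar_eq l hK hxK (F := fun z => n * u z / z 0) ?_ hu
  filter_upwards [h] with z hz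
  rw [hz]

theorem ae_glue_locSc (S : MeshSetup Ω Ω' T ρ)
    (h : ∀ i, (fun x => v x i) =ᵐ[volume.restrict Ω'] fun x => v' x i) (hv : NiceField Ω' v')
    (i : Fin 3) : (fun x => glue T (locSc n l ρ v) x i) =ᵐ[volume.restrict Ω]
      fun x => meshSc n l ρ T v' x i := by
  filter_upwards [ae_mem_regularPts S.isOpen T] with x hx
  obtain ⟨K, hK, hxK, -, hglue⟩ := exists_glue_eq S.tri hx.1
  have hint := mem_interior_of_regular hx hK hxK
  have e1 := S.avg_scalar_eq l hK hxK (h 1) (S.averageable_comp hv 1)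
  have e2 : ∀ j, avg l ρ K (fun y => covariant n v K y x j)
      = avgCov l ρ T (covField n v') j x := fun j => by
    refine S.avg_jac_eq l hK hint (F := covField n v) (fun i => ?_)
      (S.averageable_covField hv) j (.of_forall fun y => ?_)
    · fin_cases i
      · filter_upwards [h 0, h 1] with z h0 h1
        simp only [covField, Fin.zero_eta, Matrix.cons_val_zero, h0, h1]
      · filter_upwards [h 2] with z h2
        simp only [covField, Fin.mk_one, Matrix.cons_val_one, Matrix.cons_val_zero, h2]
    · fin_cases j <;> simp [covariant, covField]
  rw [hglue, locSc, meshSc, e1, e2, e2]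

theorem ae_glue_locSd (S : MeshSetup Ω Ω' T ρ)
    (h : ∀ i, (fun x => v x i) =ᵐ[volume.restrict Ω'] fun x => v' x i) (hv : NiceField Ω' v')
    (i : Fin 3) : (fun x => glue T (locSd n l ρ v) x i) =ᵐ[volume.restrict Ω]
      fun x => meshSd n l ρ T v' x i := by
  filter_upwards [ae_mem_regularPts S.isOpen T] with x hx
  obtain ⟨K, hK, hxK, -, hglue⟩ := exists_glue_eq S.tri hx.1
  have hint := mem_interior_of_regular hx hK hxK
  have hrot : ∀ i, rotField v i =ᵐ[volume.restrict Ω'] rotField v' i := fun i => by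
    fin_cases i
    · exact h 2
    · exact (h 0).neg
  have e0 : avg l ρ K (fun y => (jac K y x).det *
      ((n * v (xt K y x) 1 - v (xt K y x) 0) / xt K y x 0))
      = avgDet l ρ T (angField n v') x := by
    refine S.avg_det_eq l hK hint (F := angField n v) ?_ (S.averageable_angField hv)
    filter_upwards [h 0, h 1] with z h0 h1
    simp only [angField, h0, h1]
  -- In two dimensions the adjugate applied to `(w_r, w_z)` is a rotation of `Jᵀ` applied to `(w_z,
  -- -w_r)`: its components are `-(Jᵀ q)_1` and `(Jᵀ q)_0`.
  have e1 : avg l ρ K (fun y => -piola v K y x 0) = avgCov l ρ T (rotField v') 1 x := by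
    refine S.avg_jac_eq l hK hint hrot (S.averageable_rotField hv) 1 ?_
    filter_upwards [S.ae_det_jac_ne_zero hK x] with y hy
    rw [piola, det_smul_inv hy]
    simp [rotField, Matrix.adjugate_fin_two, Matrix.mulVec, dotProduct, Fin.sum_univ_two]
  have e2 : avg l ρ K (fun y => piola v K y x 1) = avgCov l ρ T (rotField v') 0 x := by
    refine S.avg_jac_eq l hK hint hrot (S.averageable_rotField hv) 0 ?_
    filter_upwards [S.ae_det_jac_ne_zero hK x] with y hy
    rw [piola, det_smul_inv hy]
    simp [rotField, Matrix.adjugate_fin_two, Matrix.mulVec, dotProduct, Fin.sum_univ_two]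
    ring
  have e3 : avg l ρ K (fun y => piola v K y x 0) = -avgCov l ρ T (rotField v') 1 x := by
    rw [← e1]
    simp only [avg, mul_neg, integral_neg, neg_neg]
  rw [hglue, locSd, meshSd, e0, e2, e3]

theorem ae_glue_locSo (S : MeshSetup Ω Ω' T ρ) {f f' : Pt → ℝ} (h : f =ᵐ[volume.restrict Ω'] f')
    (hf : Averageable Ω' f') :
    glue T (locSo l ρ f) =ᵐ[volume.restrict Ω] avgDet l ρ T f' := by
  filter_upwards [ae_mem_regularPts S.isOpen T] with x hx
  obtain ⟨K, hK, hxK, hglue, -⟩ := exists_glue_eq S.tri hx.1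
  rw [hglue]
  exact S.avg_det_eq l hK (mem_interior_of_regular hx hK hxK) h hf

end Representation

end MeshSetup

end CommutingDiagram

/-! ### The three commuting identities for measurable representatives -/

noncomputable section CommutingSmoothers

open Filter Topology

variable {Ω Ω' : Set Pt} {T : Finset (Fin 3 → Pt)} {ρ : ℝ} {l n : ℕ}

namespace MeshSetup

theorem avgScalar_pd (S : MeshSetup Ω Ω' T ρ) {f : Pt → ℝ} {G : Fin 2 → Pt → ℝ}
    (hf : Averageable Ω' f) (hG : ∀ i, Averageable Ω' (G i))
    (hw : ∀ i ψ, IsTest Ω' ψ → ∫ x in Ω', G i x * ψ x = -∫ x in Ω', f x * pd i ψ x)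
    {φ : Pt → ℝ} (hφ : IsTest Ω φ) (j : Fin 2) :
    ∫ x in Ω, avgScalar l ρ T f x * pd j φ x = -∫ x in Ω, avgCov l ρ T G j x * φ x :=
  S.wavg_grad hf hG hw hφ j

theorem avgDet_test (S : MeshSetup Ω Ω' T ρ) {c : Pt → ℝ} {v : Fin 2 → Pt → ℝ}
    (hc : Averageable Ω' c) (hv : ∀ i, Averageable Ω' (v i))
    (hw : ∀ ψ, IsTest Ω' ψ →
      ∫ x in Ω', c x * ψ x = -(∫ x in Ω', v 0 x * pd 1 ψ x) + ∫ x in Ω', v 1 x * pd 0 ψ x)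
    {φ : Pt → ℝ} (hφ : IsTest Ω φ) :
    ∫ x in Ω, avgDet l ρ T c x * φ x
      = -(∫ x in Ω, avgCov l ρ T v 0 x * pd 1 φ x) + ∫ x in Ω, avgCov l ρ T v 1 x * pd 0 φ x :=
  S.wavg_curl hc hv hw hφ

theorem integrableOn_averageable_mul_test (S : MeshSetup Ω Ω' T ρ) {F ψ : Pt → ℝ}
    (hF : Averageable Ω' F) (hψ : IsTest Ω' ψ) : IntegrableOn (fun x => F x * ψ x) Ω' :=
  (hF.locInt S.pos).integrableOn_mul hψ.1.continuous hψ.2.1 hψ.2.2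

theorem integrableOn_averageable_mul_pd (S : MeshSetup Ω Ω' T ρ) {F ψ : Pt → ℝ}
    (hF : Averageable Ω' F) (hψ : IsTest Ω' ψ) (j : Fin 2) :
    IntegrableOn (fun x => F x * pd j ψ x) Ω' :=
  (hF.locInt S.pos).integrableOn_mul (hψ.continuous_pd j) (hψ.hasCompactSupport_pd j)
    ((IsTest.tsupport_pd ψ j).trans hψ.2.2)

/-- The planar gradient of `n u / r` is the reduced field of `g`, by the quotient rule and `g_θ = -n
u / r`. Averaged pullback preserves this, and the prefactor `r / n` is undone by testing with `(r/n)
φ`. -/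
theorem hasGrad_meshSg (S : MeshSetup Ω Ω' T ρ) (hn : 0 < n) {u : Pt → ℝ} {g : Pt → Vec}
    (hu : Measurable u) (hg : NiceField Ω' g) (h : HasGrad n Ω' u g)
    (h1 : ∀ z, g z 1 = -(n * u z / z 0)) :
    HasGrad n Ω (meshSg n l ρ T u) (meshSc n l ρ T g) := by
  have hΩ := S.isOpen.measurableSet
  have hΩ' := S.isOpen'.measurableSet
  have hn' : (n : ℝ) ≠ 0 := Nat.cast_ne_zero.2 hn.ne'
  have hpos : ∀ x ∈ Ω, 0 < x 0 := fun x hx => S.pos x (S.subset hx)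
  have hu' : Averageable Ω' u := h.mem.averageable hΩ' S.pos hu
  have hf : Averageable Ω' fun z => n * u z / z 0 := by
    simpa only [mul_div_assoc] using (h.mem.averageable_div hΩ' S.pos hu).const_mul n
  -- The defining weak identities are tested with `(n/r) ψ`; differentiating `1/r` produces the term
  -- `-n u / r²`, which is `g_θ / r`.
  have hgrad : ∀ i ψ, IsTest Ω' ψ → ∫ x in Ω', covField n g i x * ψ x
      = -∫ x in Ω', (n * u x / x 0) * pd i ψ x := by
    intro i ψ hψ
    have hψ' := hψ.const_div_coord S.isOpen' S.pos n
    fin_cases i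
    · have i1 := S.integrableOn_averageable_mul_test (S.averageable_comp hg 0) hψ'
      have i2 := S.integrableOn_averageable_mul_test (S.averageable_comp_div hg 1) hψ
      have i3 := S.integrableOn_averageable_mul_pd hu' hψ' 0
      have e1 : ∫ x in Ω', covField n g 0 x * ψ x
          = (∫ x in Ω', g x 0 * (n / x 0 * ψ x)) + ∫ x in Ω', g x 1 / x 0 * ψ x := by
        rw [← integral_add i1 i2]
        refine setIntegral_congr_fun hΩ' fun x hx => ?_
        simp only [covField, Matrix.cons_val_zero]
        ring
      refine e1.trans ?_
      rw [h.eq_r _ hψ', ← integral_neg, ← integral_neg, ← integral_add (Integrable.fun_neg i3) i2]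
      refine setIntegral_congr_fun hΩ' fun x hx => ?_
      have hx0 := (S.pos x hx).ne'
      simp only [hψ.pd_const_div_coord n 0 (S.pos x hx), h1, if_true, Fin.zero_eta]
      field_simp
      ring
    · have e1 : ∫ x in Ω', covField n g 1 x * ψ x = ∫ x in Ω', g x 2 * (n / x 0 * ψ x) := by
        refine setIntegral_congr_fun hΩ' fun x hx => ?_
        simp only [covField, Matrix.cons_val_one, Matrix.cons_val_zero]
        ring
      refine e1.trans ?_
      rw [h.eq_z _ hψ']
      congr 1
      refine setIntegral_congr_fun hΩ' fun x hx => ?_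
      simp only [hψ.pd_const_div_coord n 1 (S.pos x hx), Fin.mk_one]
      simp
      ring
  have key := fun {φ : Pt → ℝ} (hφ : IsTest Ω φ) (j : Fin 2) =>
    S.avgScalar_pd (l := l) hf (S.averageable_covField hg) hgrad
      (hφ.const_mul_coord S.isOpen (1 / n)) j
  have hθ : ∀ x, avgScalar l ρ T (fun z => g z 1) x
      = -avgScalar l ρ T (fun z => n * u z / z 0) x := fun x => by
    simp only [avgScalar, wavg, h1, mul_neg, integral_neg]
  have bS := S.bddMeas_avgScalar (l := l) hf
  have bC := S.bddMeas_avgCov (l := l) (S.averageable_covField (n := n) hg)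
  refine ⟨(S.bddMeas_meshSg hf).memL2r hΩ S.isBounded,
    fun i => (S.bddMeas_meshSc hg i).memL2r hΩ S.isBounded, fun φ hφ => ?_, ?_, fun φ hφ => ?_⟩
  · have hφ' := hφ.const_mul_coord S.isOpen (1 / n)
    have i1 := (bC 0).integrableOn_mul hΩ hφ'.integrableOn
    have i2 := (bS.const_mul (1 / n)).integrableOn_mul hΩ hφ.integrableOn
    have i3 := bS.integrableOn_mul hΩ (integrableOn_pd_test hφ' 0)
    have e1 : ∫ x in Ω, meshSc n l ρ T g x 0 * φ x
        = (∫ x in Ω, avgCov l ρ T (covField n g) 0 x * (1 / n * x 0 * φ x))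
          + ∫ x in Ω, 1 / n * avgScalar l ρ T (fun z => n * u z / z 0) x * φ x := by
      rw [← integral_add i1 i2]
      refine setIntegral_congr_fun hΩ fun x hx => ?_
      simp only [meshSc, Matrix.cons_val_zero, hθ]
      ring
    rw [e1, ← neg_neg (∫ x in Ω, avgCov l ρ T (covField n g) 0 x * (1 / n * x 0 * φ x)),
      ← key hφ 0, ← integral_neg, ← integral_neg, ← integral_add (Integrable.fun_neg i3) i2]
    refine setIntegral_congr_fun hΩ fun x hx => ?_
    simp only [meshSg, hφ.pd_const_mul_coord, if_true]
    ring
  · filter_upwards [ae_restrict_mem hΩ] with x hx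
    have hx0 := (hpos x hx).ne'
    simp only [meshSc, meshSg, Matrix.cons_val_one, Matrix.cons_val_zero, hθ]
    field_simp
  · have e1 : ∫ x in Ω, meshSc n l ρ T g x 2 * φ x
        = ∫ x in Ω, avgCov l ρ T (covField n g) 1 x * (1 / n * x 0 * φ x) := by
      refine setIntegral_congr_fun hΩ fun x hx => ?_
      simp only [meshSc, Matrix.cons_val]
      ring
    rw [e1, ← neg_neg (∫ x in Ω, avgCov l ρ T (covField n g) 1 x * (1 / n * x 0 * φ x)),
      ← key hφ 1]
    congr 1
    refine setIntegral_congr_fun hΩ fun x hx => ?_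
    simp only [meshSg, hφ.pd_const_mul_coord]
    simp
    ring

/-- Two planar identities are transported: the scalar curl of the reduced field of `v` is `(n w_θ -
w_r)/r`, and `∇ v_θ` is the rotated part of `w` minus the reduced field of `v`. The `r`- and
`z`-components need only the second, the `θ`-component needs both. -/
theorem hasCurl_meshSc (S : MeshSetup Ω Ω' T ρ) (hn : 0 < n) {v w : Pt → Vec}
    (hv : NiceField Ω' v) (hw : NiceField Ω' w) (h : HasCurl n Ω' v w) :
    HasCurl n Ω (meshSc n l ρ T v) (meshSd n l ρ T w) := by
  have hΩ := S.isOpen.measurableSet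
  have hΩ' := S.isOpen'.measurableSet
  have hn' : (n : ℝ) ≠ 0 := Nat.cast_ne_zero.2 hn.ne'
  have hpos : ∀ x ∈ Ω, 0 < x 0 := fun x hx => S.pos x (S.subset hx)
  have ha := S.averageable_covField (n := n) hv
  have hr := S.averageable_rotField hw
  have hb := S.averageable_angField (n := n) hw
  -- This is `n` times the `θ`-equation minus the `r`-equation, both tested with `ψ / r`.
  have hcurl : ∀ ψ, IsTest Ω' ψ → ∫ x in Ω', angField n w x * ψ x
      = -(∫ x in Ω', covField n v 0 x * pd 1 ψ x) + ∫ x in Ω', covField n v 1 x * pd 0 ψ x := by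
    intro ψ hψ
    have hψ' := hψ.const_div_coord S.isOpen' S.pos 1
    have i0 := S.integrableOn_averageable_mul_test ((S.averageable_comp hw 1).const_mul n) hψ'
    have i1 := S.integrableOn_averageable_mul_test (S.averageable_comp hw 0) hψ'
    have e1 : ∫ x in Ω', angField n w x * ψ x = n * (∫ x in Ω', w x 1 * (1 / x 0 * ψ x))
        - ∫ x in Ω', w x 0 * (1 / x 0 * ψ x) := by
      rw [← integral_const_mul]
      simp only [← mul_assoc (n : ℝ)]
      rw [← integral_sub i0 i1]
      refine setIntegral_congr_fun hΩ' fun x hx => ?_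
      simp only [angField]
      ring
    have j0 := S.integrableOn_averageable_mul_pd (S.averageable_comp hv 0) hψ' 1
    have j1 := S.integrableOn_averageable_mul_pd (S.averageable_comp hv 2) hψ' 0
    have j2 := S.integrableOn_averageable_mul_test ((S.averageable_comp_div hv 2).const_mul n) hψ'
    have j3 := S.integrableOn_averageable_mul_pd (S.averageable_comp hv 1) hψ' 1
    have j4 : IntegrableOn (fun x => -(n / x 0 * v x 2) * (1 / x 0 * ψ x)
        + v x 1 * pd 1 (fun x => 1 / x 0 * ψ x) x) Ω' := by
      refine IntegrableOn.congr_fun (j2.neg.add j3) (fun x _ => ?_) hΩ'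
      simp only [Pi.add_apply, Pi.neg_apply]
      ring
    rw [e1, h.eq_θ _ hψ', h.eq_r _ hψ', ← integral_const_mul, ← integral_sub
      ((Integrable.fun_add (Integrable.fun_neg j0) j1).const_mul (n : ℝ)) j4, ← integral_neg, ← integral_add
      (Integrable.fun_neg (S.integrableOn_averageable_mul_pd (ha 0) hψ 1))
      (S.integrableOn_averageable_mul_pd (ha 1) hψ 0)]
    refine setIntegral_congr_fun hΩ' fun x hx => ?_
    have hx0 := (S.pos x hx).ne'
    simp only [hψ.pd_const_div_coord 1 _ (S.pos x hx), covField, Matrix.cons_val_one,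
      Matrix.cons_val_zero, if_true, one_ne_zero, if_false]
    field_simp
    ring
  have hgrad : ∀ i ψ, IsTest Ω' ψ → ∫ x in Ω', (rotField w i x - covField n v i x) * ψ x
      = -∫ x in Ω', v x 1 * pd i ψ x := by
    intro i ψ hψ
    have k := S.integrableOn_averageable_mul_pd (S.averageable_comp hv 1) hψ
    have k0 := fun i => S.integrableOn_averageable_mul_test (ha i) hψ
    have k1 := fun i => S.integrableOn_averageable_mul_test (hr i) hψ
    simp only [sub_mul]
    rw [integral_sub (k1 i) (k0 i)]
    fin_cases i
    · have e : ∫ x in Ω', rotField w 0 x * ψ x = (∫ x in Ω', covField n v 0 x * ψ x)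
          - ∫ x in Ω', v x 1 * pd 0 ψ x := (h.eq_z ψ hψ).trans (integral_sub (k0 0) (k 0))
      simp only [Fin.zero_eta]
      linarith
    · have e : ∫ x in Ω', rotField w 1 x * ψ x = -∫ x in Ω', w x 0 * ψ x := by
        rw [← integral_neg]
        exact setIntegral_congr_fun hΩ' fun x _ => neg_mul _ _
      have e' : ∫ x in Ω', (-(n / x 0 * v x 2) * ψ x + v x 1 * pd 1 ψ x)
          = (∫ x in Ω', v x 1 * pd 1 ψ x) - ∫ x in Ω', covField n v 1 x * ψ x := by
        rw [← integral_sub (k 1) (k0 1)]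
        refine setIntegral_congr_fun hΩ' fun x _ => ?_
        simp only [covField, Matrix.cons_val_one, Matrix.cons_val_zero]
        ring
      simp only [Fin.mk_one]
      rw [e, h.eq_r ψ hψ, e']
      ring
  have hGA : ∀ i, Averageable Ω' fun z => rotField w i z - covField n v i z :=
    fun i => (hr i).sub (ha i)
  have bA := S.bddMeas_avgCov (l := l) ha
  have bR := S.bddMeas_avgCov (l := l) hr
  have bS := S.bddMeas_avgScalar (l := l) (S.averageable_comp hv 1)
  have bD := S.bddMeas_avgDet (l := l) hb
  have keyS : ∀ φ, IsTest Ω φ → ∀ j, ∫ x in Ω, avgScalar l ρ T (fun z => v z 1) x * pd j φ x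
      = (∫ x in Ω, avgCov l ρ T (covField n v) j x * φ x)
        - ∫ x in Ω, avgCov l ρ T (rotField w) j x * φ x := by
    intro φ hφ j
    rw [S.avgScalar_pd (l := l) (S.averageable_comp hv 1) hGA hgrad hφ j,
      ← integral_sub ((bA j).integrableOn_mul hΩ hφ.integrableOn)
        ((bR j).integrableOn_mul hΩ hφ.integrableOn), ← integral_neg]
    refine setIntegral_congr_fun hΩ fun x hx => ?_
    simp only [S.avgCov_sub hr ha j hx]
    ring
  have keyD := fun {φ : Pt → ℝ} (hφ : IsTest Ω φ) =>
    S.avgDet_test (l := l) hb ha hcurl (hφ.const_mul_coord S.isOpen (1 / n))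
  refine ⟨fun i => (S.bddMeas_meshSc hv i).memL2r hΩ S.isBounded,
    fun i => (S.bddMeas_meshSd hw i).memL2r hΩ S.isBounded, fun φ hφ => ?_, fun φ hφ => ?_,
    fun φ hφ => ?_⟩
  · have e1 : ∫ x in Ω, meshSd n l ρ T w x 0 * φ x
        = -∫ x in Ω, avgCov l ρ T (rotField w) 1 x * φ x := by
      rw [← integral_neg]
      exact setIntegral_congr_fun hΩ fun x _ => neg_mul _ _
    have e2 : ∫ x in Ω, (-(n / x 0 * meshSc n l ρ T v x 2) * φ x
          + meshSc n l ρ T v x 1 * pd 1 φ x)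
        = (∫ x in Ω, avgScalar l ρ T (fun z => v z 1) x * pd 1 φ x)
          - ∫ x in Ω, avgCov l ρ T (covField n v) 1 x * φ x := by
      rw [← integral_sub (bS.integrableOn_mul hΩ (integrableOn_pd_test hφ 1))
        ((bA 1).integrableOn_mul hΩ hφ.integrableOn)]
      refine setIntegral_congr_fun hΩ fun x hx => ?_
      have hx0 := (hpos x hx).ne'
      simp only [meshSc, Matrix.cons_val]
      field_simp
      ring
    rw [e1, e2, keyS φ hφ 1]
    ring
  -- Testing the scalar curl with `(r/n) φ` differentiates the factor `r` as well. The extra term is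
  -- cancelled by the part `-⟨v_θ⟩/n` of the first component of `S^c v`, whose `z`-derivative leaves
  -- exactly the term `Q_r / n` of `S^d`.
  · have hφ' := hφ.const_mul_coord S.isOpen (1 / n)
    have i0 := (bA 0).integrableOn_mul hΩ (integrableOn_pd_test hφ' 1)
    have i1 := (bA 1).integrableOn_mul hΩ (integrableOn_pd_test hφ' 0)
    have i2 := (bS.integrableOn_mul hΩ (integrableOn_pd_test hφ 1)).const_mul (1 / n : ℝ)
    have i3 := ((bA 1).integrableOn_mul hΩ hφ.integrableOn).const_mul (1 / n : ℝ)
    have i4 := ((bR 1).integrableOn_mul hΩ hφ.integrableOn).const_mul (1 / n : ℝ)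
    have i5 := bD.integrableOn_mul hΩ hφ'.integrableOn
    have e1 : ∫ x in Ω, meshSd n l ρ T w x 1 * φ x
        = (∫ x in Ω, avgDet l ρ T (angField n w) x * (1 / n * x 0 * φ x))
          - 1 / n * ∫ x in Ω, avgCov l ρ T (rotField w) 1 x * φ x := by
      rw [← integral_const_mul, ← integral_sub i5 i4]
      refine setIntegral_congr_fun hΩ fun x hx => ?_
      simp only [meshSd, Matrix.cons_val]
      ring
    have e2 : ∫ x in Ω, (-(meshSc n l ρ T v x 0 * pd 1 φ x) + meshSc n l ρ T v x 2 * pd 0 φ x)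
        = ((∫ x in Ω, avgCov l ρ T (covField n v) 1 x * pd 0 (fun x => 1 / n * x 0 * φ x) x)
            - ∫ x in Ω, avgCov l ρ T (covField n v) 0 x * pd 1 (fun x => 1 / n * x 0 * φ x) x)
          + (1 / n * (∫ x in Ω, avgScalar l ρ T (fun z => v z 1) x * pd 1 φ x)
            - 1 / n * ∫ x in Ω, avgCov l ρ T (covField n v) 1 x * φ x) := by
      rw [← integral_const_mul, ← integral_const_mul, ← integral_sub i1 i0, ← integral_sub i2 i3,
        ← integral_add (Integrable.sub' i1 i0) (Integrable.sub' i2 i3)]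
      refine setIntegral_congr_fun hΩ fun x hx => ?_
      simp only [meshSc, Matrix.cons_val, hφ.pd_const_mul_coord, if_true, one_ne_zero, if_false]
      ring
    rw [e1, e2, keyD hφ, keyS φ hφ 1]
    ring
  · have e1 : ∫ x in Ω, ((n * meshSc n l ρ T v x 0 + meshSc n l ρ T v x 1) / x 0 * φ x
          - meshSc n l ρ T v x 1 * pd 0 φ x)
        = (∫ x in Ω, avgCov l ρ T (covField n v) 0 x * φ x)
          - ∫ x in Ω, avgScalar l ρ T (fun z => v z 1) x * pd 0 φ x := by
      rw [← integral_sub ((bA 0).integrableOn_mul hΩ hφ.integrableOn)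
        (bS.integrableOn_mul hΩ (integrableOn_pd_test hφ 0))]
      refine setIntegral_congr_fun hΩ fun x hx => ?_
      have hx0 := (hpos x hx).ne'
      simp only [meshSc, Matrix.cons_val]
      field_simp
      ring
    rw [e1, keyS φ hφ 0, sub_sub_cancel]
    rfl

/-- The planar divergence of `(w_r, w_z)`, that is the scalar curl of its rotation, equals `f + (n
w_θ - w_r)/r`. After averaging, the second summand is matched by the `θ`-component of `S^d w`, which
is defined so that `(n w_θ - w_r)/r` transforms as a density. -/
theorem hasDiv_meshSd (S : MeshSetup Ω Ω' T ρ) (hn : 0 < n) {w : Pt → Vec} {f : Pt → ℝ}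
    (hw : NiceField Ω' w) (hfm : Measurable f) (h : HasDiv n Ω' w f) :
    HasDiv n Ω (meshSd n l ρ T w) (avgDet l ρ T f) := by
  have hΩ := S.isOpen.measurableSet
  have hΩ' := S.isOpen'.measurableSet
  have hn' : (n : ℝ) ≠ 0 := Nat.cast_ne_zero.2 hn.ne'
  have hpos : ∀ x ∈ Ω, 0 < x 0 := fun x hx => S.pos x (S.subset hx)
  have hr := S.averageable_rotField hw
  have hb := S.averageable_angField (n := n) hw
  have hf := h.mem_div.averageable hΩ' S.pos hfm
  have hcurl : ∀ ψ, IsTest Ω' ψ → ∫ x in Ω', (f x + angField n w x) * ψ x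
      = -(∫ x in Ω', rotField w 0 x * pd 1 ψ x) + ∫ x in Ω', rotField w 1 x * pd 0 ψ x := by
    intro ψ hψ
    have i0 := S.integrableOn_averageable_mul_test hf hψ
    have i1 := S.integrableOn_averageable_mul_test hb hψ
    have i2 := S.integrableOn_averageable_mul_pd (hr 0) hψ 1
    have i3 := S.integrableOn_averageable_mul_pd (hr 1) hψ 0
    have e : ∫ x in Ω', (-(w x 0 * pd 0 ψ x) + (w x 0 - n * w x 1) / x 0 * ψ x
          - w x 2 * pd 1 ψ x)
        = (∫ x in Ω', rotField w 1 x * pd 0 ψ x) - (∫ x in Ω', angField n w x * ψ x)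
          - ∫ x in Ω', rotField w 0 x * pd 1 ψ x := by
      rw [← integral_sub i3 i1, ← integral_sub (Integrable.sub' i3 i1) i2]
      refine setIntegral_congr_fun hΩ' fun x hx => ?_
      simp only [rotField, angField, Matrix.cons_val_one, Matrix.cons_val_zero]
      ring
    simp only [add_mul]
    rw [integral_add i0 i1, h.eq ψ hψ, e]
    ring
  have bR := S.bddMeas_avgCov (l := l) hr
  have bD := S.bddMeas_avgDet (l := l) hb
  have bF := S.bddMeas_avgDet (l := l) hf
  refine ⟨fun i => (S.bddMeas_meshSd hw i).memL2r hΩ S.isBounded, bF.memL2r hΩ S.isBounded,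
    fun φ hφ => ?_⟩
  have i0 := bF.integrableOn_mul hΩ hφ.integrableOn
  have i1 := bD.integrableOn_mul hΩ hφ.integrableOn
  have i2 := (bR 0).integrableOn_mul hΩ (integrableOn_pd_test hφ 1)
  have i3 := (bR 1).integrableOn_mul hΩ (integrableOn_pd_test hφ 0)
  have key := S.avgDet_test (l := l) (hf.add hb) hr hcurl hφ
  have e1 : ∫ x in Ω, avgDet l ρ T (fun z => f z + angField n w z) x * φ x
      = (∫ x in Ω, avgDet l ρ T f x * φ x) + ∫ x in Ω, avgDet l ρ T (angField n w) x * φ x := by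
    rw [← integral_add i0 i1]
    refine setIntegral_congr_fun hΩ fun x hx => ?_
    simp only [S.avgDet_add hf hb hx, add_mul]
  have e2 : ∫ x in Ω, (-(meshSd n l ρ T w x 0 * pd 0 φ x)
        + (meshSd n l ρ T w x 0 - n * meshSd n l ρ T w x 1) / x 0 * φ x
        - meshSd n l ρ T w x 2 * pd 1 φ x)
      = (∫ x in Ω, avgCov l ρ T (rotField w) 1 x * pd 0 φ x)
        - (∫ x in Ω, avgDet l ρ T (angField n w) x * φ x)
        - ∫ x in Ω, avgCov l ρ T (rotField w) 0 x * pd 1 φ x := by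
    rw [← integral_sub i3 i1, ← integral_sub (Integrable.sub' i3 i1) i2]
    refine setIntegral_congr_fun hΩ fun x hx => ?_
    have hx0 := (hpos x hx).ne'
    simp only [meshSd, Matrix.cons_val]
    field_simp
    ring
  rw [e2]
  linarith

end MeshSetup

end CommutingSmoothers

/-! ### Passage to representatives and the empty mesh -/

noncomputable section Conclusion

open Filter Topology

variable {Ω Ω' : Set Pt} {T : Finset (Fin 3 → Pt)} {ρ : ℝ} {l n : ℕ}

theorem MemL2rVec.exists_niceField {U : Set Pt} (hU : MeasurableSet U) (hpos : ∀ x ∈ U, 0 < x 0)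
    {v : Pt → Vec} (h : MemL2rVec U v) :
    ∃ v' : Pt → Vec, NiceField U v' ∧
      ∀ i, (fun x => v x i) =ᵐ[volume.restrict U] fun x => v' x i := by
  obtain ⟨v', hv', he⟩ := h.exists_measurable hU hpos
  exact ⟨v', ⟨hv', fun i => (h i).congr (he i)⟩, he⟩

namespace MeshSetup

theorem hasGrad_glue (S : MeshSetup Ω Ω' T ρ) (hn : 0 < n) {u : Pt → ℝ} {g : Pt → Vec}
    (h : HasGrad n Ω' u g) :
    HasGrad n Ω (glue T (locSg n l ρ u)) (glue T (locSc n l ρ g)) := by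
  have hΩ' := S.isOpen'.measurableSet
  obtain ⟨u', hu', heu⟩ := h.mem.exists_measurable hΩ' S.pos
  obtain ⟨g₀, hg₀, heg₀⟩ := h.mem_grad.exists_niceField hΩ' S.pos
  -- The `θ`-component is defined from `u'`, so that `g_θ = -n u / r` holds at every point and can
  -- be substituted under integrals and averages without exceptional sets.
  let g' : Pt → Vec := fun z => ![g₀ z 0, -(n * u' z / z 0), g₀ z 2]
  have heg : ∀ i, (fun x => g x i) =ᵐ[volume.restrict Ω'] fun x => g' x i := by
    intro i
    fin_cases i
    · exact heg₀ 0
    · filter_upwards [h.eq_θ, heu] with x h1 h2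
      simp only [g', Fin.mk_one, Matrix.cons_val_one, Matrix.cons_val_zero, h1, h2]
      ring
    · exact heg₀ 2
  have hg' : NiceField Ω' g' := by
    refine ⟨fun i => ?_, fun i => (h.mem_grad i).congr (heg i)⟩
    fin_cases i
    · exact hg₀.measurable 0
    · exact ((hu'.const_mul (n : ℝ)).div (measurable_coord 0)).neg
    · exact hg₀.measurable 2
  have h' := h.congr heu heg
  have hf : Averageable Ω' fun z => n * u' z / z 0 := by
    simpa only [mul_div_assoc] using (h'.mem.averageable_div hΩ' S.pos hu').const_mul n
  exact (S.hasGrad_meshSg hn hu' hg' h' fun z => rfl).congr (S.ae_glue_locSg heu hf).symm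
    fun i => (S.ae_glue_locSc heg hg' i).symm

theorem hasCurl_glue (S : MeshSetup Ω Ω' T ρ) (hn : 0 < n) {v w : Pt → Vec}
    (h : HasCurl n Ω' v w) :
    HasCurl n Ω (glue T (locSc n l ρ v)) (glue T (locSd n l ρ w)) := by
  have hΩ' := S.isOpen'.measurableSet
  obtain ⟨v', hv', hev⟩ := h.mem.exists_niceField hΩ' S.pos
  obtain ⟨w', hw', hew⟩ := h.mem_curl.exists_niceField hΩ' S.pos
  exact (S.hasCurl_meshSc hn hv' hw' (h.congr hev hew)).congr
    (fun i => (S.ae_glue_locSc hev hv' i).symm) fun i => (S.ae_glue_locSd hew hw' i).symm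

theorem hasDiv_glue (S : MeshSetup Ω Ω' T ρ) (hn : 0 < n) {w : Pt → Vec} {f : Pt → ℝ}
    (h : HasDiv n Ω' w f) :
    HasDiv n Ω (glue T (locSd n l ρ w)) (glue T (locSo l ρ f)) := by
  have hΩ' := S.isOpen'.measurableSet
  obtain ⟨w', hw', hew⟩ := h.mem.exists_niceField hΩ' S.pos
  obtain ⟨f', hf', hef⟩ := h.mem_div.exists_measurable hΩ' S.pos
  have h' := h.congr hew hef
  exact (S.hasDiv_meshSd hn hw' hf' h').congr (fun i => (S.ae_glue_locSd hew hw' i).symm)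
    (S.ae_glue_locSo hef (h'.mem_div.averageable hΩ' S.pos hf')).symm

end MeshSetup

theorem meshSize_pos (hT : IsTriangulation Ω T) (hne : T.Nonempty) : 0 < meshSize T := by
  obtain ⟨K, hK⟩ := hne
  have hd : 0 < Metric.diam (tri K) := by
    refine Metric.diam_pos ⟨K 0, subset_convexHull ℝ _ ⟨0, rfl⟩, K 1,
      subset_convexHull ℝ _ ⟨1, rfl⟩, fun h => ?_⟩ (isCompact_tri K).isBounded
    exact absurd ((hT.nondegenerate K hK).injective h) (by decide)
  exact hd.trans_le (le_ciSup (f := fun K : {K // K ∈ T} => Metric.diam (tri K.1))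
    (Set.finite_range _).bddAbove ⟨K, hK⟩)

theorem hasGrad_empty (u : Pt → ℝ) (g : Pt → Vec) : HasGrad n ∅ u g := by
  constructor <;> simp [MemL2r, MemL2rVec, rMeasure]

theorem hasCurl_empty (v w : Pt → Vec) : HasCurl n ∅ v w := by
  constructor <;> simp [MemL2r, MemL2rVec, rMeasure]

theorem hasDiv_empty (w : Pt → Vec) (f : Pt → ℝ) : HasDiv n ∅ w f := by
  constructor <;> simp [MemL2r, MemL2rVec, rMeasure]

end Conclusion

/-- Functions on `Ω` are extended to `Ω'` before being evaluated at the points `x̃_y`. -/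
theorem proposition5p3 (n : ℕ) (hn : 0 < n) (l : ℕ) (Ω Ω' : Set Pt)
    (hΩ : IsOpen Ω) (hΩ' : IsOpen Ω') (hsub : Ω ⊆ Ω') (hpos : ∀ x ∈ Ω', 0 < x 0)
    (T : Finset (Fin 3 → Pt)) (hT : IsTriangulation Ω T)
    (δ : ℝ) (hδ : 0 < δ)
    (hhull : ∀ K ∈ T, interior (convexHull ℝ (⋃ i, disk (meshSize T * δ) (K i))) ⊆ Ω')
    (E : ExtensionOperators n Ω Ω') :
    (∀ u g, HasGrad n Ω u g →
      HasGrad n Ω (Sg n l T δ (E.E0 u)) (Sc n l T δ (E.E1 g))) ∧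
    (∀ v w, HasCurl n Ω v w →
      HasCurl n Ω (Sc n l T δ (E.E1 v)) (Sd n l T δ (E.E2 w))) ∧
    (∀ w f, HasDiv n Ω w f →
      HasDiv n Ω (Sd n l T δ (E.E2 w)) (So l T δ (E.E3 f))) := by
  -- For an empty mesh the supremum defining the mesh size is 0, so the radius is not positive; but
  -- then `Ω` is empty and all three assertions are vacuous.
  rcases T.eq_empty_or_nonempty with rfl | hne
  · have h0 : closure Ω = ∅ := by rw [← hT.cover]; simp
    obtain rfl : Ω = ∅ := closure_empty_iff Ω |>.1 h0
    exact ⟨fun _ _ _ => hasGrad_empty _ _, fun _ _ _ => hasCurl_empty _ _,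
      fun _ _ _ => hasDiv_empty _ _⟩
  · have S : MeshSetup Ω Ω' T (meshSize T * δ) :=
      ⟨hΩ, hΩ', hsub, hpos, hT, mul_pos (meshSize_pos hT hne) hδ, hhull⟩
    exact ⟨fun u g h => S.hasGrad_glue hn (E.comm_grad u g h),
      fun v w h => S.hasCurl_glue hn (E.comm_curl v w h),
      fun w f h => S.hasDiv_glue hn (E.comm_div w f h)⟩
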